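/- Let $(M,\bar h)$ be a compact smooth Riemannian manifold with boundary (of dimension $d\ge 1$) that is Ricci flat, with Levi-Civita connection $\bar\nabla$. Let $n$ be the outward unit normal of $\partial M$, $\bar k$ the induced metric on $\partial M$ and $\mathscr K(u,v)=\bar h(\bar\nabla_u n,v)$ the extrinsic curvature of $\partial M$. For a vector field $\sigma$ on $M$, $\sigma^a$ is its part tangential to $\partial M$; extending $n$ to a unit field near $\partial M$ and letting $\chi=\sigma-\bar h(\sigma,n)n$, $D^\perp\sigma^a$ denotes the tangential part of $\bar\nabla_n\chi$ on $\partial M$ (in a frame $e_a$ orthogonal to $n$: $n^i\partial_i\chi^a+\Gamma^a_b\chi^b$ with $\Gamma^a_b=n^ie^a_j\bar\nabla_ie^j_b$). Call a smooth vector field $\sigma$ *admissible* if it satisfies the momentum constraint $\bar\nabla^i\bar\nabla_{[i}\sigma_{j]}=0$ on $M$ and is boundary preserving, $n_i\sigma^i=0$ on $\partial M$. For a Riemannian metric $h$ on $M$ let $$\mathrm g_h(\delta_1h,\delta_2h)=\tfrac12\int_M\left(h^{ik}h^{jl}-h^{ij}h^{kl}\right)\delta_1h_{ij}\,\delta_2h_{kl}\,dV(h)$$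 be the DeWitt metric. For a vacuum $h=\phi^*\bar h$, with $\phi$ a diffeomorphism of $M$, and vector fields $\sigma_1,\sigma_2$, write $\mathrm g_h(\sigma_1,\sigma_2)$ for its value on the variations $\delta h_{ij}=\nabla_i\xi_j+\nabla_j\xi_i$ of $h$, where $\nabla$ is the Levi-Civita connection of $h$ and $\sigma=\phi_*\xi$. 1. For every $h=\phi^*\bar h$ and all admissible $\sigma_1,\sigma_2$, both integrands below are integrable and $$\mathrm g_h(\sigma_1,\sigma_2)=\oint_{\partial M}\left(\sigma_1^aD^\perp\sigma_{2\,a}-\mathscr K_{ab}\sigma_1^a\sigma_2^b\right)dV(\bar k).$$ 2. For every smooth function $\alpha$ on $M$ whose gradient is boundary preserving (that is, $n^i\partial_i\alpha=0$ on $\partial M$), one has on $\partial M$ $$D^\perp\partial_a\alpha=-\mathscr K_a^b\,\partial_b\alpha .$$ 3. If $\alpha,\beta$ are smooth functions that vanish on $\partial M$ and have boundary preserving gradients, and $\sigma_1,\sigma_2$ are admissible, then $\sigma_1+\bar\nabla\alpha$ and $\sigma_2+\bar\nabla\beta$ are admissible, and replacing $\sigma_1,\sigma_2$ by them changes neither the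 boundary integral in 1 nor $\mathrm g_h$, for any $h=\phi^*\bar h$. 4. The metric depends only on the tangential boundary vector fields: if $\sigma_1,\sigma_2,\tau_1,\tau_2$ are admissible and $\sigma_1^a=\tau_1^a$, $\sigma_2^a=\tau_2^a$ on $\partial M$, then the boundary integrals of $(\sigma_1,\sigma_2)$ and $(\tau_1,\tau_2)$ agree, and $\mathrm g_h(\sigma_1,\sigma_2)=\mathrm g_h(\tau_1,\tau_2)$ for every $h=\phi^*\bar h$. -/

import Mathlib

open Set MeasureTheory Bundle
open scoped Manifold ContDiff ENNReal

noncomputable section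

namespace VacuaMetric

/-- The model vector space `ℝᵈ`, `d = n + 1`. -/
abbrev Model (n : ℕ) : Type := EuclideanSpace ℝ (Fin (n + 1))

/-- The `i`-th standard basis vector of `ℝᵈ`. -/
abbrev stdVec {n : ℕ} (i : Fin (n + 1)) : Model n := EuclideanSpace.single i (1 : ℝ)

/-- Smooth Riemannian metrics on a `d`-dimensional manifold with boundary (`d = n + 1`), charts
taking values in the half space `{y | 0 ≤ y 0}`. -/
abbrev Metric (n : ℕ) (M : Type*) [TopologicalSpace M]
    [ChartedSpace (EuclideanHalfSpace (n + 1)) M] [IsManifold (𝓡∂ (n + 1)) ∞ M] : Type _ :=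
  ContMDiffRiemannianMetric (𝓡∂ (n + 1)) ∞ (Model n)
    (fun x : M => TangentSpace (𝓡∂ (n + 1)) x)

/-- Vector fields on `M` (no regularity included). -/
abbrev VField (n : ℕ) (M : Type*) [TopologicalSpace M]
    [ChartedSpace (EuclideanHalfSpace (n + 1)) M] : Type _ :=
  ∀ x : M, TangentSpace (𝓡∂ (n + 1)) x

/-- Fields of (covariant) 2-tensors on `M`, e.g. variations `δh` of a metric. -/
abbrev TensorField (n : ℕ) (M : Type*) [TopologicalSpace M]
    [ChartedSpace (EuclideanHalfSpace (n + 1)) M] : Type _ :=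
  ∀ x : M, TangentSpace (𝓡∂ (n + 1)) x → TangentSpace (𝓡∂ (n + 1)) x → ℝ

/-- The tangent vector at `x` with the given components. The tangent space `TangentSpace I x` is
the model space, through the preferred chart at `x`; so the vectors `tvec x (stdVec i)` are the
coordinate vectors `∂_i` of the chart at `x`. -/
def tvec {n : ℕ} {M : Type*} [TopologicalSpace M] [ChartedSpace (EuclideanHalfSpace (n + 1)) M]
    (x : M) (v : Model n) : TangentSpace (𝓡∂ (n + 1)) x := v

/-- The components of a tangent vector at `x` in the chart at `x`. -/
def tcomp {n : ℕ} {M : Type*} [TopologicalSpace M] [ChartedSpace (EuclideanHalfSpace (n + 1)) M]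
    {x : M} (v : TangentSpace (𝓡∂ (n + 1)) x) : Model n := v

/-- A tangent vector of the model vector space, as an element of that space. -/
def modelVec {n : ℕ} {y : Model n} (v : TangentSpace 𝓘(ℝ, Model n) y) : Model n := v

/-- A tangent vector of the real line, as a real number. -/
def realVec {t : ℝ} (v : TangentSpace 𝓘(ℝ, ℝ) t) : ℝ := v

section Coordinates

/-! ### Tensor calculus in a chart

Everything in this section is expressed in the coordinates of the preferred chart around a point
`c`; the variable `y` runs through the image of that chart. -/

variable {n : ℕ} {M : Type*} [TopologicalSpace M] [ChartedSpace (EuclideanHalfSpace (n + 1)) M]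

/-- The partial derivative `∂_k f` of a function on the half space. -/
def pd (k : Fin (n + 1)) (f : Model n → ℝ) (y : Model n) : ℝ :=
  fderivWithin ℝ f (range (𝓡∂ (n + 1))) y (stdVec k)

/-- The coordinate vector `∂_i` at the point with coordinates `y`. -/
def coordVec (c : M) (y : Model n) (i : Fin (n + 1)) :
    TangentSpace (𝓡∂ (n + 1)) ((extChartAt (𝓡∂ (n + 1)) c).symm y) :=
  mfderivWithin 𝓘(ℝ, Model n) (𝓡∂ (n + 1)) (extChartAt (𝓡∂ (n + 1)) c).symm
    (range (𝓡∂ (n + 1))) y (stdVec i : Model n)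

/-- The components `V^k` of a vector field. -/
def vecCoord (V : VField n M) (c : M) (y : Model n) (k : Fin (n + 1)) : ℝ :=
  modelVec (mfderiv (𝓡∂ (n + 1)) 𝓘(ℝ, Model n) (extChartAt (𝓡∂ (n + 1)) c)
    ((extChartAt (𝓡∂ (n + 1)) c).symm y) (V ((extChartAt (𝓡∂ (n + 1)) c).symm y))) k

variable [IsManifold (𝓡∂ (n + 1)) ∞ M]

/-- The components `h_ij` of a metric. -/
def metricCoord (h : Metric n M) (c : M) (y : Model n) :
    Matrix (Fin (n + 1)) (Fin (n + 1)) ℝ :=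
  Matrix.of fun i j =>
    h.inner ((extChartAt (𝓡∂ (n + 1)) c).symm y) (coordVec c y i) (coordVec c y j)

/-- The components `h^ij` of the inverse metric. -/
def invCoord (h : Metric n M) (c : M) (y : Model n) :
    Matrix (Fin (n + 1)) (Fin (n + 1)) ℝ :=
  (metricCoord h c y)⁻¹

/-- The Christoffel symbols `Γ^k_ij` of the Levi-Civita connection. -/
def christoffel (h : Metric n M) (c : M) (k i j : Fin (n + 1)) (y : Model n) : ℝ :=
  1 / 2 * ∑ l, invCoord h c y k l *
    (pd i (fun z => metricCoord h c z l j) y + pd j (fun z => metricCoord h c z l i) y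
      - pd l (fun z => metricCoord h c z i j) y)

/-- The components `R_ij` of the Ricci tensor. -/
def ricciCoord (h : Metric n M) (c : M) (i j : Fin (n + 1)) (y : Model n) : ℝ :=
  ∑ k, (pd k (christoffel h c k i j) y - pd j (christoffel h c k i k) y)
    + ∑ k, ∑ l, (christoffel h c k k l y * christoffel h c l i j y
      - christoffel h c k j l y * christoffel h c l i k y)

/-- `∇_i W^k` for a vector field with components `W^k`. -/
def covVec (h : Metric n M) (c : M) (W : Model n → Fin (n + 1) → ℝ) (i k : Fin (n + 1))
    (y : Model n) : ℝ :=
  pd i (fun z => W z k) y + ∑ l, christoffel h c k i l y * W y l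

/-- `∇_i ω_j` for a covector field with components `ω_j`. -/
def covCovec (h : Metric n M) (c : M) (w : Model n → Fin (n + 1) → ℝ) (i j : Fin (n + 1))
    (y : Model n) : ℝ :=
  pd i (fun z => w z j) y - ∑ k, christoffel h c k i j y * w y k

/-- `∇_k A_ij` for a 2-tensor field with components `A_ij`. -/
def covTensor (h : Metric n M) (c : M) (A : Fin (n + 1) → Fin (n + 1) → Model n → ℝ)
    (k i j : Fin (n + 1)) (y : Model n) : ℝ :=
  pd k (A i j) y - ∑ l, christoffel h c l k i y * A l j y
    - ∑ l, christoffel h c l k j y * A i l y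

/-- The lowered components `V_j = h_jk V^k` of a vector field. -/
def lowerCoord (h : Metric n M) (V : VField n M) (c : M) (y : Model n) (j : Fin (n + 1)) : ℝ :=
  ∑ k, metricCoord h c y j k * vecCoord V c y k

/-- `∇_[i V_j] = (∇_i V_j - ∇_j V_i) / 2`. -/
def antisymCoord (h : Metric n M) (V : VField n M) (c : M) (i j : Fin (n + 1)) (y : Model n) : ℝ :=
  1 / 2 * (covCovec h c (lowerCoord h V c) i j y - covCovec h c (lowerCoord h V c) j i y)

/-- The momentum constraint expression `𝒫_j(V) = ∇^i ∇_[i V_j]`. -/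
def momentumCoord (h : Metric n M) (V : VField n M) (c : M) (j : Fin (n + 1)) (y : Model n) : ℝ :=
  ∑ i, ∑ k, invCoord h c y i k * covTensor h c (antisymCoord h V c) k i j y

/-- The unit vector field `N^k = - h^{k0} / √h^{00}` orthogonal to the level sets of the boundary
defining coordinate `y 0`, and pointing towards decreasing `y 0`. At boundary points (`y 0 = 0`)
this is the outward unit normal of `∂M`; elsewhere it extends the normal off the boundary. -/
def normalCoord (h : Metric n M) (c : M) (y : Model n) (k : Fin (n + 1)) : ℝ :=
  - invCoord h c y k 0 / Real.sqrt (invCoord h c y 0 0)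

/-- The part orthogonal to `N` of a vector field with components `W^k`. -/
def orthPart (h : Metric n M) (c : M) (W : Model n → Fin (n + 1) → ℝ) (y : Model n)
    (k : Fin (n + 1)) : ℝ :=
  W y k - (∑ i, ∑ j, metricCoord h c y i j * W y i * normalCoord h c y j) * normalCoord h c y k

end Coordinates

section Manifold

variable {n : ℕ} {M : Type*} [TopologicalSpace M] [ChartedSpace (EuclideanHalfSpace (n + 1)) M]
  [IsManifold (𝓡∂ (n + 1)) ∞ M]

/-- `R_ij(h) = 0`. -/
def IsRicciFlat (h : Metric n M) : Prop :=
  ∀ c : M, ∀ y ∈ (extChartAt (𝓡∂ (n + 1)) c).target, ∀ i j, ricciCoord h c i j y = 0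

/-- `∇^i ∇_[i σ_j] = 0`. -/
def MomentumConstraint (h : Metric n M) (σ : VField n M) : Prop :=
  ∀ c : M, ∀ y ∈ (extChartAt (𝓡∂ (n + 1)) c).target, ∀ j, momentumCoord h σ c j y = 0

/-- The outward unit normal `n` at a boundary point. -/
def outwardNormal (h : Metric n M) (x : M) : TangentSpace (𝓡∂ (n + 1)) x :=
  tvec x (WithLp.toLp 2 (normalCoord h x (extChartAt (𝓡∂ (n + 1)) x x)))

/-- `n_i σ^i = 0` on `∂M`. -/
def BoundaryPreserving (h : Metric n M) (σ : VField n M) : Prop :=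
  ∀ x ∈ (𝓡∂ (n + 1)).boundary M, h.inner x (outwardNormal h x) (σ x) = 0

/-- Smooth boundary preserving solutions of the momentum constraint. -/
structure IsAdmissible (h : Metric n M) (σ : VField n M) : Prop where
  smooth : ContMDiff (𝓡∂ (n + 1)) (𝓡∂ (n + 1)).tangent ∞
    (fun x => (⟨x, σ x⟩ : TangentBundle (𝓡∂ (n + 1)) M))
  momentum : MomentumConstraint h σ
  boundaryPreserving : BoundaryPreserving h σ

/-- The part `σ^a` of `σ` tangential to `∂M` at a boundary point. -/
def tangentialPart (h : Metric n M) (σ : VField n M) (x : M) : TangentSpace (𝓡∂ (n + 1)) x :=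
  σ x - h.inner x (outwardNormal h x) (σ x) • outwardNormal h x

/-- The normal derivative `D^⊥ σ^a` at a boundary point: the tangential part of `∇_n χ`, where
`χ = χ^a e_a` is the tangential part of `σ` (near the boundary, with respect to an extension of
the normal). In a frame `e_a` of fields orthogonal to the normal its components are
`n^i ∂_i χ^a + Γ^a_b χ^b`, with `Γ^a_b = n^i e^a_j ∇_i e^j_b`. -/
def normalDeriv (h : Metric n M) (σ : VField n M) (x : M) : TangentSpace (𝓡∂ (n + 1)) x :=
  tvec x (WithLp.toLp 2 (orthPart h x
    (fun y k => ∑ i, normalCoord h x y i * covVec h x (orthPart h x (vecCoord σ x)) i k y)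
    (extChartAt (𝓡∂ (n + 1)) x x)))

/-- The extrinsic curvature `𝒦(u, v) = h(∇_u n, v)` of `∂M` at a boundary point, for `u`, `v`
tangent to `∂M` (`n` the outward unit normal, so that round balls have `𝒦 > 0`). -/
def extrinsicCurvature (h : Metric n M) (x : M) (u v : TangentSpace (𝓡∂ (n + 1)) x) : ℝ :=
  ∑ i, ∑ k, ∑ j, tcomp u i *
    covVec h x (normalCoord h x) i k (extChartAt (𝓡∂ (n + 1)) x x) *
    metricCoord h x (extChartAt (𝓡∂ (n + 1)) x x) k j * tcomp v j

/-- The gradient of a function, `(∇α)^i = h^ij ∂_j α`. -/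
def grad (h : Metric n M) (α : M → ℝ) : VField n M := fun x =>
  tvec x (WithLp.toLp 2 fun i => ∑ j, invCoord h x (extChartAt (𝓡∂ (n + 1)) x x) i j *
    realVec (mfderiv (𝓡∂ (n + 1)) 𝓘(ℝ, ℝ) α x (tvec x (stdVec j))))

/-- The variation `δh_ij = ∇_i ξ_j + ∇_j ξ_i` of `h` along the flow of `ξ`. -/
def deformation (h : Metric n M) (ξ : VField n M) : TensorField n M := fun x u v =>
  ∑ i, ∑ j, (covCovec h x (lowerCoord h ξ x) i j (extChartAt (𝓡∂ (n + 1)) x x)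
    + covCovec h x (lowerCoord h ξ x) j i (extChartAt (𝓡∂ (n + 1)) x x)) * tcomp u i * tcomp v j

/-- The function `(h^ik h^jl - h^ij h^kl) δ₁h_ij δ₂h_kl` on `M`. -/
def deWittDensity (h : Metric n M) (k₁ k₂ : TensorField n M) (x : M) : ℝ :=
  ∑ i, ∑ j, ∑ k, ∑ l,
    (invCoord h x (extChartAt (𝓡∂ (n + 1)) x x) i k * invCoord h x (extChartAt (𝓡∂ (n + 1)) x x) j l
      - invCoord h x (extChartAt (𝓡∂ (n + 1)) x x) i j *
        invCoord h x (extChartAt (𝓡∂ (n + 1)) x x) k l)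
    * k₁ x (tvec x (stdVec i)) (tvec x (stdVec j)) * k₂ x (tvec x (stdVec k)) (tvec x (stdVec l))

/-- `h = φ^* h'`. -/
def IsPullback (φ : M → M) (h' h : Metric n M) : Prop :=
  ∀ (x : M) (u v : TangentSpace (𝓡∂ (n + 1)) x),
    h.inner x u v = h'.inner (φ x) (mfderiv (𝓡∂ (n + 1)) (𝓡∂ (n + 1)) φ x u)
      (mfderiv (𝓡∂ (n + 1)) (𝓡∂ (n + 1)) φ x v)

/-- The function integrated over `∂M`: `σ₁^a D^⊥σ₂_a - 𝒦_ab σ₁^a σ₂^b`. -/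
def boundaryDensity (h : Metric n M) (σ₁ σ₂ : VField n M) (x : M) : ℝ :=
  h.inner x (tangentialPart h σ₁ x) (normalDeriv h σ₂ x)
    - extrinsicCurvature h x (tangentialPart h σ₁ x) (tangentialPart h σ₂ x)

variable [MeasurableSpace M]

/-- The Riemannian volume `√(det h_ij) dy` of the domain of a chart, as a measure on `M`. -/
def chartVolume (h : Metric n M) (c : M) : Measure M :=
  ((volume.restrict (extChartAt (𝓡∂ (n + 1)) c).target).withDensity
    fun y => ENNReal.ofReal (Real.sqrt (metricCoord h c y).det)).map
      (extChartAt (𝓡∂ (n + 1)) c).symm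

/-- The Riemannian volume measure: the smallest measure that dominates the volume of each chart
domain (so that on each chart domain it agrees with `√(det h_ij) dy`). -/
def riemVolume (h : Metric n M) : Measure M := ⨆ c : M, chartVolume h c

/-- The inclusion `y' ↦ (0, y')` of `ℝᵈ⁻¹` as the boundary of the half space. -/
def bdryIncl (y : EuclideanSpace ℝ (Fin n)) : Model n :=
  WithLp.toLp 2 (Fin.cons 0 fun i => y i)

/-- The volume, with respect to the induced metric on `∂M`, of the part of `∂M` in the domain of a
chart, as a measure on `M` carried by `∂M`. -/
def chartBdryVolume (h : Metric n M) (c : M) : Measure M :=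
  (((volume : Measure (EuclideanSpace ℝ (Fin n))).restrict
      (bdryIncl ⁻¹' (extChartAt (𝓡∂ (n + 1)) c).target)).withDensity
    fun y => ENNReal.ofReal
      (Real.sqrt ((metricCoord h c (bdryIncl y)).submatrix Fin.succ Fin.succ).det)).map
        fun y => (extChartAt (𝓡∂ (n + 1)) c).symm (bdryIncl y)

/-- The Riemannian volume measure of `∂M` with the induced metric, as a measure on `M`. -/
def bdryVolume (h : Metric n M) : Measure M := ⨆ c : M, chartBdryVolume h c

/-- The DeWitt metric
`g_h(δ₁h, δ₂h) = 1/2 ∫_M (h^ik h^jl - h^ij h^kl) δ₁h_ij δ₂h_kl dV(h)`. -/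
def deWitt (h : Metric n M) (k₁ k₂ : TensorField n M) : ℝ :=
  1 / 2 * ∫ x, deWittDensity h k₁ k₂ x ∂(riemVolume h)

/-- The DeWitt metric at the vacuum `h = φ^* h'` evaluated on the variations `L_{ξ₁} h`, `L_{ξ₂} h`
that move `h` within the space of vacua, expressed in terms of `σ_i = φ_* ξ_i`. -/
def vacuaMetric (h : Metric n M) (φ : M → M) (σ₁ σ₂ : VField n M) : ℝ :=
  deWitt h
    (deformation h (VectorField.mpullback (𝓡∂ (n + 1)) (𝓡∂ (n + 1)) φ σ₁))
    (deformation h (VectorField.mpullback (𝓡∂ (n + 1)) (𝓡∂ (n + 1)) φ σ₂))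

/-- `∮_∂M (σ₁^a D^⊥σ₂_a - 𝒦_ab σ₁^a σ₂^b) dV`. -/
def boundaryForm (h : Metric n M) (σ₁ σ₂ : VField n M) : ℝ :=
  ∫ x, boundaryDensity h σ₁ σ₂ x ∂(bdryVolume h)

end Manifold

end VacuaMetric

end

set_option linter.unusedSectionVars false
set_option autoImplicit false

noncomputable section

namespace VacuaMetric

namespace TensorAlgebra

/-! ### Tensor calculus over a commutative ring with commuting derivations -/

open Matrix

variable {ι A : Type*} [Fintype ι] [DecidableEq ι] [CommRing A] [Algebra ℝ A]

/-! The theorem is a Green formula. Let B_σ be the deformation ∇_iσ_j + ∇_jσ_i and T_σ = B_σ − (tr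
B_σ)·1, with one index raised (`momM`). The contracted Ricci identity gives div T_σ = 2∇^i∇_[iσ_j] +
2 Ric(σ, ·), so T_σ is divergence free when the metric is Ricci flat and σ solves the momentum
constraint (`divergence_momM`). For an arbitrary field V one then has div(T_σ V) = tr(T_σ ∇V), and
since B_σ is symmetric this is half the DeWitt contraction of B_V with B_σ
(`divergence_momM_mulVec`). The divergence theorem turns the DeWitt pairing into ∮ T_σ(n, V). If V
is tangential, the trace term drops out and B_σ(n, V) = h(∇_nσ, V) + h(n, ∇_Vσ) remains. The first
term is h(D^⊥σ, V). Differentiating h(n, σ) = 0 along the boundary identifies the second with −𝒦(V,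
σ) (`boundaryDensity_eq_self`).

In this argument only σ has to be admissible, while V is merely smooth and boundary preserving. So V
can be cut up by a partition of unity (`greenIdentity`), which reduces the formula to fields
supported in one chart (`greenIdentity_of_support`), where the divergence theorem on the half space
applies.

The passage from φ^*h̄ back to h̄ rests on naturality of the Lie derivative of the metric, of the
DeWitt contraction and of the Riemannian volume (`lieDeriv_natural`, `deWittDensity_natural`,
`map_riemVolume`). The same statements with φ = id give independence of the chart, which is needed
because all objects are defined through the preferred chart at each point.

The formula for D^⊥ of a gradient is the symmetry of the Hessian in the normal and a tangential
argument; the same symmetry shows that adding a gradient does not affect the momentum constraint.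
The boundary form visibly depends on its first field only through the tangential part on the
boundary. It is symmetric on admissible fields because the DeWitt metric is, so the same holds for
the second field (`boundaryForm_congr`). Gauge invariance is a special case: a boundary preserving
gradient of a function vanishing on the boundary is itself zero there (`grad_eq_zero`).

The tensor identities are proved over a commutative ring with commuting derivations, realized by
smooth functions on a chart; `Rep` carries them over to the coordinate expressions. -/

lemma map_mul_derivation (d : Derivation ℝ A A) (M N : Matrix ι ι A) :
    (M * N).map d = M.map d * N + M * N.map d := by
  ext i j
  simp [Matrix.mul_apply, Finset.sum_add_distrib, mul_comm, add_comm]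

lemma map_mulVec_derivation (d : Derivation ℝ A A) (M : Matrix ι ι A) (v : ι → A) :
    (fun i => d ((M *ᵥ v) i)) = M.map d *ᵥ v + M *ᵥ (fun i => d (v i)) := by
  ext i
  simp [Matrix.mulVec, dotProduct, Finset.sum_add_distrib, mul_comm, add_comm]

lemma map_one_derivation (d : Derivation ℝ A A) : (1 : Matrix ι ι A).map d = 0 := by
  ext i j
  by_cases h : i = j <;> simp [h]

lemma map_inv_derivation (d : Derivation ℝ A A) {g H : Matrix ι ι A} (hgH : g * H = 1) :
    H.map d = - (H * g.map d * H) := by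
  have hHg : H * g = 1 := mul_eq_one_comm.mp hgH
  have h := map_mul_derivation d g H
  rw [hgH, map_one_derivation] at h
  have h2 : H * (g.map d * H + g * H.map d) = 0 := by rw [← h]; simp
  rw [mul_add, ← mul_assoc, ← mul_assoc, hHg, one_mul] at h2
  exact eq_neg_of_add_eq_zero_right h2

/-- Keeping the product over the whole index set, with one factor replaced, lets each summand match
a term of the determinant of a matrix with one column differentiated. -/
lemma derivation_prod (d : Derivation ℝ A A) (s : Finset ι) (f : ι → A) :
    d (∏ i ∈ s, f i) = ∑ i ∈ s, ∏ j ∈ s, (if j = i then d (f j) else f j) := by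
  induction s using Finset.induction_on with
  | empty => simp
  | insert a s ha ih =>
    rw [Finset.prod_insert ha, Derivation.leibniz, ih, Finset.sum_insert ha, Finset.prod_insert ha]
    have h1 : ∏ j ∈ s, (if j = a then d (f j) else f j) = ∏ j ∈ s, f j :=
      Finset.prod_congr rfl fun j hj => if_neg (by rintro rfl; exact ha hj)
    rw [h1, if_pos rfl, smul_eq_mul, smul_eq_mul, mul_comm (∏ j ∈ s, f j), add_comm,
      Finset.mul_sum]
    congr 1
    refine Finset.sum_congr rfl fun i hi => ?_
    rw [Finset.prod_insert ha, if_neg (by rintro rfl; exact ha hi)]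

/-- Jacobi's formula. -/
lemma derivation_det (d : Derivation ℝ A A) {g H : Matrix ι ι A} (hgH : g * H = 1) :
    d g.det = g.det * (H * g.map d).trace := by
  have h1 : d g.det = ∑ i, (g.updateCol i fun j => d (g j i)).det := by
    simp only [Matrix.det_apply, map_sum]
    rw [Finset.sum_comm]
    refine Finset.sum_congr rfl fun σ _ => ?_
    rw [← Finset.smul_sum, Units.smul_def, Units.smul_def, map_zsmul, derivation_prod]
    congr 1
    refine Finset.sum_congr rfl fun i _ => Finset.prod_congr rfl fun j _ => ?_
    by_cases h : j = i
    · subst h; simp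
    · simp [h]
  -- By Cramer's rule each summand of `h1` is an entry of the adjugate applied to a differentiated
  -- column, and the adjugate is the determinant times the given inverse.
  have hadj : g.adjugate = g.det • H := by
    have : g.adjugate * (g * H) = g.det • H := by
      rw [← mul_assoc, Matrix.adjugate_mul, Matrix.smul_mul, one_mul]
    rwa [hgH, mul_one] at this
  rw [h1]
  simp only [← Matrix.cramer_apply, Matrix.cramer_eq_adjugate_mulVec, hadj]
  simp [Matrix.trace, Matrix.mulVec, dotProduct, Matrix.mul_apply, Finset.mul_sum, mul_assoc]

variable (D : ι → Derivation ℝ A A) (g H : Matrix ι ι A)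

/-- Christoffel symbols `Γ^k_ij`. -/
def chr (k i j : ι) : A :=
  (1 / 2 : ℝ) • ∑ l, H k l * (D i (g l j) + D j (g l i) - D l (g i j))

/-- The matrix `(Γ_m)^i_j = Γ^i_mj`. -/
def chrM (m : ι) : Matrix ι ι A := Matrix.of fun i j => chr D g H i m j

/-- Covariant derivative of a vector field. -/
def covV (m : ι) (v : ι → A) : ι → A := (fun i => D m (v i)) + chrM D g H m *ᵥ v

/-- Covariant derivative of a field of endomorphisms. -/
def covM (m : ι) (M : Matrix ι ι A) : Matrix ι ι A :=
  M.map (D m) + chrM D g H m * M - M * chrM D g H m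

/-- Covariant derivative of a covariant 2-tensor. -/
def covT (m : ι) (B : Matrix ι ι A) : Matrix ι ι A :=
  B.map (D m) - (chrM D g H m)ᵀ * B - B * chrM D g H m

/-- The endomorphism `N^k_i = ∇_i ζ^k`. -/
def nablaV (v : ι → A) : Matrix ι ι A := Matrix.of fun k i => covV D g H i v k

/-- The Ricci tensor. -/
def ric (i j : ι) : A :=
  ∑ k, (D k (chr D g H k i j) - D j (chr D g H k i k))
    + ∑ k, ∑ l, (chr D g H k k l * chr D g H l i j - chr D g H k j l * chr D g H l i k)

/-- The symmetrized covariant derivative `∇_i ζ_j + ∇_j ζ_i`. -/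
def lieM (v : ι → A) : Matrix ι ι A := g * nablaV D g H v + (g * nablaV D g H v)ᵀ

/-- The endomorphism `B^i_j - δ^i_j B^k_k` for `B = ∇_i ζ_j + ∇_j ζ_i`. -/
def momM (v : ι → A) : Matrix ι ι A :=
  H * lieM D g H v - (H * lieM D g H v).trace • (1 : Matrix ι ι A)

variable {D g H}

/-! ### The Levi-Civita connection in matrix form -/

lemma chr_symm (hg : gᵀ = g) (k i j : ι) : chr D g H k i j = chr D g H k j i := by
  have h : g i j = g j i := congrFun (congrFun hg j) i
  simp only [chr, h]
  congr 1
  refine Finset.sum_congr rfl fun l _ => ?_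
  ring

/-- Lowering the upper index cancels the inverse metric and leaves the Christoffel symbols of the
first kind. -/
lemma mul_chrM (hgH : g * H = 1) (m a i : ι) :
    (g * chrM D g H m) a i = (1 / 2 : ℝ) • (D m (g a i) + D i (g a m) - D a (g m i)) := by
  have : (g * chrM D g H m) a i =
      (1 / 2 : ℝ) • ((g * H) *ᵥ fun l => D m (g l i) + D i (g l m) - D l (g m i)) a := by
    rw [← Matrix.mulVec_mulVec]
    simp only [Matrix.mul_apply, chrM, chr, Matrix.mulVec, dotProduct, Matrix.of_apply,
      Finset.smul_sum, Finset.mul_sum, mul_smul_comm]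
  rw [this, hgH, Matrix.one_mulVec]

/-- This is ∇g = 0. In the sum of two first-kind symbols with outer indices exchanged, all
derivatives cancel except twice the derivative of the metric entry itself. -/
lemma map_metric (hg : gᵀ = g) (hgH : g * H = 1) (m : ι) :
    g.map (D m) = (chrM D g H m)ᵀ * g + g * chrM D g H m := by
  have h1 : (chrM D g H m)ᵀ * g = (g * chrM D g H m)ᵀ := by rw [Matrix.transpose_mul, hg]
  have hs : ∀ i j, g i j = g j i := fun i j => congrFun (congrFun hg j) i
  ext i j
  rw [h1, Matrix.add_apply, Matrix.transpose_apply, mul_chrM hgH, mul_chrM hgH, hs j i,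
    hs j m, hs m i, ← smul_add, Matrix.map_apply]
  have : D m (g i j) + D i (g m j) - D j (g i m) + (D m (g i j) + D j (g i m) - D i (g m j))
      = (2 : ℝ) • D m (g i j) := by rw [two_smul]; ring
  rw [this, smul_smul]; norm_num

lemma transpose_inv (hg : gᵀ = g) (hgH : g * H = 1) : Hᵀ = H := by
  have hHg : H * g = 1 := mul_eq_one_comm.mp hgH
  have h : Hᵀ * g = 1 := by
    have := congrArg Matrix.transpose hgH
    rwa [Matrix.transpose_mul, hg, Matrix.transpose_one] at this
  calc Hᵀ = Hᵀ * (g * H) := by rw [hgH, mul_one]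
    _ = H := by rw [← mul_assoc, h, one_mul]

lemma map_inv (hg : gᵀ = g) (hgH : g * H = 1) (m : ι) :
    H.map (D m) = - (H * (chrM D g H m)ᵀ) - chrM D g H m * H := by
  have hHg : H * g = 1 := mul_eq_one_comm.mp hgH
  rw [map_inv_derivation (D m) hgH, map_metric hg hgH]
  have : H * ((chrM D g H m)ᵀ * g + g * chrM D g H m) * H =
      H * (chrM D g H m)ᵀ * (g * H) + (H * g) * chrM D g H m * H := by noncomm_ring
  rw [this, hgH, hHg]; noncomm_ring

/-- Raising an index commutes with ∇ because the inverse metric is parallel (`map_inv`). -/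
lemma covM_inv_mul (hg : gᵀ = g) (hgH : g * H = 1) (m : ι) (B : Matrix ι ι A) :
    covM D g H m (H * B) = H * covT D g H m B := by
  rw [covM, covT, map_mul_derivation, map_inv hg hgH]; noncomm_ring

/-- The connection acts on endomorphisms by a commutator, which has trace zero. -/
lemma trace_covM (m : ι) (M : Matrix ι ι A) : (covM D g H m M).trace = D m M.trace := by
  rw [covM, Matrix.trace_sub, Matrix.trace_add, Matrix.trace_mul_comm (chrM D g H m)]
  simp [Matrix.trace]

lemma covM_smul_one (m : ι) (a : A) :
    covM D g H m (a • (1 : Matrix ι ι A)) = D m a • (1 : Matrix ι ι A) := by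
  rw [covM]
  simp only [Matrix.mul_smul, Matrix.smul_mul, mul_one, one_mul, add_sub_cancel_right]
  ext i j
  by_cases h : i = j <;> simp [h]

lemma covM_sub (m : ι) (M N : Matrix ι ι A) :
    covM D g H m (M - N) = covM D g H m M - covM D g H m N := by
  have : (M - N).map (D m) = M.map (D m) - N.map (D m) := by ext; simp
  rw [covM, covM, covM, this]; noncomm_ring

lemma covT_add (m : ι) (M N : Matrix ι ι A) :
    covT D g H m (M + N) = covT D g H m M + covT D g H m N := by
  have : (M + N).map (D m) = M.map (D m) + N.map (D m) := by ext; simp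
  rw [covT, covT, covT, this]; noncomm_ring

lemma covT_sub (m : ι) (M N : Matrix ι ι A) :
    covT D g H m (M - N) = covT D g H m M - covT D g H m N := by
  have : (M - N).map (D m) = M.map (D m) - N.map (D m) := by ext; simp
  rw [covT, covT, covT, this]; noncomm_ring

lemma covT_apply (m i j : ι) (M : Matrix ι ι A) :
    covT D g H m M i j = D m (M i j) - ∑ l, chr D g H l m i * M l j
      - ∑ l, chr D g H l m j * M i l := by
  simp [covT, Matrix.mul_apply, chrM, mul_comm]

lemma covT_smul (m : ι) (r : ℝ) (M : Matrix ι ι A) :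
    covT D g H m (r • M) = r • covT D g H m M := by
  have : (r • M).map (D m) = r • M.map (D m) := by ext; simp
  rw [covT, covT, this]
  simp only [Matrix.mul_smul, Matrix.smul_mul, smul_sub]

lemma covT_transpose (m : ι) (M : Matrix ι ι A) :
    covT D g H m Mᵀ = (covT D g H m M)ᵀ := by
  rw [covT, covT, Matrix.transpose_sub, Matrix.transpose_sub, Matrix.transpose_mul,
    Matrix.transpose_mul, Matrix.transpose_transpose, Matrix.transpose_map]
  noncomm_ring

lemma covV_mulVec (m : ι) (M : Matrix ι ι A) (v : ι → A) :
    covV D g H m (M *ᵥ v) = covM D g H m M *ᵥ v + M *ᵥ covV D g H m v := by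
  rw [covV, map_mulVec_derivation, covM, covV]
  simp only [Matrix.add_mulVec, Matrix.sub_mulVec, Matrix.mulVec_add, Matrix.mulVec_mulVec]
  abel

/-- Metric compatibility. -/
lemma derivation_inner (hg : gᵀ = g) (hgH : g * H = 1) (m : ι) (u v : ι → A) :
    D m (u ⬝ᵥ g *ᵥ v) = covV D g H m u ⬝ᵥ g *ᵥ v + u ⬝ᵥ g *ᵥ covV D g H m v := by
  have h1 : D m (u ⬝ᵥ g *ᵥ v) =
      (fun i => D m (u i)) ⬝ᵥ g *ᵥ v + u ⬝ᵥ (fun i => D m ((g *ᵥ v) i)) := by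
    simp [dotProduct, Finset.sum_add_distrib, mul_comm, add_comm]
  have h2 : u ⬝ᵥ ((chrM D g H m)ᵀ * g) *ᵥ v = (chrM D g H m *ᵥ u) ⬝ᵥ g *ᵥ v := by
    rw [← Matrix.mulVec_mulVec, Matrix.dotProduct_mulVec, Matrix.vecMul_transpose]
  rw [h1, map_mulVec_derivation, map_metric hg hgH]
  simp only [covV, Matrix.add_mulVec, Matrix.mulVec_add, dotProduct_add, add_dotProduct, h2,
    Matrix.mulVec_mulVec]
  ring

/-! ### The Ricci identity and the divergence of `momM` -/

/-- The contracted Ricci identity. -/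
lemma contracted_ricci_identity (hD : ∀ i j a, D i (D j a) = D j (D i a)) (hg : gᵀ = g)
    (v : ι → A) (j : ι) :
    ∑ k, covM D g H k (nablaV D g H v) k j - (covM D g H j (nablaV D g H v)).trace =
      ∑ l, ric D g H l j * v l := by
  rw [trace_covM]
  simp only [covM, Matrix.add_apply, Matrix.sub_apply, Matrix.map_apply, Matrix.mul_apply, chrM,
    nablaV, covV, Pi.add_apply, Matrix.mulVec, dotProduct, Matrix.of_apply, map_add, map_sum,
    Derivation.leibniz, smul_eq_mul, Matrix.trace, Matrix.diag_apply, ric, Finset.sum_mul, add_mul,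
    sub_mul, mul_add, Finset.mul_sum, Finset.sum_add_distrib, Finset.sum_sub_distrib]
  -- Second derivatives of `v` cancel since the derivations commute. The identities `e2` to `e6`
  -- rename summation indices and use the symmetry of the lower indices of Γ, after which both sides
  -- agree term by term.
  have e1 : ∑ x, D x (D j (v x)) = ∑ x, D j (D x (v x)) :=
    Finset.sum_congr rfl fun x _ => hD _ _ _
  have e2 : ∑ x, ∑ y, chr D g H x j y * D x (v y) = ∑ x, ∑ y, D y (v x) * chr D g H y x j := by
    rw [Finset.sum_comm]
    exact Finset.sum_congr rfl fun x _ => Finset.sum_congr rfl fun y _ => by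
      rw [chr_symm hg, mul_comm]
  have e3 : ∑ x, ∑ y, v y * D x (chr D g H x j y) = ∑ x, ∑ y, D y (chr D g H y x j) * v x := by
    rw [Finset.sum_comm]
    exact Finset.sum_congr rfl fun x _ => Finset.sum_congr rfl fun y _ => by
      rw [chr_symm hg, mul_comm]
  have e4 : ∑ x, ∑ y, v y * D j (chr D g H x x y) = ∑ x, ∑ y, D j (chr D g H y x y) * v x := by
    rw [Finset.sum_comm]
    exact Finset.sum_congr rfl fun x _ => Finset.sum_congr rfl fun y _ => by
      rw [chr_symm hg y y x, mul_comm]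
  have e5 : ∑ x, ∑ y, ∑ z, chr D g H x x y * (chr D g H y j z * v z) =
      ∑ x, ∑ y, ∑ z, chr D g H y y z * chr D g H z x j * v x := by
    simp_rw [Finset.sum_comm (f := fun y z => chr D g H _ _ y * _)]
    rw [Finset.sum_comm]
    exact Finset.sum_congr rfl fun x _ => Finset.sum_congr rfl fun y _ =>
      Finset.sum_congr rfl fun z _ => by rw [chr_symm hg z j x]; ring
  have e6 : ∑ x, ∑ y, ∑ z, chr D g H x y z * v z * chr D g H y x j =
      ∑ x, ∑ y, ∑ z, chr D g H y j z * chr D g H z x y * v x := by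
    have : ∀ x, ∑ y, ∑ z, chr D g H x y z * v z * chr D g H y x j =
        ∑ z, ∑ y, chr D g H x y z * v z * chr D g H y x j := fun x => Finset.sum_comm
    simp_rw [this]
    rw [Finset.sum_comm]
    refine Finset.sum_congr rfl fun x _ => ?_
    rw [Finset.sum_comm]
    exact Finset.sum_congr rfl fun y _ =>
      Finset.sum_congr rfl fun z _ => by rw [chr_symm hg y j z, chr_symm hg z x y]; ring
  rw [e1, e2, e3, e4, e5, e6]
  abel

/-- The divergence of `momM` vanishes for Ricci flat metrics and solutions of the momentum
constraint. -/
lemma divergence_momM (hD : ∀ i j a, D i (D j a) = D j (D i a)) (hg : gᵀ = g) (hgH : g * H = 1)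
    (v : ι → A) (j : ι) :
    ∑ i, covM D g H i (momM D g H v) i j =
      ∑ i, ∑ k, H i k * covT D g H k ((g * nablaV D g H v)ᵀ - g * nablaV D g H v) i j
        + (2 : ℝ) • ∑ l, ric D g H l j * v l := by
  have hHg : H * g = 1 := mul_eq_one_comm.mp hgH
  have hH : Hᵀ = H := transpose_inv hg hgH
  set N := nablaV D g H v with hN
  have hcov : ∀ m, H * covT D g H m (g * N) = covM D g H m N := fun m => by
    rw [← covM_inv_mul hg hgH, ← mul_assoc, hHg, one_mul]
  -- The two halves of the symmetrized derivative have the same trace, so the trace part of `momM`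
  -- contributes 2 ∇_j tr N.
  have htr : ∀ m, (H * (covT D g H m (g * N))ᵀ).trace = (covM D g H m N).trace := fun m => by
    rw [← hcov m, ← Matrix.trace_transpose, Matrix.transpose_mul, Matrix.transpose_transpose, hH,
      Matrix.trace_mul_comm]
  have hmom : ∑ i, ∑ k, H i k * covT D g H k ((g * N)ᵀ - g * N) i j =
      ∑ k, (H * (covT D g H k (g * N))ᵀ) k j - ∑ k, covM D g H k N k j := by
    rw [Finset.sum_comm, ← Finset.sum_sub_distrib]
    refine Finset.sum_congr rfl fun k _ => ?_
    rw [← hcov k, covT_sub, covT_transpose, Matrix.mul_apply, Matrix.mul_apply,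
      ← Finset.sum_sub_distrib]
    refine Finset.sum_congr rfl fun i _ => ?_
    have : H i k = H k i := congrFun (congrFun hH k) i
    rw [this, Matrix.sub_apply, mul_sub]
  have hE : ∑ i, covM D g H i (momM D g H v) i j =
      ∑ k, covM D g H k N k j + ∑ k, (H * (covT D g H k (g * N))ᵀ) k j
        - (2 : ℝ) • (covM D g H j N).trace := by
    have h1 : ∀ i, covM D g H i (momM D g H v) i j = covM D g H i N i j
        + (H * (covT D g H i (g * N))ᵀ) i j
        - (2 : ℝ) • ((covM D g H i N).trace * (1 : Matrix ι ι A) i j) := fun i => by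
      rw [momM, covM_sub, covM_smul_one, ← trace_covM, covM_inv_mul hg hgH, lieM, covT_add,
        covT_transpose, ← hN, mul_add, Matrix.trace_add, htr, hcov, two_smul]
      simp [add_mul]
    simp_rw [h1]
    rw [Finset.sum_sub_distrib, Finset.sum_add_distrib, ← Finset.smul_sum]
    simp [Matrix.one_apply]
  -- The transposed term ∇^k∇_kζ_j occurs in both `hE` and `hmom`. In the difference only 2(∇_kN^k_j
  -- − ∇_j tr N) is left, which is twice the contracted Ricci identity.
  rw [hE, hmom, ← contracted_ricci_identity hD hg v j, ← hN]
  simp only [two_smul]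
  abel

lemma divergence_momM_eq_zero (hD : ∀ i j a, D i (D j a) = D j (D i a)) (hg : gᵀ = g)
    (hgH : g * H = 1) (v : ι → A) (hric : ∀ i j, ric D g H i j = 0) (j : ι)
    (hmom : ∑ i, ∑ k, H i k * covT D g H k ((1 / 2 : ℝ) •
      ((g * nablaV D g H v)ᵀ - g * nablaV D g H v)) i j = 0) :
    ∑ i, covM D g H i (momM D g H v) i j = 0 := by
  rw [divergence_momM hD hg hgH]
  have h1 := congrArg (fun a => (2 : ℝ) • a) hmom
  simp only [covT_smul, Matrix.smul_apply, mul_smul_comm, ← Finset.smul_sum, smul_smul,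
    smul_zero] at h1
  norm_num at h1
  simp [hric, h1]

/-- The divergence identity behind the reduction to the boundary. -/
lemma divergence_momM_mulVec (hg : gᵀ = g) (hgH : g * H = 1) {w : A}
    (hw : ∀ m, D m w = w * (chrM D g H m).trace) (u v : ι → A)
    (hdiv : ∀ j, ∑ i, covM D g H i (momM D g H v) i j = 0) :
    ∑ i, D i (w * (momM D g H v *ᵥ u) i) = w * ((1 / 2 : ℝ) •
      ((H * lieM D g H u * H * lieM D g H v).trace
        - (H * lieM D g H u).trace * (H * lieM D g H v).trace)) := by
  have hHg : H * g = 1 := mul_eq_one_comm.mp hgH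
  have hH : Hᵀ = H := transpose_inv hg hgH
  set T := momM D g H v with hT
  -- For a density w with the derivative of √det g, the coordinate divergence of wX is w ∇_iX^i; the
  -- contraction of Γ has to be matched with its trace by symmetry of the lower indices.
  have h1 : ∑ i, D i (w * (T *ᵥ u) i) = w * ∑ i, covV D g H i (T *ᵥ u) i := by
    have hΓ : ∑ i, (chrM D g H i *ᵥ (T *ᵥ u)) i = ∑ i, (chrM D g H i).trace * (T *ᵥ u) i := by
      simp only [Matrix.mulVec, dotProduct, Matrix.trace, Matrix.diag_apply, chrM,
        Matrix.of_apply, Finset.sum_mul]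
      rw [Finset.sum_comm]
      exact Finset.sum_congr rfl fun x _ => Finset.sum_congr rfl fun y _ => by rw [chr_symm hg]
    simp only [covV, Pi.add_apply, Finset.sum_add_distrib, hΓ, Derivation.leibniz, hw, smul_eq_mul]
    rw [mul_add, Finset.mul_sum, Finset.mul_sum]
    congr 1
    exact Finset.sum_congr rfl fun x _ => by ring
  -- Leibniz rule: the term with div T vanishes by hypothesis, and T contracted with ∇u remains.
  have h2 : ∑ i, covV D g H i (T *ᵥ u) i = (T * nablaV D g H u).trace := by
    simp only [covV_mulVec, Pi.add_apply, Finset.sum_add_distrib]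
    have : ∑ i, (covM D g H i T *ᵥ u) i = 0 := by
      simp only [Matrix.mulVec, dotProduct]
      rw [Finset.sum_comm]
      simp_rw [← Finset.sum_mul, hdiv]
      simp
    rw [this, zero_add]
    simp [Matrix.trace, Matrix.mul_apply, Matrix.mulVec, dotProduct, nablaV]
  set N := nablaV D g H u with hN
  set L := lieM D g H v with hL
  have hLt : Lᵀ = L := by rw [hL, lieM]; simp [add_comm]
  have h3 : H * lieM D g H u = N + H * Nᵀ * g := by
    rw [lieM, mul_add, ← mul_assoc, hHg, one_mul, Matrix.transpose_mul, hg, mul_assoc]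
  have h4 : (N + H * Nᵀ * g).trace = (2 : ℝ) • N.trace := by
    rw [Matrix.trace_add, Matrix.trace_mul_cycle, hgH, one_mul, Matrix.trace_transpose, two_smul]
  -- Paired with the symmetric L, the derivative N and its metric adjoint contribute equally. This
  -- factor 2, and that in `h4`, produce the factor 1/2 in the statement.
  have h5 : ((N + H * Nᵀ * g) * H * L).trace = (2 : ℝ) • (H * L * N).trace := by
    have e1 : (N + H * Nᵀ * g) * H * L = N * H * L + H * Nᵀ * (g * H) * L := by noncomm_ring
    have e2 : (H * Nᵀ * L).trace = (H * L * N).trace := by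
      rw [← Matrix.trace_transpose]
      simp only [Matrix.transpose_mul, Matrix.transpose_transpose, hH, hLt]
      rw [Matrix.trace_mul_comm, Matrix.trace_mul_comm, ← mul_assoc, Matrix.trace_mul_cycle,
        Matrix.trace_mul_cycle]
    rw [e1, hgH, mul_one, Matrix.trace_add, e2, Matrix.trace_mul_cycle, Matrix.trace_mul_cycle,
      two_smul]
  have h6 : (T * N).trace = (H * L * N).trace - (H * L).trace * N.trace := by
    rw [hT, momM, sub_mul, Matrix.trace_sub, Matrix.smul_mul, one_mul, Matrix.trace_smul,
      smul_eq_mul]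
  rw [h1, h2, h3, h4, h5, h6, smul_mul_assoc, ← smul_sub, smul_smul]
  norm_num
  ring

/-- The derivative of the volume density. -/
lemma derivation_volume (hg : gᵀ = g) (hgH : g * H = 1) {w w' : A} (hw : w * w = g.det)
    (hw' : w * w' = 1) (m : ι) : D m w = w * (chrM D g H m).trace := by
  have hHg : H * g = 1 := mul_eq_one_comm.mp hgH
  have h := derivation_det (D m) hgH
  have h1 : (H * g.map (D m)).trace = (2 : ℝ) • (chrM D g H m).trace := by
    rw [map_metric hg hgH, mul_add, ← mul_assoc, ← mul_assoc, hHg, one_mul, Matrix.trace_add,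
      Matrix.trace_mul_cycle, hgH, one_mul, Matrix.trace_transpose, two_smul]
  rw [h1, ← hw, Derivation.leibniz, smul_eq_mul, ← two_smul ℝ (w * D m w), mul_smul_comm] at h
  have h2 : w * D m w = w * w * (chrM D g H m).trace := by
    have := congrArg (fun a => (1 / 2 : ℝ) • a) h
    simpa [smul_smul] using this
  -- The derivative of w² = det g determines w·D_m w; the explicit inverse `w'` is what permits
  -- cancelling w in a ring.
  calc D m w = (w * w') * D m w := by rw [hw', one_mul]
    _ = w' * (w * D m w) := by ring
    _ = (w * w') * (w * (chrM D g H m).trace) := by rw [h2]; ring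
    _ = _ := by rw [hw', one_mul]

/-! ### Lowered derivatives, Hessians and Lie derivatives -/

/-- Lowering an index commutes with covariant differentiation. -/
lemma mul_nablaV (hg : gᵀ = g) (hgH : g * H = 1) (v : ι → A) (i j : ι) :
    (g * nablaV D g H v) j i = D i ((g *ᵥ v) j) - ∑ k, chr D g H k i j * (g *ᵥ v) k := by
  have h1 : (g * nablaV D g H v) j i = (g *ᵥ covV D g H i v) j := by
    simp [Matrix.mul_apply, Matrix.mulVec, dotProduct, nablaV]
  have h2 := congrFun (map_mulVec_derivation (D i) g v) j
  rw [map_metric hg hgH, Matrix.add_mulVec] at h2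
  have h3 : (((chrM D g H i)ᵀ * g) *ᵥ v) j = ∑ k, chr D g H k i j * (g *ᵥ v) k := by
    rw [← Matrix.mulVec_mulVec]
    simp [Matrix.mulVec, dotProduct, chrM]
  rw [h1, h2, covV, Matrix.mulVec_add, Matrix.mulVec_mulVec, Pi.add_apply, Pi.add_apply,
    Pi.add_apply, h3]
  ring

/-- The Hessian is symmetric. -/
lemma transpose_mul_nablaV_grad (hD : ∀ i j a, D i (D j a) = D j (D i a)) (hg : gᵀ = g)
    (hgH : g * H = 1) (a : A) :
    (g * nablaV D g H (H *ᵥ fun j => D j a))ᵀ = g * nablaV D g H (H *ᵥ fun j => D j a) := by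
  ext i j
  rw [Matrix.transpose_apply, mul_nablaV hg hgH, mul_nablaV hg hgH, Matrix.mulVec_mulVec, hgH,
    Matrix.one_mulVec, hD]
  simp_rw [chr_symm hg _ i j]

/-- The Lie derivative of the metric. -/
lemma lieM_apply (hg : gᵀ = g) (hgH : g * H = 1) (v : ι → A) (i j : ι) :
    lieM D g H v i j = ∑ k, v k * D k (g i j) + ∑ k, g k j * D i (v k) + ∑ k, g i k * D j (v k) := by
  have hs : ∀ i j, g i j = g j i := fun i j => congrFun (congrFun hg j) i
  have h1 : ∀ i j, (g * nablaV D g H v) i j =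
      ∑ k, g i k * D j (v k) + ∑ l, (g * chrM D g H j) i l * v l := fun i j => by
    have e1 : (g * nablaV D g H v) i j = (g *ᵥ covV D g H j v) i := by
      simp [Matrix.mul_apply, Matrix.mulVec, dotProduct, nablaV]
    rw [e1, covV, Matrix.mulVec_add, Matrix.mulVec_mulVec]
    rfl
  -- On symmetrizing, the connection terms add up to the derivative of the metric, so the result no
  -- longer involves Γ. This is the form of the deformation whose naturality is an exercise in the
  -- chain rule.
  have h2 : ∀ l, (g * chrM D g H j) i l * v l + (g * chrM D g H i) j l * v l =
      v l * D l (g i j) := fun l => by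
    rw [mul_chrM hgH, mul_chrM hgH, ← add_mul, ← smul_add, hs j l, hs j i]
    have : D j (g i l) + D l (g i j) - D i (g l j) + (D i (g l j) + D l (g i j) - D j (g i l))
        = (2 : ℝ) • D l (g i j) := by rw [two_smul]; ring
    rw [this, smul_smul]
    norm_num [mul_comm]
  rw [lieM, Matrix.add_apply, Matrix.transpose_apply, h1, h1]
  simp_rw [← h2, Finset.sum_add_distrib, hs j]
  ring

lemma dotProduct_mul_nablaV (v p u : ι → A) : p ⬝ᵥ (g * nablaV D g H v) *ᵥ u =
    ∑ i, u i * (p ⬝ᵥ g *ᵥ covV D g H i v) := by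
  rw [← Matrix.mulVec_mulVec]
  have : nablaV D g H v *ᵥ u = ∑ i, u i • covV D g H i v := by
    ext k
    simp [Matrix.mulVec, dotProduct, nablaV, mul_comm]
  rw [this, Matrix.mulVec_sum, dotProduct_sum]
  simp [Matrix.mulVec_smul]

/-- To be used with p the normal and u tangential: the two sums then become the extrinsic curvature
term and the normal derivative term of the boundary integrand. -/
lemma dotProduct_lieM (v p u : ι → A) :
    p ⬝ᵥ lieM D g H v *ᵥ u = ∑ i, u i * (p ⬝ᵥ g *ᵥ covV D g H i v)
      + ∑ i, p i * (u ⬝ᵥ g *ᵥ covV D g H i v) := by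
  rw [lieM, Matrix.add_mulVec, dotProduct_add, dotProduct_mul_nablaV,
    ← dotProduct_mul_nablaV v u p, Matrix.mulVec_transpose,
    Matrix.dotProduct_mulVec u, dotProduct_comm p (u ᵥ* _)]

/-! ### Pointwise identities at the boundary -/

variable {R : Type*} [CommRing R]

/-- The part of `v` orthogonal to the unit vector field `p`. -/
def orthV (g : Matrix ι ι A) (p v : ι → A) : ι → A := v - (v ⬝ᵥ g *ᵥ p) • p

/-- The normal derivative of the tangential part, at a point where `v` and `u` are tangential. -/
lemma eval_inner_normal_derivative (ev : A →+* R) (p u v : ι → A)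
    (hv : ev (v ⬝ᵥ g *ᵥ p) = 0) (hu : ev (u ⬝ᵥ g *ᵥ p) = 0) :
    ev (u ⬝ᵥ g *ᵥ orthV g p (∑ i, p i • covV D g H i (orthV g p v))) =
      ev (∑ i, p i * (u ⬝ᵥ g *ᵥ covV D g H i v)) := by
  -- Besides ∇_iv, differentiating the projection creates a multiple of p, which disappears on
  -- pairing with u, and a multiple of h(v, p), which disappears under evaluation. No derivative of
  -- h(v, p) has to vanish.
  have h1 : ∀ i, covV D g H i (orthV g p v) = covV D g H i v
      - D i (v ⬝ᵥ g *ᵥ p) • p - (v ⬝ᵥ g *ᵥ p) • covV D g H i p := fun i => by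
    ext k
    simp only [covV, orthV, Pi.add_apply, Pi.sub_apply, Pi.smul_apply, smul_eq_mul, map_sub,
      Derivation.leibniz, Matrix.mulVec_sub, Matrix.mulVec_smul]
    ring
  have h2 : ∀ w, ev (u ⬝ᵥ g *ᵥ orthV g p w) = ev (u ⬝ᵥ g *ᵥ w) := fun w => by
    rw [orthV, Matrix.mulVec_sub, Matrix.mulVec_smul, dotProduct_sub, dotProduct_smul, map_sub,
      smul_eq_mul, map_mul, hu, mul_zero, sub_zero]
  rw [h2, Matrix.mulVec_sum, dotProduct_sum, map_sum, map_sum]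
  refine Finset.sum_congr rfl fun i _ => ?_
  rw [h1, Matrix.mulVec_smul, dotProduct_smul, Matrix.mulVec_sub, Matrix.mulVec_sub,
    Matrix.mulVec_smul, Matrix.mulVec_smul, dotProduct_sub, dotProduct_sub, dotProduct_smul,
    dotProduct_smul]
  simp only [smul_eq_mul, map_mul, map_sub, hv, hu]
  ring

/-- The second fundamental form, at a point where `v` is tangential to first order along `u`. -/
lemma eval_extrinsic (hg : gᵀ = g) (hgH : g * H = 1) (ev : A →+* R) (p u v : ι → A)
    (hv : ev (∑ i, u i * D i (p ⬝ᵥ g *ᵥ v)) = 0) :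
    ev (∑ i, u i * (covV D g H i p ⬝ᵥ g *ᵥ v)) =
      - ev (∑ i, u i * (p ⬝ᵥ g *ᵥ covV D g H i v)) := by
  -- By metric compatibility the two sides differ by the derivative of h(p, v) along u.
  rw [eq_neg_iff_add_eq_zero, ← map_add, ← hv, ← Finset.sum_add_distrib]
  congr 1
  refine Finset.sum_congr rfl fun i _ => ?_
  rw [derivation_inner hg hgH, mul_add]

end TensorAlgebra
end VacuaMetric
end

noncomputable section

namespace VacuaMetric

/-! ### Smooth functions on relatively open subsets of the half space -/

variable {n : ℕ}

/-- The closed half space. -/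
abbrev halfSpace (n : ℕ) : Set (Model n) := range (𝓡∂ (n + 1))

lemma halfSpace_eq : halfSpace n = {y | 0 ≤ y 0} := range_modelWithCornersEuclideanHalfSpace _

lemma uniqueDiffOn_halfSpace : UniqueDiffOn ℝ (halfSpace n) := (𝓡∂ (n + 1)).uniqueDiffOn

lemma halfSpace_subset_closure_interior : halfSpace n ⊆ closure (interior (halfSpace n)) :=
  (𝓡∂ (n + 1)).range_subset_closure_interior

/-- Relatively open subsets of the half space. -/
structure IsRelOpen (U : Set (Model n)) : Prop where
  subset : U ⊆ halfSpace n
  mem_nhdsWithin : ∀ y ∈ U, U ∈ nhdsWithin y (halfSpace n)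

/-- Smoothness within the half space at the points of `U`. -/
def SmoothAlong (U : Set (Model n)) {F : Type*} [NormedAddCommGroup F] [NormedSpace ℝ F]
    (f : Model n → F) : Prop :=
  ∀ y ∈ U, ContDiffWithinAt ℝ ∞ f (halfSpace n) y

section Smooth

variable {U : Set (Model n)} {F : Type*} [NormedAddCommGroup F] [NormedSpace ℝ F]

lemma SmoothAlong.differentiableWithinAt {f : Model n → F} (hf : SmoothAlong U f) {y : Model n}
    (hy : y ∈ U) : DifferentiableWithinAt ℝ f (halfSpace n) y :=
  (hf y hy).differentiableWithinAt (by simp)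

lemma SmoothAlong.congr (hU : IsRelOpen U) {f g : Model n → F} (hf : SmoothAlong U f)
    (h : ∀ y ∈ U, g y = f y) : SmoothAlong U g := fun y hy =>
  (hf y hy).congr_of_eventuallyEq (Filter.eventually_of_mem (hU.mem_nhdsWithin y hy) h) (h y hy)

lemma fderivWithin_congr_of_isRelOpen (hU : IsRelOpen U) {f g : Model n → F} {y : Model n}
    (hy : y ∈ U) (h : ∀ z ∈ U, g z = f z) :
    fderivWithin ℝ g (halfSpace n) y = fderivWithin ℝ f (halfSpace n) y :=
  Filter.EventuallyEq.fderivWithin_eq (Filter.eventually_of_mem (hU.mem_nhdsWithin y hy) h) (h y hy)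

lemma pd_congr (hU : IsRelOpen U) {f g : Model n → ℝ} {y : Model n} (hy : y ∈ U)
    (h : ∀ z ∈ U, g z = f z) (k : Fin (n + 1)) : pd k g y = pd k f y := by
  rw [pd, pd, fderivWithin_congr_of_isRelOpen hU hy h]

lemma SmoothAlong.fderivWithin (hU : IsRelOpen U) {f : Model n → F} (hf : SmoothAlong U f) :
    SmoothAlong U (fun y => fderivWithin ℝ f (halfSpace n) y) := fun y hy =>
  (hf y hy).fderivWithin_right uniqueDiffOn_halfSpace (by simp) (hU.subset hy)

lemma SmoothAlong.pd (hU : IsRelOpen U) {f : Model n → ℝ} (hf : SmoothAlong U f)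
    (k : Fin (n + 1)) : SmoothAlong U (pd k f) := fun y hy =>
  (hf.fderivWithin hU y hy).clm_apply contDiffWithinAt_const

lemma SmoothAlong.add {f g : Model n → F} (hf : SmoothAlong U f) (hg : SmoothAlong U g) :
    SmoothAlong U (fun y => f y + g y) := fun y hy => (hf y hy).add (hg y hy)

lemma SmoothAlong.mul {f g : Model n → ℝ} (hf : SmoothAlong U f) (hg : SmoothAlong U g) :
    SmoothAlong U (fun y => f y * g y) := fun y hy => (hf y hy).mul (hg y hy)

lemma SmoothAlong.sum {ι : Type*} {s : Finset ι} {f : ι → Model n → F}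
    (hf : ∀ i ∈ s, SmoothAlong U (f i)) : SmoothAlong U (fun y => ∑ i ∈ s, f i y) :=
  fun y hy => ContDiffWithinAt.sum fun i hi => hf i hi y hy

lemma SmoothAlong.prod {ι : Type*} {s : Finset ι} {f : ι → Model n → ℝ}
    (hf : ∀ i ∈ s, SmoothAlong U (f i)) : SmoothAlong U (fun y => ∏ i ∈ s, f i y) :=
  fun y hy => contDiffWithinAt_prod fun i hi => hf i hi y hy

lemma smoothAlong_const (a : F) : SmoothAlong U fun _ => a := fun _ _ => contDiffWithinAt_const

lemma SmoothAlong.det {ι : Type*} [Fintype ι] [DecidableEq ι] {m : Model n → Matrix ι ι ℝ}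
    (hm : ∀ i j, SmoothAlong U fun y => m y i j) : SmoothAlong U fun y => (m y).det := by
  simp only [Matrix.det_apply']
  exact SmoothAlong.sum fun σ _ => (smoothAlong_const _).mul (SmoothAlong.prod fun i _ => hm _ _)

/-- Cramer's rule writes the entries of the inverse as quotients of determinants, hence as smooth
functions where the determinant does not vanish. -/
lemma SmoothAlong.inv_matrix {ι : Type*} [Fintype ι] [DecidableEq ι] {m : Model n → Matrix ι ι ℝ}
    (hm : ∀ i j, SmoothAlong U fun y => m y i j) (hdet : ∀ y ∈ U, (m y).det ≠ 0) (i j : ι) :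
    SmoothAlong U fun y => (m y)⁻¹ i j := by
  have h1 : (fun y => (m y)⁻¹ i j) =
      fun y => (m y).det⁻¹ * ((m y).updateRow j (Pi.single i 1)).det := by
    ext y
    rw [Matrix.inv_def, Matrix.smul_apply, Matrix.adjugate_apply, smul_eq_mul, Ring.inverse_eq_inv']
  rw [h1]
  refine SmoothAlong.mul (fun y hy => (SmoothAlong.det hm y hy).inv (hdet y hy)) ?_
  refine SmoothAlong.det fun a b => ?_
  by_cases h : a = j
  · subst h; simpa using smoothAlong_const _
  · simpa [Matrix.updateRow_apply, h] using hm a b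

lemma SmoothAlong.continuousOn (hU : IsRelOpen U) {f : Model n → F} (hf : SmoothAlong U f) :
    ContinuousOn f U := fun y hy => (hf y hy).continuousWithinAt.mono hU.subset

/-- This includes boundary points: the half space lies in the closure of its interior, so the
symmetry persists up to the boundary. -/
lemma isSymmSndFDerivWithinAt_halfSpace {f : Model n → F} {y : Model n}
    (hf : ContDiffWithinAt ℝ ∞ f (halfSpace n) y) (hy : y ∈ halfSpace n) :
    IsSymmSndFDerivWithinAt ℝ f (halfSpace n) y :=
  hf.isSymmSndFDerivWithinAt (by simp; exact WithTop.coe_le_coe.2 (by simp))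
    uniqueDiffOn_halfSpace (halfSpace_subset_closure_interior hy) hy

lemma pd_pd_comm (hU : IsRelOpen U) {f : Model n → ℝ} (hf : SmoothAlong U f) {y : Model n}
    (hy : y ∈ U) (i j : Fin (n + 1)) : VacuaMetric.pd i (VacuaMetric.pd j f) y =
      VacuaMetric.pd j (VacuaMetric.pd i f) y := by
  have hsymm := isSymmSndFDerivWithinAt_halfSpace (hf y hy) (hU.subset hy)
  have hd := (hf.fderivWithin hU).differentiableWithinAt hy
  have key : ∀ i j, VacuaMetric.pd i (VacuaMetric.pd j f) y =
      _root_.fderivWithin ℝ (_root_.fderivWithin ℝ f (halfSpace n)) (halfSpace n) y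
        (stdVec i) (stdVec j) := fun i j => by
    have : (VacuaMetric.pd j f) =
      fun z => (_root_.fderivWithin ℝ f (halfSpace n) z) (stdVec j) := rfl
    rw [VacuaMetric.pd, this, fderivWithin_clm_apply (uniqueDiffOn_halfSpace y (hU.subset hy)) hd
      (differentiableWithinAt_const _)]
    simp
  rw [key, key, hsymm]

end Smooth

/-! ### The ring of smooth functions -/

section Ring

variable (U : Set (Model n))

/-- Extension by zero. -/
def extendZero {U : Set (Model n)} (f : U → ℝ) : Model n → ℝ := Function.extend Subtype.val f 0

variable {U}

lemma extendZero_of_mem (f : U → ℝ) {y : Model n} (hy : y ∈ U) : extendZero f y = f ⟨y, hy⟩ :=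
  Subtype.val_injective.extend_apply f 0 ⟨y, hy⟩

/-- The algebra of smooth functions on a relatively open subset of the half space. -/
def smoothSubalgebra (hU : IsRelOpen U) : Subalgebra ℝ (U → ℝ) where
  carrier := {f | SmoothAlong U (extendZero f)}
  mul_mem' {a b} ha hb := (SmoothAlong.mul ha hb).congr hU fun y hy => by
    simp [extendZero_of_mem _ hy]
  add_mem' {a b} ha hb := (SmoothAlong.add ha hb).congr hU fun y hy => by
    simp [extendZero_of_mem _ hy]
  algebraMap_mem' r := (smoothAlong_const r).congr hU fun y hy => by
    simp [extendZero_of_mem _ hy]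

/-- The ring of smooth functions on a relatively open subset of the half space. -/
def SmoothRing (hU : IsRelOpen U) : Type := smoothSubalgebra hU

instance (hU : IsRelOpen U) : CommRing (SmoothRing hU) :=
  inferInstanceAs (CommRing (smoothSubalgebra hU))

instance (hU : IsRelOpen U) : Algebra ℝ (SmoothRing hU) :=
  inferInstanceAs (Algebra ℝ (smoothSubalgebra hU))

variable {hU : IsRelOpen U}

/-- The extension by zero of an element of the ring. -/
def SmoothRing.fn (a : SmoothRing hU) : Model n → ℝ := extendZero (Subtype.val a)

lemma SmoothRing.smoothAlong_fn (a : SmoothRing hU) : SmoothAlong U a.fn := Subtype.property a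

/-- A smooth function as an element of the ring. -/
def ofSmooth (hU : IsRelOpen U) (f : Model n → ℝ) (hf : SmoothAlong U f) : SmoothRing hU :=
  Subtype.mk (p := fun f => f ∈ smoothSubalgebra hU) (fun y : U => f y)
    (hf.congr hU fun _ hy => extendZero_of_mem _ hy)

/-- Evaluation at a point. -/
def evalAt (hU : IsRelOpen U) {y : Model n} (hy : y ∈ U) : SmoothRing hU →ₐ[ℝ] ℝ :=
  (Pi.evalAlgHom ℝ (fun _ : U => ℝ) ⟨y, hy⟩).comp (smoothSubalgebra hU).val

lemma evalAt_eq_fn {y : Model n} (hy : y ∈ U) (a : SmoothRing hU) :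
    evalAt hU hy a = a.fn y := (extendZero_of_mem _ hy).symm

lemma ext_evalAt {a b : SmoothRing hU} (h : ∀ y (hy : y ∈ U), evalAt hU hy a = evalAt hU hy b) :
    a = b := Subtype.ext (funext fun y => h y.1 y.2)

/-- The function `f` represents the ring element `a`. -/
def Rep (f : Model n → ℝ) (a : SmoothRing hU) : Prop := ∀ y (hy : y ∈ U), f y = evalAt hU hy a

lemma rep_fn (a : SmoothRing hU) : Rep a.fn a := fun _ hy => (evalAt_eq_fn hy a).symm

lemma rep_ofSmooth {f : Model n → ℝ} (hf : SmoothAlong U f) : Rep f (ofSmooth hU f hf) :=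
  fun _ _ => rfl

lemma Rep.smoothAlong {f : Model n → ℝ} {a : SmoothRing hU} (h : Rep f a) : SmoothAlong U f :=
  SmoothAlong.congr hU a.smoothAlong_fn fun y hy => (h y hy).trans (evalAt_eq_fn hy a)

lemma Rep.pd_eq {f : Model n → ℝ} {a : SmoothRing hU} (h : Rep f a) {y : Model n} (hy : y ∈ U)
    (k : Fin (n + 1)) : pd k f y = pd k a.fn y :=
  pd_congr hU hy (fun z hz => (h z hz).trans (evalAt_eq_fn hz a)) k

lemma Rep.add {f g : Model n → ℝ} {a b : SmoothRing hU} (hf : Rep f a) (hg : Rep g b) :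
    Rep (fun y => f y + g y) (a + b) := fun y hy => by
  rw [map_add]; exact congrArg₂ _ (hf y hy) (hg y hy)

lemma Rep.sub {f g : Model n → ℝ} {a b : SmoothRing hU} (hf : Rep f a) (hg : Rep g b) :
    Rep (fun y => f y - g y) (a - b) := fun y hy => by
  rw [map_sub]; exact congrArg₂ _ (hf y hy) (hg y hy)

lemma Rep.mul {f g : Model n → ℝ} {a b : SmoothRing hU} (hf : Rep f a) (hg : Rep g b) :
    Rep (fun y => f y * g y) (a * b) := fun y hy => by
  rw [map_mul]; exact congrArg₂ _ (hf y hy) (hg y hy)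

lemma Rep.const_mul {f : Model n → ℝ} {a : SmoothRing hU} (r : ℝ) (hf : Rep f a) :
    Rep (fun y => r * f y) (r • a) := fun y hy => by
  rw [map_smul]; exact congrArg _ (hf y hy)

lemma Rep.sum {ι : Type*} {s : Finset ι} {f : ι → Model n → ℝ} {a : ι → SmoothRing hU}
    (hf : ∀ i, Rep (f i) (a i)) : Rep (fun y => ∑ i ∈ s, f i y) (∑ i ∈ s, a i) := fun y hy => by
  rw [map_sum]; exact Finset.sum_congr rfl fun i _ => hf i y hy

lemma Rep.congr {f g : Model n → ℝ} {a : SmoothRing hU} (hf : Rep f a) (h : ∀ y ∈ U, g y = f y) :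
    Rep g a := fun y hy => (h y hy).trans (hf y hy)

/-- The device for identities in the ring: one function representing both sides suffices. The
derivation rules and the commutation of derivations are obtained from calculus in this way. -/
lemma Rep.unique {f : Model n → ℝ} {a b : SmoothRing hU} (ha : Rep f a) (hb : Rep f b) : a = b :=
  ext_evalAt fun y hy => (ha y hy).symm.trans (hb y hy)

lemma pd_add {f g : Model n → ℝ} {y : Model n} (hy : y ∈ halfSpace n)
    (hf : DifferentiableWithinAt ℝ f (halfSpace n) y)
    (hg : DifferentiableWithinAt ℝ g (halfSpace n) y) (k : Fin (n + 1)) :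
    pd k (fun z => f z + g z) y = pd k f y + pd k g y := by
  rw [pd, fderivWithin_fun_add (uniqueDiffOn_halfSpace y hy) hf hg]; rfl

lemma pd_mul {f g : Model n → ℝ} {y : Model n} (hy : y ∈ halfSpace n)
    (hf : DifferentiableWithinAt ℝ f (halfSpace n) y)
    (hg : DifferentiableWithinAt ℝ g (halfSpace n) y) (k : Fin (n + 1)) :
    pd k (fun z => f z * g z) y = f y * pd k g y + g y * pd k f y := by
  rw [pd, fderivWithin_fun_mul (uniqueDiffOn_halfSpace y hy) hf hg]; rfl

/-- Partial differentiation of elements of the ring. -/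
def pdFun (k : Fin (n + 1)) (a : SmoothRing hU) : SmoothRing hU :=
  ofSmooth hU (pd k a.fn) (a.smoothAlong_fn.pd hU k)

lemma Rep.pdFun {f : Model n → ℝ} {a : SmoothRing hU} (h : Rep f a) (k : Fin (n + 1)) :
    Rep (pd k f) (pdFun k a) := fun _ hy => h.pd_eq hy k

lemma pdFun_add (k : Fin (n + 1)) (a b : SmoothRing hU) :
    pdFun k (a + b) = pdFun k a + pdFun k b :=
  (((rep_fn a).add (rep_fn b)).pdFun k).unique ((((rep_fn a).pdFun k).add
    ((rep_fn b).pdFun k)).congr fun _ hy => pd_add (hU.subset hy)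
      (a.smoothAlong_fn.differentiableWithinAt hy) (b.smoothAlong_fn.differentiableWithinAt hy) k)

lemma pdFun_mul (k : Fin (n + 1)) (a b : SmoothRing hU) :
    pdFun k (a * b) = a * pdFun k b + b * pdFun k a :=
  (((rep_fn a).mul (rep_fn b)).pdFun k).unique ((((rep_fn a).mul ((rep_fn b).pdFun k)).add
    ((rep_fn b).mul ((rep_fn a).pdFun k))).congr fun _ hy => pd_mul (hU.subset hy)
      (a.smoothAlong_fn.differentiableWithinAt hy) (b.smoothAlong_fn.differentiableWithinAt hy) k)

lemma pdFun_smul (k : Fin (n + 1)) (r : ℝ) (a : SmoothRing hU) :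
    pdFun k (r • a) = r • pdFun k a :=
  (((rep_fn a).const_mul r).pdFun k).unique ((((rep_fn a).pdFun k).const_mul r).congr
    fun y hy => by
      rw [pd_mul (hU.subset hy) (differentiableWithinAt_const _)
        (a.smoothAlong_fn.differentiableWithinAt hy)]
      simp [pd])

/-- Partial differentiation as a derivation. -/
def pdDer (hU : IsRelOpen U) (k : Fin (n + 1)) :
    Derivation ℝ (SmoothRing hU) (SmoothRing hU) :=
  Derivation.mk' { toFun := pdFun k, map_add' := pdFun_add k, map_smul' := pdFun_smul k }
    (pdFun_mul k)

lemma Rep.pd {f : Model n → ℝ} {a : SmoothRing hU} (h : Rep f a) (k : Fin (n + 1)) :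
    Rep (pd k f) (pdDer hU k a) := h.pdFun k

lemma pdDer_comm (i j : Fin (n + 1)) (a : SmoothRing hU) :
    pdDer hU i (pdDer hU j a) = pdDer hU j (pdDer hU i a) :=
  (((rep_fn a).pd j).pd i).unique ((((rep_fn a).pd i).pd j).congr fun _ hy =>
    pd_pd_comm hU a.smoothAlong_fn hy i j)

end Ring

end VacuaMetric
end

noncomputable section

namespace VacuaMetric

/-! ### Geometry in a chart -/

section Chart

variable {n : ℕ} {M : Type*} [TopologicalSpace M] [ChartedSpace (EuclideanHalfSpace (n + 1)) M]

/-- The extended chart around `c`. -/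
abbrev chart (c : M) : PartialEquiv M (Model n) := extChartAt (𝓡∂ (n + 1)) c

lemma isRelOpen_target (c : M) : IsRelOpen (chart (n := n) c).target where
  subset := extChartAt_target_subset_range c
  mem_nhdsWithin _ hy := extChartAt_target_mem_nhdsWithin_of_mem hy

/-- The derivative of the inverse of a chart. -/
def dSymm (c : M) (y : Model n) :
    Model n →L[ℝ] TangentSpace (𝓡∂ (n + 1)) ((chart (n := n) c).symm y) :=
  mfderivWithin 𝓘(ℝ, Model n) (𝓡∂ (n + 1)) (chart c).symm (halfSpace n) y

/-- The derivative of a chart. -/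
def dChart (c : M) (x : M) : TangentSpace (𝓡∂ (n + 1)) x →L[ℝ] Model n :=
  mfderiv (𝓡∂ (n + 1)) 𝓘(ℝ, Model n) (chart (n := n) c) x

/-- The vector of components of a vector field. -/
def vecChart (V : VField n M) (c : M) (y : Model n) : Model n :=
  dChart c ((chart (n := n) c).symm y) (V ((chart (n := n) c).symm y))

lemma vecCoord_eq (V : VField n M) (c : M) (y : Model n) (k : Fin (n + 1)) :
    vecCoord V c y k = vecChart V c y k := rfl

lemma coordVec_eq (c : M) (y : Model n) (i : Fin (n + 1)) :
    coordVec c y i = dSymm c y (stdVec i) := rfl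

lemma eq_sum_stdVec (v : Model n) : v = ∑ i, v i • (stdVec i : Model n) := by
  conv_lhs => rw [← (EuclideanSpace.basisFun (Fin (n + 1)) ℝ).sum_repr v]
  simp [EuclideanSpace.basisFun_apply]

variable [IsManifold (𝓡∂ (n + 1)) ∞ M]

instance : IsManifold (𝓡∂ (n + 1)) 1 M := IsManifold.of_le (n := ∞) (by simp)

lemma dChart_dSymm {c : M} {y : Model n} (hy : y ∈ (chart c).target) (v : Model n) :
    dChart c ((chart c).symm y) (dSymm c y v) = v :=
  DFunLike.congr_fun (mfderiv_extChartAt_comp_mfderivWithin_extChartAt_symm hy) v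

lemma dSymm_dChart {c : M} {y : Model n} (hy : y ∈ (chart c).target)
    (v : TangentSpace (𝓡∂ (n + 1)) ((chart (n := n) c).symm y)) :
    dSymm c y (dChart c ((chart c).symm y) v) = v :=
  DFunLike.congr_fun (mfderivWithin_extChartAt_symm_comp_mfderiv_extChartAt hy) v

lemma dChart_self (x : M) (v : TangentSpace (𝓡∂ (n + 1)) x) : dChart x x v = tcomp v :=
  DFunLike.congr_fun (mfderiv_extChartAt_self (I := 𝓡∂ (n + 1)) (x := x)) v

lemma dSymm_vecChart (V : VField n M) {c : M} {y : Model n} (hy : y ∈ (chart c).target) :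
    dSymm c y (vecChart V c y) = V ((chart c).symm y) := dSymm_dChart hy _

lemma contMDiffOn_dSymm (c : M) {w : Model n → Model n} (hw : ContDiffOn ℝ ∞ w (chart c).target) :
    ContMDiffOn 𝓘(ℝ, Model n) (𝓡∂ (n + 1)).tangent ∞
      (fun y => (⟨(chart c).symm y, dSymm c y (w y)⟩ : TangentBundle (𝓡∂ (n + 1)) M))
      (chart c).target := by
  have h1 := (contMDiffOn_extChartAt_symm (I := 𝓡∂ (n + 1)) (n := ∞) c).contMDiffOn_tangentMapWithin
    (m := ∞) (by simp) (uniqueMDiffOn_iff_uniqueDiffOn.2 (uniqueDiffOn_extChartAt_target c))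
  have h2 : ContMDiffOn 𝓘(ℝ, Model n) (𝓘(ℝ, Model n)).tangent ∞
      (fun y => (⟨y, w y⟩ : TangentBundle 𝓘(ℝ, Model n) (Model n))) (chart c).target :=
    contMDiffOn_vectorSpace_iff_contDiffOn.2 hw
  refine (h1.comp h2 fun y hy => hy).congr fun y hy => ?_
  simp only [Function.comp, tangentMapWithin, dSymm]
  congr 2
  -- The tangent map is formed within the chart target while `dSymm` is formed within the half
  -- space; the two sets have the same germ at points of the target.
  rw [mfderivWithin_congr_set (extChartAt_target_eventuallyEq_of_mem hy)]

lemma contDiffOn_vecChart {V : VField n M} (hV : ContMDiff (𝓡∂ (n + 1)) (𝓡∂ (n + 1)).tangent ∞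
    (fun x => (⟨x, V x⟩ : TangentBundle (𝓡∂ (n + 1)) M))) (c : M) :
    ContDiffOn ℝ ∞ (vecChart V c) (chart c).target := by
  have h1 := (contMDiffOn_extChartAt (I := 𝓡∂ (n + 1)) (n := ∞) (x := c)).contMDiffOn_tangentMapWithin
    (m := ∞) (by simp) (chartAt (EuclideanHalfSpace (n + 1)) c).open_source.uniqueMDiffOn
  have h2 := h1.comp (hV.contMDiffOn (s := (chartAt (EuclideanHalfSpace (n + 1)) c).source))
    fun x hx => hx
  have h3 := (contMDiff_snd_tangentBundle_modelSpace (Model n) 𝓘(ℝ, Model n) (n := ∞)).comp_contMDiffOn h2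
  have h4 := h3.comp (contMDiffOn_extChartAt_symm (I := 𝓡∂ (n + 1)) (n := ∞) c) fun y hy => by
    rw [mem_preimage, ← extChartAt_source (𝓡∂ (n + 1))]; exact (chart c).map_target hy
  rw [← contMDiffOn_iff_contDiffOn]
  refine h4.congr fun y hy => ?_
  have hy' : (chart c).symm y ∈ (chartAt (EuclideanHalfSpace (n + 1)) c).source := by
    rw [← extChartAt_source (𝓡∂ (n + 1))]; exact (chart c).map_target hy
  simp only [Function.comp, tangentMapWithin, vecChart, dChart]
  rw [mfderivWithin_of_isOpen (chartAt (EuclideanHalfSpace (n + 1)) c).open_source hy']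
  rfl

lemma ContDiffOn.smoothAlong {U : Set (Model n)} (hU : IsRelOpen U) {F : Type*}
    [NormedAddCommGroup F] [NormedSpace ℝ F] {f : Model n → F} (hf : ContDiffOn ℝ ∞ f U) :
    SmoothAlong U f := fun y hy => (hf y hy).mono_of_mem_nhdsWithin (hU.mem_nhdsWithin y hy)

lemma SmoothAlong.contDiffOn {U : Set (Model n)} (hU : IsRelOpen U) {F : Type*}
    [NormedAddCommGroup F] [NormedSpace ℝ F] {f : Model n → F} (hf : SmoothAlong U f) :
    ContDiffOn ℝ ∞ f U := fun y hy => (hf y hy).mono hU.subset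

/-- Smooth vector fields. -/
def IsSmooth (V : VField n M) : Prop := ContMDiff (𝓡∂ (n + 1)) (𝓡∂ (n + 1)).tangent ∞
    (fun x => (⟨x, V x⟩ : TangentBundle (𝓡∂ (n + 1)) M))

lemma IsSmooth.vecChart {V : VField n M} (hV : IsSmooth V) (c : M) :
    SmoothAlong (chart c).target (vecChart V c) :=
  ContDiffOn.smoothAlong (isRelOpen_target c) (contDiffOn_vecChart hV c)

lemma IsSmooth.of_vecChart {V : VField n M}
    (hV : ∀ c : M, SmoothAlong (chart (n := n) c).target (VacuaMetric.vecChart V c)) : IsSmooth V := by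
  intro x
  have h1 := contMDiffOn_dSymm x ((hV x).contDiffOn (isRelOpen_target x))
  have h2 := h1.comp (contMDiffOn_extChartAt (I := 𝓡∂ (n + 1)) (n := ∞) (x := x)) fun z hz =>
    (chart x).map_source (by rwa [extChartAt_source])
  have hx : (chartAt (EuclideanHalfSpace (n + 1)) x).source ∈ nhds x :=
    (chartAt (EuclideanHalfSpace (n + 1)) x).open_source.mem_nhds (mem_chart_source _ x)
  refine (h2.contMDiffAt hx).congr_of_eventuallyEq (Filter.eventually_of_mem hx fun z hz => ?_)
  have hz' : z ∈ (chart (n := n) x).source := by rwa [extChartAt_source]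
  simp only [Function.comp]
  rw [dSymm_vecChart V ((chart x).map_source hz'), (chart x).left_inv hz']

lemma contMDiffOn_trivial {U : Set (Model n)} {b : Model n → M} {f : Model n → ℝ}
    (h : ContMDiffOn 𝓘(ℝ, Model n) ((𝓡∂ (n + 1)).prod 𝓘(ℝ, ℝ)) ∞
      (fun y => TotalSpace.mk' ℝ (E := Bundle.Trivial M ℝ) (b y) (f y)) U) :
    ContDiffOn ℝ ∞ f U := by
  rw [← contMDiffOn_iff_contDiffOn]
  intro y hy
  exact (contMDiffWithinAt_totalSpace.1 (h y hy)).2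

lemma contDiffOn_metricCoord (h : Metric n M) (c : M) (i j : Fin (n + 1)) :
    ContDiffOn ℝ ∞ (fun y => metricCoord h c y i j) (chart c).target := by
  have h1 := (h.contMDiff.comp_contMDiffOn
    (contMDiffOn_extChartAt_symm (I := 𝓡∂ (n + 1)) (n := ∞) c)).clm_bundle_apply₂
      (E₃ := Bundle.Trivial M ℝ) (F₃ := ℝ) (contMDiffOn_dSymm c (w := fun _ => stdVec i) contDiffOn_const)
      (contMDiffOn_dSymm c (w := fun _ => stdVec j) contDiffOn_const)
  exact contMDiffOn_trivial h1

lemma smoothAlong_metricCoord (h : Metric n M) (c : M) (i j : Fin (n + 1)) :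
    SmoothAlong (chart c).target (fun y => metricCoord h c y i j) :=
  ContDiffOn.smoothAlong (isRelOpen_target c) (contDiffOn_metricCoord h c i j)

instance : NormedAddCommGroup (Model n →L[ℝ] Model n →L[ℝ] ℝ) :=
  ContinuousLinearMap.toNormedAddCommGroup

instance : NormedSpace ℝ (Model n →L[ℝ] Model n →L[ℝ] ℝ) :=
  ContinuousLinearMap.toNormedSpace

/-- The `i`-th coordinate function. -/
abbrev coordFun (i : Fin (n + 1)) : Model n →L[ℝ] ℝ := EuclideanSpace.proj i

/-- The metric in a chart, as a bilinear form on the model space. -/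
def metricForm (h : Metric n M) (c : M) (y : Model n) : Model n →L[ℝ] Model n →L[ℝ] ℝ :=
  ∑ i, ∑ j, metricCoord h c y i j • (coordFun i).smulRight (coordFun j)

lemma metricForm_eq_sum (h : Metric n M) (c : M) (y u v : Model n) :
    metricForm h c y u v = ∑ i, ∑ j, metricCoord h c y i j * u i * v j := by
  simp [metricForm, mul_assoc]

lemma metricForm_apply (h : Metric n M) (c : M) (y u v : Model n) :
    metricForm h c y u v = h.inner ((chart c).symm y) (dSymm c y u) (dSymm c y v) := by
  rw [metricForm_eq_sum]
  conv_rhs => rw [eq_sum_stdVec u, eq_sum_stdVec v]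
  simp only [map_sum, map_smul, sum_apply, smul_apply, smul_eq_mul, Finset.mul_sum]
  rw [Finset.sum_comm]
  refine Finset.sum_congr rfl fun i _ => Finset.sum_congr rfl fun j _ => ?_
  rw [metricCoord, Matrix.of_apply, coordVec_eq, coordVec_eq]
  ring

lemma smoothAlong_metricForm (h : Metric n M) (c : M) :
    SmoothAlong (chart c).target (metricForm h c) :=
  SmoothAlong.sum fun i _ => SmoothAlong.sum fun j _ => fun y hy =>
    ((ContinuousLinearMap.id ℝ ℝ).smulRight
      ((coordFun (n := n) i).smulRight (coordFun j))).contDiff.comp_contDiffWithinAt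
        (smoothAlong_metricCoord h c i j y hy)

end Chart
end VacuaMetric
end

noncomputable section

namespace VacuaMetric

section Realization

/-! ### The tensor calculus of a chart in the ring of smooth functions -/

open VacuaMetric.TensorAlgebra Matrix

variable {n : ℕ} {M : Type*} [TopologicalSpace M] [ChartedSpace (EuclideanHalfSpace (n + 1)) M]
  [IsManifold (𝓡∂ (n + 1)) ∞ M]

lemma metricCoord_transpose (h : Metric n M) (c : M) (y : Model n) :
    (metricCoord h c y)ᵀ = metricCoord h c y := by
  ext i j
  exact h.symm _ _ _

lemma metricCoord_posDef (h : Metric n M) {c : M} {y : Model n} (hy : y ∈ (chart c).target) :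
    (metricCoord h c y).PosDef := by
  refine Matrix.PosDef.of_dotProduct_mulVec_pos (by
    rw [Matrix.IsHermitian, Matrix.conjTranspose_eq_transpose_of_trivial,
      metricCoord_transpose]) fun x hx => ?_
  have h1 : star x ⬝ᵥ metricCoord h c y *ᵥ x =
      metricForm h c y (WithLp.toLp 2 x) (WithLp.toLp 2 x) := by
    rw [metricForm_eq_sum]
    simp only [dotProduct, Matrix.mulVec, Pi.star_apply, star_trivial, Finset.mul_sum]
    exact Finset.sum_congr rfl fun i _ => Finset.sum_congr rfl fun j _ => by ring
  rw [h1, metricForm_apply]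
  refine h.pos _ _ fun h0 => hx ?_
  have h2 := dChart_dSymm hy (WithLp.toLp 2 x)
  rw [h0, map_zero] at h2
  have h3 := congrArg WithLp.ofLp h2
  exact h3.symm

lemma metricCoord_det_pos (h : Metric n M) {c : M} {y : Model n} (hy : y ∈ (chart c).target) :
    0 < (metricCoord h c y).det := (metricCoord_posDef h hy).det_pos

lemma metricCoord_mul_inv (h : Metric n M) {c : M} {y : Model n} (hy : y ∈ (chart c).target) :
    metricCoord h c y * invCoord h c y = 1 :=
  Matrix.mul_nonsing_inv _ (isUnit_iff_ne_zero.2 (metricCoord_det_pos h hy).ne')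

lemma invCoord_transpose (h : Metric n M) {c : M} {y : Model n} :
    (invCoord h c y)ᵀ = invCoord h c y := by
  rw [invCoord, Matrix.transpose_nonsing_inv, metricCoord_transpose]

lemma invCoord_zero_pos (h : Metric n M) {c : M} {y : Model n} (hy : y ∈ (chart c).target)
    (i : Fin (n + 1)) : 0 < invCoord h c y i i := (metricCoord_posDef h hy).inv.diag_pos

lemma smoothAlong_invCoord (h : Metric n M) (c : M) (i j : Fin (n + 1)) :
    SmoothAlong (chart c).target (fun y => invCoord h c y i j) :=
  SmoothAlong.inv_matrix (smoothAlong_metricCoord h c)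
    (fun _ hy => (metricCoord_det_pos h hy).ne') i j

/-- The ring of smooth functions on a chart. -/
abbrev ChartRing (c : M) : Type := SmoothRing (isRelOpen_target (n := n) c)

/-- The coordinate derivations. -/
abbrev chartDer (c : M) (k : Fin (n + 1)) : Derivation ℝ (ChartRing (n := n) c) (ChartRing (n := n) c) :=
  pdDer (isRelOpen_target (n := n) c) k

/-- The metric over the ring of smooth functions. -/
def metricR (h : Metric n M) (c : M) : Matrix (Fin (n + 1)) (Fin (n + 1)) (ChartRing (n := n) c) :=
  Matrix.of fun i j => ofSmooth _ _ (smoothAlong_metricCoord h c i j)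

/-- The inverse metric over the ring of smooth functions. -/
def invR (h : Metric n M) (c : M) : Matrix (Fin (n + 1)) (Fin (n + 1)) (ChartRing (n := n) c) :=
  Matrix.of fun i j => ofSmooth _ _ (smoothAlong_invCoord h c i j)

lemma rep_metric (h : Metric n M) (c : M) (i j : Fin (n + 1)) :
    Rep (fun y => metricCoord h c y i j) (metricR h c i j) := rep_ofSmooth (smoothAlong_metricCoord h c i j)

lemma rep_inv (h : Metric n M) (c : M) (i j : Fin (n + 1)) :
    Rep (fun y => invCoord h c y i j) (invR h c i j) := rep_ofSmooth (smoothAlong_invCoord h c i j)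

lemma metricR_transpose (h : Metric n M) (c : M) : (metricR h c)ᵀ = metricR h c := by
  refine Matrix.ext fun i j => ext_evalAt fun y hy => ?_
  rw [Matrix.transpose_apply, ← rep_metric h c j i y hy, ← rep_metric h c i j y hy]
  exact h.symm _ _ _

lemma metricR_mul_invR (h : Metric n M) (c : M) : metricR h c * invR h c = 1 := by
  refine Matrix.ext fun i j => ext_evalAt fun y hy => ?_
  have h1 := congrFun (congrFun (metricCoord_mul_inv h hy) i) j
  rw [Matrix.mul_apply] at h1 ⊢
  simp only [map_sum, map_mul, ← rep_metric h c _ _ y hy, ← rep_inv h c _ _ y hy, h1]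
  rw [Matrix.one_apply, Matrix.one_apply]
  split_ifs
  · rw [map_one]
  · rw [map_zero]

/-- The algebraic definitions mirror the coordinate ones term by term, so this and the following
representation lemmas are assembled by the closure rules of `Rep`. -/
lemma rep_christoffel (h : Metric n M) (c : M) (k i j : Fin (n + 1)) :
    Rep (christoffel h c k i j) (chr (chartDer c) (metricR h c) (invR h c) k i j) :=
  Rep.const_mul _ (Rep.sum fun l => (rep_inv h c k l).mul
    ((((rep_metric h c l j).pd i).add ((rep_metric h c l i).pd j)).sub ((rep_metric h c i j).pd l)))

lemma rep_ricci (h : Metric n M) (c : M) (i j : Fin (n + 1)) :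
    Rep (ricciCoord h c i j) (ric (chartDer c) (metricR h c) (invR h c) i j) :=
  (Rep.sum fun k => ((rep_christoffel h c k i j).pd k).sub ((rep_christoffel h c k i k).pd j)).add
    (Rep.sum fun k => Rep.sum fun l =>
      ((rep_christoffel h c k k l).mul (rep_christoffel h c l i j)).sub
        ((rep_christoffel h c k j l).mul (rep_christoffel h c l i k)))

lemma rep_covVec (h : Metric n M) (c : M) {W : Model n → Fin (n + 1) → ℝ}
    {w : Fin (n + 1) → ChartRing (n := n) c} (hW : ∀ k, Rep (fun y => W y k) (w k))
    (i k : Fin (n + 1)) :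
    Rep (covVec h c W i k) (covV (chartDer c) (metricR h c) (invR h c) i w k) :=
  ((hW k).pd i).add (Rep.sum fun l => (rep_christoffel h c k i l).mul (hW l))

lemma rep_covCovec (h : Metric n M) (c : M) {W : Model n → Fin (n + 1) → ℝ}
    {w : Fin (n + 1) → ChartRing (n := n) c} (hW : ∀ k, Rep (fun y => W y k) (w k))
    (i j : Fin (n + 1)) :
    Rep (covCovec h c W i j) (chartDer c i (w j)
      - ∑ k, chr (chartDer c) (metricR h c) (invR h c) k i j * w k) :=
  ((hW j).pd i).sub (Rep.sum fun k => (rep_christoffel h c k i j).mul (hW k))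

lemma rep_covTensor (h : Metric n M) (c : M) {B : Fin (n + 1) → Fin (n + 1) → Model n → ℝ}
    {b : Matrix (Fin (n + 1)) (Fin (n + 1)) (ChartRing (n := n) c)}
    (hB : ∀ i j, Rep (B i j) (b i j)) (k i j : Fin (n + 1)) :
    Rep (covTensor h c B k i j) (covT (chartDer c) (metricR h c) (invR h c) k b i j) := by
  have h1 := (((hB i j).pd k).sub (Rep.sum (s := Finset.univ) fun l =>
    (rep_christoffel h c l k i).mul (hB l j))).sub (Rep.sum (s := Finset.univ) fun l =>
      (rep_christoffel h c l k j).mul (hB i l))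
  rw [covT_apply]
  exact h1

lemma IsSmooth.coord {V : VField n M} (hV : IsSmooth V) (c : M) (k : Fin (n + 1)) :
    SmoothAlong (chart c).target (fun y => vecCoord V c y k) := fun y hy =>
  (coordFun k).contDiff.comp_contDiffWithinAt (hV.vecChart c y hy)

/-- A vector field over the ring of smooth functions. -/
def vecR {V : VField n M} (hV : IsSmooth V) (c : M) : Fin (n + 1) → ChartRing (n := n) c :=
  fun k => ofSmooth _ _ (hV.coord c k)

variable {V : VField n M} (hV : IsSmooth V)

lemma rep_vec (c : M) (k : Fin (n + 1)) : Rep (fun y => vecCoord V c y k) (vecR hV c k) :=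
  rep_ofSmooth (hV.coord c k)

lemma rep_lower (h : Metric n M) (c : M) (j : Fin (n + 1)) :
    Rep (fun y => lowerCoord h V c y j) ((metricR h c *ᵥ vecR hV c) j) :=
  Rep.sum fun k => (rep_metric h c j k).mul (rep_vec hV c k)

/-- The column index of `nablaV` is the direction of differentiation; hence the exchanged indices.
-/
lemma rep_covLower (h : Metric n M) (c : M) (i j : Fin (n + 1)) :
    Rep (covCovec h c (lowerCoord h V c) i j)
      ((metricR h c * nablaV (chartDer c) (metricR h c) (invR h c) (vecR hV c)) j i) := by
  rw [mul_nablaV (metricR_transpose h c) (metricR_mul_invR h c)]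
  exact rep_covCovec h c (rep_lower hV h c) i j

lemma rep_antisym (h : Metric n M) (c : M) (i j : Fin (n + 1)) :
    Rep (antisymCoord h V c i j) (((1 / 2 : ℝ) •
      ((metricR h c * nablaV (chartDer c) (metricR h c) (invR h c) (vecR hV c))ᵀ
      - metricR h c * nablaV (chartDer c) (metricR h c) (invR h c) (vecR hV c))) i j) :=
  Rep.const_mul _ ((rep_covLower hV h c i j).sub (rep_covLower hV h c j i))

lemma rep_momentum (h : Metric n M) (c : M) (j : Fin (n + 1)) :
    Rep (momentumCoord h V c j) (∑ i, ∑ k, invR h c i k *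
      covT (chartDer c) (metricR h c) (invR h c) k ((1 / 2 : ℝ) •
        ((metricR h c * nablaV (chartDer c) (metricR h c) (invR h c) (vecR hV c))ᵀ
      - metricR h c * nablaV (chartDer c) (metricR h c) (invR h c) (vecR hV c))) i j) :=
  Rep.sum fun i => Rep.sum fun k =>
    (rep_inv h c i k).mul (rep_covTensor h c (rep_antisym hV h c) k i j)

/-- The components `∇_i V_j + ∇_j V_i`. -/
def lieCoord (h : Metric n M) (V : VField n M) (c : M) (y : Model n) :
    Matrix (Fin (n + 1)) (Fin (n + 1)) ℝ := Matrix.of fun i j =>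
  covCovec h c (lowerCoord h V c) i j y + covCovec h c (lowerCoord h V c) j i y

lemma rep_lie (h : Metric n M) (c : M) (i j : Fin (n + 1)) :
    Rep (fun y => lieCoord h V c y i j)
      (lieM (chartDer c) (metricR h c) (invR h c) (vecR hV c) i j) := by
  rw [lieM, Matrix.add_apply, add_comm]
  exact (rep_covLower hV h c i j).add (rep_covLower hV h c j i)

lemma Rep.eq_zero {c : M} {f : Model n → ℝ} {a : ChartRing (n := n) c} (hf : Rep f a)
    (h : ∀ y ∈ (chart c).target, f y = 0) : a = 0 :=
  ext_evalAt fun y hy => by rw [← hf y hy, h y hy, map_zero]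

/-- The divergence of the endomorphism `momM` vanishes. -/
lemma divergence_momM_chart {h : Metric n M} (hflat : IsRicciFlat h)
    (hmom : MomentumConstraint h V) (c : M) (j : Fin (n + 1)) :
    ∑ i, covM (chartDer c) (metricR h c) (invR h c) i
      (momM (chartDer c) (metricR h c) (invR h c) (vecR hV c)) i j = 0 :=
  divergence_momM_eq_zero pdDer_comm (metricR_transpose h c) (metricR_mul_invR h c) _
    (fun i j => (rep_ricci h c i j).eq_zero fun y hy => hflat c y hy i j) j
    ((rep_momentum hV h c j).eq_zero fun y hy => hmom c y hy j)

end Realization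
end VacuaMetric
end

noncomputable section

namespace VacuaMetric

/-! ### Naturality -/

section Lie

variable {E : Type*} [NormedAddCommGroup E] [NormedSpace ℝ E]

instance : AddCommGroup (E →L[ℝ] E →L[ℝ] ℝ) := ContinuousLinearMap.addCommGroup

instance : NormedAddCommGroup (E →L[ℝ] E →L[ℝ] ℝ) := ContinuousLinearMap.toNormedAddCommGroup

instance : NormedSpace ℝ (E →L[ℝ] E →L[ℝ] ℝ) := ContinuousLinearMap.toNormedSpace

/-- The Lie derivative of a field of bilinear forms along a vector field. -/
def lieDeriv (S : Set E) (g : E → E →L[ℝ] E →L[ℝ] ℝ) (X : E → E) (y u v : E) : ℝ :=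
  fderivWithin ℝ g S y (X y) u v + g y (fderivWithin ℝ X S y u) v + g y u (fderivWithin ℝ X S y v)

/-- The relations g = F^*g' and X' ∘ F = DF·X are differentiated at y by the chain rule. Both
produce second derivatives of F, which agree by symmetry. Only germs within S enter, so boundary
points are covered. -/
lemma lieDeriv_natural {S : Set E} (hS : UniqueDiffOn ℝ S) {g g' : E → E →L[ℝ] E →L[ℝ] ℝ}
    {X X' F : E → E} {y : E} (hy : y ∈ S)
    (hF : DifferentiableWithinAt ℝ F S y)
    (hDF : DifferentiableWithinAt ℝ (fderivWithin ℝ F S) S y)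
    (hsymm : IsSymmSndFDerivWithinAt ℝ F S y)
    (hg : DifferentiableWithinAt ℝ g S y) (hg' : DifferentiableWithinAt ℝ g' S (F y))
    (hX : DifferentiableWithinAt ℝ X S y) (hX' : DifferentiableWithinAt ℝ X' S (F y))
    (hmaps : ∀ᶠ z in nhdsWithin y S, F z ∈ S)
    (hgg : ∀ᶠ z in nhdsWithin y S, ∀ u v,
      g z u v = g' (F z) (fderivWithin ℝ F S z u) (fderivWithin ℝ F S z v))
    (hXX : ∀ᶠ z in nhdsWithin y S, X' (F z) = fderivWithin ℝ F S z (X z)) (u v : E) :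
    lieDeriv S g X y u v =
      lieDeriv S g' X' (F y) (fderivWithin ℝ F S y u) (fderivWithin ℝ F S y v) := by
  have hu := hS y hy
  have htend : Filter.Tendsto F (nhdsWithin y S) (nhdsWithin (F y) S) :=
    tendsto_nhdsWithin_iff.2 ⟨hF.continuousWithinAt, hmaps⟩
  have hgF : HasFDerivWithinAt (fun z => g' (F z))
      ((fderivWithin ℝ g' S (F y)).comp (fderivWithin ℝ F S y)) S y :=
    hg'.hasFDerivWithinAt.comp_of_tendsto y hF.hasFDerivWithinAt htend
  have hXF : HasFDerivWithinAt (fun z => X' (F z))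
      ((fderivWithin ℝ X' S (F y)).comp (fderivWithin ℝ F S y)) S y :=
    hX'.hasFDerivWithinAt.comp_of_tendsto y hF.hasFDerivWithinAt htend
  have hD := hDF.hasFDerivWithinAt
  have hDw : ∀ w : E, HasFDerivWithinAt (fun z => fderivWithin ℝ F S z w) _ S y := fun w =>
    hD.clm_apply (hasFDerivWithinAt_const w y S)
  have e1 : ∀ w, fderivWithin ℝ g S y w u v =
      fderivWithin ℝ g' S (F y) (fderivWithin ℝ F S y w) (fderivWithin ℝ F S y u)
          (fderivWithin ℝ F S y v)
        + g' (F y) (fderivWithin ℝ (fderivWithin ℝ F S) S y w u) (fderivWithin ℝ F S y v)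
        + g' (F y) (fderivWithin ℝ F S y u) (fderivWithin ℝ (fderivWithin ℝ F S) S y w v) :=
    fun w => by
      have h1 := (hg.hasFDerivWithinAt.clm_apply (hasFDerivWithinAt_const u y S)).clm_apply
        (hasFDerivWithinAt_const v y S)
      have h2 := ((hgF.clm_apply (hDw u)).clm_apply (hDw v)).congr_of_eventuallyEq
        (f₁ := fun z => g z u v) (hgg.mono fun z hz => hz u v)
        (hgg.self_of_nhdsWithin hy u v)
      have := DFunLike.congr_fun (hu.eq h1 h2) w
      simpa [add_comm, add_left_comm, add_assoc] using this
  have e2 : ∀ w, fderivWithin ℝ X' S (F y) (fderivWithin ℝ F S y w) =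
      fderivWithin ℝ (fderivWithin ℝ F S) S y w (X y)
        + fderivWithin ℝ F S y (fderivWithin ℝ X S y w) := fun w => by
    have h2 := (hD.clm_apply hX.hasFDerivWithinAt).congr_of_eventuallyEq hXX
      (hXX.self_of_nhdsWithin hy)
    have := DFunLike.congr_fun (hu.eq hXF h2) w
    simpa [add_comm] using this
  have hg0 := hgg.self_of_nhdsWithin hy
  have hX0 := hXX.self_of_nhdsWithin hy
  -- On the left the second derivative of F has X in the first slot, on the right in the second;
  -- `hsymm` exchanges them.
  rw [lieDeriv, lieDeriv, e1, e2, e2, hg0, hg0, hX0, hsymm (X y) u, hsymm (X y) v]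
  simp only [map_add, add_apply]
  ring

end Lie

/-! ### Maps read in charts and naturality of the deformation -/

section Chart

variable {n : ℕ} {M : Type*} [TopologicalSpace M] [ChartedSpace (EuclideanHalfSpace (n + 1)) M]
  [IsManifold (𝓡∂ (n + 1)) ∞ M]

lemma inner_eq_metricForm (h : Metric n M) {c z : M} (hz : z ∈ (chart (n := n) c).source)
    (u v : TangentSpace (𝓡∂ (n + 1)) z) :
    h.inner z u v = metricForm h c (chart c z) (dChart c z u) (dChart c z v) := by
  obtain ⟨y, hy, rfl⟩ : ∃ y ∈ (chart (n := n) c).target, (chart c).symm y = z :=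
    ⟨chart c z, (chart c).map_source hz, (chart c).left_inv hz⟩
  rw [(chart c).right_inv hy, metricForm_apply, dSymm_dChart hy, dSymm_dChart hy]

lemma vecChart_apply (V : VField n M) {c z : M} (hz : z ∈ (chart (n := n) c).source) :
    vecChart V c (chart c z) = dChart c z (V z) := by
  obtain ⟨y, hy, rfl⟩ : ∃ y ∈ (chart (n := n) c).target, (chart c).symm y = z :=
    ⟨chart c z, (chart c).map_source hz, (chart c).left_inv hz⟩
  rw [(chart c).right_inv hy, vecChart]

/-- A map read in the charts around `c` and `c'`. -/
def readIn (φ : M → M) (c c' : M) (y : Model n) : Model n := chart c' (φ ((chart c).symm y))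

/-- The domain on which a map is read in the charts around `c` and `c'`. -/
def readDomain (φ : M → M) (c c' : M) : Set (Model n) :=
  (chart (n := n) c).target ∩ (chart c).symm ⁻¹' (φ ⁻¹' (chart (n := n) c').source)

variable {φ : M → M} {c c' : M}

lemma isRelOpen_readDomain (hφ : Continuous φ) : IsRelOpen (readDomain (n := n) φ c c') where
  subset := inter_subset_left.trans (isRelOpen_target c).subset
  mem_nhdsWithin y hy := by
    refine Filter.inter_mem ((isRelOpen_target c).mem_nhdsWithin y hy.1) ?_
    have h1 : ContinuousWithinAt (chart (n := n) c).symm (halfSpace n) y :=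
      (continuousAt_extChartAt_symm'' hy.1).continuousWithinAt
    exact h1.preimage_mem_nhdsWithin
      (((isOpen_extChartAt_source c').preimage hφ).mem_nhds hy.2)

lemma readIn_mem_target {y : Model n} (hy : y ∈ readDomain φ c c') :
    readIn φ c c' y ∈ (chart c').target := (chart c').map_source hy.2

lemma symm_readIn {y : Model n} (hy : y ∈ readDomain φ c c') :
    (chart c').symm (readIn φ c c' y) = φ ((chart c).symm y) := (chart c').left_inv hy.2

lemma smoothAlong_readIn (hφ : ContMDiff (𝓡∂ (n + 1)) (𝓡∂ (n + 1)) ∞ φ) :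
    SmoothAlong (readDomain (n := n) φ c c') (readIn φ c c') := by
  refine ContDiffOn.smoothAlong (isRelOpen_readDomain hφ.continuous) ?_
  rw [← contMDiffOn_iff_contDiffOn]
  refine (contMDiffOn_extChartAt (I := 𝓡∂ (n + 1)) (n := ∞) (x := c')).comp
    ((hφ.comp_contMDiffOn (contMDiffOn_extChartAt_symm c)).mono inter_subset_left) fun y hy => ?_
  rw [← extChartAt_source (𝓡∂ (n + 1))]
  exact hy.2

lemma fderivWithin_readIn (hφ : ContMDiff (𝓡∂ (n + 1)) (𝓡∂ (n + 1)) ∞ φ) {y : Model n}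
    (hy : y ∈ readDomain φ c c') (v : Model n) :
    fderivWithin ℝ (readIn φ c c') (halfSpace n) y v = dChart c' (φ ((chart c).symm y))
      (mfderiv (𝓡∂ (n + 1)) (𝓡∂ (n + 1)) φ ((chart c).symm y) (dSymm c y v)) := by
  have hu : UniqueMDiffWithinAt 𝓘(ℝ, Model n) (halfSpace n) y :=
    (uniqueDiffOn_halfSpace y ((isRelOpen_target c).subset hy.1)).uniqueMDiffWithinAt
  have h1 : MDifferentiableWithinAt 𝓘(ℝ, Model n) (𝓡∂ (n + 1)) (chart (n := n) c).symm
    (halfSpace n) y := mdifferentiableWithinAt_extChartAt_symm hy.1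
  have h2 : MDifferentiableAt (𝓡∂ (n + 1)) (𝓡∂ (n + 1)) φ ((chart (n := n) c).symm y) :=
    hφ.mdifferentiableAt (by simp)
  have h3 : MDifferentiableAt (𝓡∂ (n + 1)) 𝓘(ℝ, Model n) (chart (n := n) c')
      (φ ((chart (n := n) c).symm y)) := mdifferentiableAt_extChartAt (by
    rw [← extChartAt_source (𝓡∂ (n + 1))]; exact hy.2)
  rw [← mfderivWithin_eq_fderivWithin]
  have h4 := mfderiv_comp_mfderivWithin y h3 (h2.comp_mdifferentiableWithinAt y h1) hu
  have h5 := mfderiv_comp_mfderivWithin y h2 h1 hu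
  rw [h5] at h4
  exact DFunLike.congr_fun h4 v

lemma metricForm_readIn (hφ : ContMDiff (𝓡∂ (n + 1)) (𝓡∂ (n + 1)) ∞ φ) {h h' : Metric n M}
    (hp : IsPullback φ h' h) {y : Model n} (hy : y ∈ readDomain φ c c') (u v : Model n) :
    metricForm h c y u v = metricForm h' c' (readIn φ c c' y)
      (fderivWithin ℝ (readIn φ c c') (halfSpace n) y u)
      (fderivWithin ℝ (readIn φ c c') (halfSpace n) y v) := by
  rw [metricForm_apply, hp, inner_eq_metricForm h' hy.2, fderivWithin_readIn hφ hy,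
    fderivWithin_readIn hφ hy, readIn]

lemma vecChart_readIn (hφ : ContMDiff (𝓡∂ (n + 1)) (𝓡∂ (n + 1)) ∞ φ) {ξ σ : VField n M}
    (hσ : ∀ x, mfderiv (𝓡∂ (n + 1)) (𝓡∂ (n + 1)) φ x (ξ x) = σ (φ x)) {y : Model n}
    (hy : y ∈ readDomain φ c c') : vecChart σ c' (readIn φ c c' y) =
      fderivWithin ℝ (readIn φ c c') (halfSpace n) y (vecChart ξ c y) := by
  rw [fderivWithin_readIn hφ hy, dSymm_vecChart ξ hy.1, hσ, readIn, vecChart_apply σ hy.2]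

/-- The Lie derivative of a metric in a chart. -/
def lieForm (h : Metric n M) (V : VField n M) (c : M) (y u v : Model n) : ℝ :=
  lieDeriv (halfSpace n) (metricForm h c) (vecChart V c) y u v

/-- Used twice: with φ the identity it is independence of the chart, and with φ a diffeomorphism it
relates the deformation of φ^*h' along ξ to that of h' along φ_*ξ. -/
lemma lieForm_readIn (hφ : ContMDiff (𝓡∂ (n + 1)) (𝓡∂ (n + 1)) ∞ φ) {h h' : Metric n M}
    (hp : IsPullback φ h' h) {ξ σ : VField n M} (hξs : IsSmooth ξ) (hσs : IsSmooth σ)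
    (hσ : ∀ x, mfderiv (𝓡∂ (n + 1)) (𝓡∂ (n + 1)) φ x (ξ x) = σ (φ x)) {y : Model n}
    (hy : y ∈ readDomain φ c c') (u v : Model n) :
    lieForm h ξ c y u v = lieForm h' σ c' (readIn φ c c' y)
      (fderivWithin ℝ (readIn φ c c') (halfSpace n) y u)
      (fderivWithin ℝ (readIn φ c c') (halfSpace n) y v) := by
  have hU := isRelOpen_readDomain (n := n) (c := c) (c' := c') hφ.continuous
  have hF := smoothAlong_readIn (n := n) (c := c) (c' := c') hφ
  have hmem := hU.mem_nhdsWithin y hy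
  have hy' := readIn_mem_target hy
  exact lieDeriv_natural uniqueDiffOn_halfSpace (hU.subset hy)
    (hF.differentiableWithinAt hy) ((hF.fderivWithin hU).differentiableWithinAt hy)
    (isSymmSndFDerivWithinAt_halfSpace (hF y hy) (hU.subset hy))
    ((smoothAlong_metricForm h c).differentiableWithinAt hy.1)
    ((smoothAlong_metricForm h' c').differentiableWithinAt hy')
    ((hξs.vecChart c).differentiableWithinAt hy.1)
    ((hσs.vecChart c').differentiableWithinAt hy')
    (Filter.eventually_of_mem hmem fun z hz =>
      (isRelOpen_target c').subset (readIn_mem_target hz))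
    (Filter.eventually_of_mem hmem fun z hz => metricForm_readIn hφ hp hz)
    (Filter.eventually_of_mem hmem fun z hz => vecChart_readIn hφ hσ hz) u v

lemma metricForm_stdVec (h : Metric n M) (c : M) (y : Model n) (i j : Fin (n + 1)) :
    metricForm h c y (stdVec i) (stdVec j) = metricCoord h c y i j := by
  rw [metricForm_apply]; rfl

lemma metricForm_stdVec_right (h : Metric n M) (c : M) (y v : Model n) (j : Fin (n + 1)) :
    metricForm h c y v (stdVec j) = ∑ k, metricCoord h c y k j * v k := by
  conv_lhs => rw [eq_sum_stdVec v]
  simp only [map_sum, map_smul, sum_apply, smul_apply, smul_eq_mul, metricForm_stdVec, mul_comm]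

lemma metricForm_stdVec_left (h : Metric n M) (c : M) (y v : Model n) (i : Fin (n + 1)) :
    metricForm h c y (stdVec i) v = ∑ k, metricCoord h c y i k * v k := by
  conv_lhs => rw [eq_sum_stdVec v]
  simp only [map_sum, map_smul, smul_eq_mul, metricForm_stdVec, mul_comm]

lemma pd_vecCoord {V : VField n M} (hV : IsSmooth V) {c : M} {y : Model n}
    (hy : y ∈ (chart c).target) (i k : Fin (n + 1)) : pd i (fun z => vecCoord V c z k) y =
      fderivWithin ℝ (vecChart V c) (halfSpace n) y (stdVec i) k := by
  have h1 := (coordFun (n := n) k).hasFDerivAt.comp_hasFDerivWithinAt y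
    ((hV.vecChart c).differentiableWithinAt hy).hasFDerivWithinAt
  exact DFunLike.congr_fun
    (h1.fderivWithin (uniqueDiffOn_halfSpace y ((isRelOpen_target c).subset hy))) (stdVec i)

lemma fderivWithin_metricForm (h : Metric n M) {c : M} {y : Model n} (hy : y ∈ (chart c).target)
    (w : Model n) (i j : Fin (n + 1)) :
    fderivWithin ℝ (metricForm h c) (halfSpace n) y w (stdVec i) (stdVec j) =
      ∑ k, w k * pd k (fun z => metricCoord h c z i j) y := by
  have h1 := ((((smoothAlong_metricForm h c).differentiableWithinAt hy).hasFDerivWithinAt.clm_apply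
    (hasFDerivWithinAt_const (stdVec i : Model n) y _)).clm_apply
      (hasFDerivWithinAt_const (stdVec j : Model n) y _)).fderivWithin
        (uniqueDiffOn_halfSpace y ((isRelOpen_target c).subset hy))
  simp only [metricForm_stdVec] at h1
  have h2 : ∀ w, fderivWithin ℝ (metricForm h c) (halfSpace n) y w (stdVec i) (stdVec j) =
      fderivWithin ℝ (fun z => metricCoord h c z i j) (halfSpace n) y w := fun w => by
    rw [h1]; simp
  rw [h2]
  conv_lhs => rw [eq_sum_stdVec w]
  simp only [map_sum, map_smul, smul_eq_mul]
  rfl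

lemma lieCoord_eq {V : VField n M} (hV : IsSmooth V) (h : Metric n M) {c : M} {y : Model n}
    (hy : y ∈ (chart c).target) (i j : Fin (n + 1)) :
    lieCoord h V c y i j = lieForm h V c y (stdVec i) (stdVec j) := by
  have h1 := rep_lie hV h c i j y hy
  rw [TensorAlgebra.lieM_apply (metricR_transpose h c) (metricR_mul_invR h c)] at h1
  have h2 := ((Rep.sum (s := Finset.univ) fun k =>
    (rep_vec hV c k).mul ((rep_metric h c i j).pd k)).add
    (Rep.sum (s := Finset.univ) fun k => (rep_metric h c k j).mul ((rep_vec hV c k).pd i))).add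
    (Rep.sum (s := Finset.univ) fun k => (rep_metric h c i k).mul ((rep_vec hV c k).pd j)) y hy
  refine h1.trans (h2.symm.trans ?_)
  rw [lieForm, lieDeriv, fderivWithin_metricForm h hy, metricForm_stdVec_right,
    metricForm_stdVec_left]
  simp only [pd_vecCoord hV hy]
  rfl

lemma lieForm_eq_sum {V : VField n M} (hV : IsSmooth V) (h : Metric n M) {c : M} {y : Model n}
    (hy : y ∈ (chart c).target) (u v : Model n) :
    lieForm h V c y u v = ∑ i, ∑ j, lieCoord h V c y i j * u i * v j := by
  simp only [lieCoord_eq hV h hy]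
  conv_lhs => rw [eq_sum_stdVec u, eq_sum_stdVec v]
  simp only [lieForm, lieDeriv, map_sum, map_smul, sum_apply, smul_apply, smul_eq_mul,
    Finset.mul_sum, ← Finset.sum_add_distrib, add_mul]
  rw [Finset.sum_comm]
  exact Finset.sum_congr rfl fun i _ => Finset.sum_congr rfl fun j _ => by ring

lemma deformation_eq_self {V : VField n M} (hV : IsSmooth V) (h : Metric n M) (x : M)
    (u v : TangentSpace (𝓡∂ (n + 1)) x) :
    deformation h V x u v = lieForm h V x (chart x x) (tcomp u) (tcomp v) := by
  rw [lieForm_eq_sum hV h (mem_extChartAt_target x)]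
  rfl

lemma isPullback_id (h : Metric n M) : IsPullback id h h := fun x u v => by
  rw [mfderiv_id]; rfl

lemma chart_mem_readDomain {z : M} (hz : z ∈ (chart (n := n) c).source)
    (hz' : φ z ∈ (chart (n := n) c').source) : chart c z ∈ readDomain (n := n) φ c c' :=
  ⟨(chart c).map_source hz, by rwa [mem_preimage, mem_preimage, (chart c).left_inv hz]⟩

lemma readIn_chart {z : M} (hz : z ∈ (chart (n := n) c).source) :
    readIn (n := n) φ c c' (chart c z) = chart c' (φ z) := by
  rw [readIn, (chart c).left_inv hz]

lemma fderivWithin_readIn_chart (hφ : ContMDiff (𝓡∂ (n + 1)) (𝓡∂ (n + 1)) ∞ φ) {z : M}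
    (hz : z ∈ (chart (n := n) c).source) (hz' : φ z ∈ (chart (n := n) c').source)
    (u : TangentSpace (𝓡∂ (n + 1)) z) :
    fderivWithin ℝ (readIn φ c c') (halfSpace n) (chart c z) (dChart c z u) =
      dChart c' (φ z) (mfderiv (𝓡∂ (n + 1)) (𝓡∂ (n + 1)) φ z u) := by
  have h1 := fderivWithin_readIn hφ (chart_mem_readDomain hz hz')
  obtain ⟨y, hy, rfl⟩ : ∃ y ∈ (chart (n := n) c).target, (chart c).symm y = z :=
    ⟨chart c z, (chart c).map_source hz, (chart c).left_inv hz⟩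
  rw [(chart c).right_inv hy] at h1 ⊢
  rw [h1, dSymm_dChart hy]

/-! ### The density of the DeWitt metric -/

/-- The DeWitt pairing of two matrices. -/
def deWittPairing (m A B : Matrix (Fin (n + 1)) (Fin (n + 1)) ℝ) : ℝ :=
  ∑ i, ∑ j, ∑ k, ∑ l, (m⁻¹ i k * m⁻¹ j l - m⁻¹ i j * m⁻¹ k l) * A i j * B k l

open Matrix in
-- In trace form a change of basis becomes a conjugation. No symmetry of the matrices is assumed,
-- hence the transposes.
lemma deWittPairing_eq_trace (m A B : Matrix (Fin (n + 1)) (Fin (n + 1)) ℝ) :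
    deWittPairing m A B = (Aᵀ * m⁻¹ * B * (m⁻¹)ᵀ).trace - (Aᵀ * m⁻¹).trace * (Bᵀ * m⁻¹).trace := by
  have h1 : (Aᵀ * m⁻¹).trace = ∑ i, ∑ j, m⁻¹ i j * A i j := by
    simp only [Matrix.trace, Matrix.diag_apply, Matrix.mul_apply, Matrix.transpose_apply]
    rw [Finset.sum_comm]
    simp_rw [mul_comm]
  have h2 : (Bᵀ * m⁻¹).trace = ∑ k, ∑ l, m⁻¹ k l * B k l := by
    simp only [Matrix.trace, Matrix.diag_apply, Matrix.mul_apply, Matrix.transpose_apply]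
    rw [Finset.sum_comm]
    simp_rw [mul_comm]
  have h3 : (Aᵀ * m⁻¹ * B * (m⁻¹)ᵀ).trace =
      ∑ i, ∑ j, ∑ k, ∑ l, m⁻¹ i k * m⁻¹ j l * A i j * B k l := by
    simp only [Matrix.trace, Matrix.diag_apply, Matrix.mul_apply, Matrix.transpose_apply,
      Finset.sum_mul]
    calc _ = ∑ j, ∑ l, ∑ i, ∑ k, m⁻¹ i k * m⁻¹ j l * A i j * B k l := by
          refine Finset.sum_congr rfl fun j _ => Finset.sum_congr rfl fun l _ => ?_
          rw [Finset.sum_comm]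
          exact Finset.sum_congr rfl fun i _ => Finset.sum_congr rfl fun k _ => by ring
      _ = ∑ j, ∑ i, ∑ k, ∑ l, m⁻¹ i k * m⁻¹ j l * A i j * B k l := by
          refine Finset.sum_congr rfl fun j _ => ?_
          rw [Finset.sum_comm]
          exact Finset.sum_congr rfl fun i _ => Finset.sum_comm
      _ = _ := Finset.sum_comm
  rw [mul_comm, h1, h2, h3, deWittPairing]
  simp only [sub_mul, Finset.sum_sub_distrib, Finset.sum_mul, Finset.mul_sum]
  congr 1
  refine Finset.sum_congr rfl fun i _ => ?_
  rw [Finset.sum_congr rfl fun j _ => ?_]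
  refine Finset.sum_congr rfl fun k _ => Finset.sum_congr rfl fun l _ => ?_
  ring

open Matrix in
-- Each product of a form with the inverse metric is conjugated by the transpose of P, and traces do
-- not change under conjugation.
lemma deWittPairing_natural (m A B P : Matrix (Fin (n + 1)) (Fin (n + 1)) ℝ)
    (hP : IsUnit P.det) :
    deWittPairing (Pᵀ * m * P) (Pᵀ * A * P) (Pᵀ * B * P) = deWittPairing m A B := by
  have hPt : IsUnit (Pᵀ).det := by rwa [Matrix.det_transpose]
  have hinv : (Pᵀ * m * P)⁻¹ = P⁻¹ * m⁻¹ * (Pᵀ)⁻¹ := by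
    rw [Matrix.mul_inv_rev, Matrix.mul_inv_rev, mul_assoc]
  have h1 : ∀ X : Matrix (Fin (n + 1)) (Fin (n + 1)) ℝ,
      Pᵀ * X * P * (P⁻¹ * m⁻¹ * (Pᵀ)⁻¹) = Pᵀ * (X * m⁻¹) * (Pᵀ)⁻¹ := fun X => by
    calc _ = Pᵀ * X * (P * P⁻¹) * m⁻¹ * (Pᵀ)⁻¹ := by simp only [Matrix.mul_assoc]
      _ = _ := by rw [Matrix.mul_nonsing_inv _ hP]
                  simp only [Matrix.mul_assoc, Matrix.mul_one]
  have h1' : ∀ X : Matrix (Fin (n + 1)) (Fin (n + 1)) ℝ,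
      Pᵀ * X * P * (P⁻¹ * m⁻¹ * (Pᵀ)⁻¹)ᵀ = Pᵀ * (X * (m⁻¹)ᵀ) * (Pᵀ)⁻¹ := fun X => by
    have e : (P⁻¹ * m⁻¹ * (Pᵀ)⁻¹)ᵀ = P⁻¹ * (m⁻¹)ᵀ * (Pᵀ)⁻¹ := by
      simp only [Matrix.transpose_mul, Matrix.transpose_nonsing_inv, Matrix.transpose_transpose,
        Matrix.mul_assoc]
    rw [e]
    calc _ = Pᵀ * X * (P * P⁻¹) * (m⁻¹)ᵀ * (Pᵀ)⁻¹ := by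
          simp only [Matrix.mul_assoc]
      _ = _ := by rw [Matrix.mul_nonsing_inv _ hP]
                  simp only [Matrix.mul_assoc, Matrix.mul_one]
  have htr : ∀ X : Matrix (Fin (n + 1)) (Fin (n + 1)) ℝ,
      (Pᵀ * X * (Pᵀ)⁻¹).trace = X.trace := fun X => by
    rw [Matrix.trace_mul_cycle, Matrix.nonsing_inv_mul _ hPt, one_mul]
  have ht : ∀ X : Matrix (Fin (n + 1)) (Fin (n + 1)) ℝ, (Pᵀ * X * P)ᵀ = Pᵀ * Xᵀ * P := fun X => by
    rw [Matrix.transpose_mul, Matrix.transpose_mul, Matrix.transpose_transpose, mul_assoc]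
  rw [deWittPairing_eq_trace, deWittPairing_eq_trace, hinv, ht, ht, h1, h1, htr, htr]
  congr 1
  have h2 : Pᵀ * (Aᵀ * m⁻¹) * (Pᵀ)⁻¹ * (Pᵀ * B * P) * (P⁻¹ * m⁻¹ * (Pᵀ)⁻¹)ᵀ =
      Pᵀ * (Aᵀ * m⁻¹ * B * (m⁻¹)ᵀ) * (Pᵀ)⁻¹ := by
    rw [Matrix.mul_assoc _ (Pᵀ * B * P), h1', Matrix.mul_assoc Pᵀ (B * _), Matrix.mul_assoc _ (Pᵀ)⁻¹,
      ← Matrix.mul_assoc (Pᵀ)⁻¹, Matrix.nonsing_inv_mul _ hPt, Matrix.one_mul]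
    simp only [Matrix.mul_assoc]
  rw [h2, htr]

end Chart
end VacuaMetric
end

noncomputable section

namespace VacuaMetric

section Chart

variable {n : ℕ} {M : Type*} [TopologicalSpace M] [ChartedSpace (EuclideanHalfSpace (n + 1)) M]
  [IsManifold (𝓡∂ (n + 1)) ∞ M]

open Matrix

/-! ### The Jacobian matrix of a map read in charts -/

/-- The Jacobian matrix. -/
def jacobian (F : Model n → Model n) (y : Model n) : Matrix (Fin (n + 1)) (Fin (n + 1)) ℝ :=
  Matrix.of fun a i => fderivWithin ℝ F (halfSpace n) y (stdVec i) a

lemma jacobian_mulVec (F : Model n → Model n) (y v : Model n) (a : Fin (n + 1)) :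
    fderivWithin ℝ F (halfSpace n) y v a = (jacobian F y *ᵥ v) a := by
  conv_lhs => rw [eq_sum_stdVec v]
  simp [jacobian, Matrix.mulVec, dotProduct, mul_comm]

lemma det_fderivWithin (F : Model n → Model n) (y : Model n) :
    (fderivWithin ℝ F (halfSpace n) y).det = (jacobian F y).det := by
  rw [ContinuousLinearMap.det, ← LinearMap.det_toMatrix (EuclideanSpace.basisFun _ ℝ).toBasis]
  congr 1

lemma sum_bilinear_eq (m P : Matrix (Fin (n + 1)) (Fin (n + 1)) ℝ) (i j : Fin (n + 1)) :
    (Pᵀ * m * P) i j = ∑ a, ∑ b, m a b * P a i * P b j := by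
  simp only [Matrix.mul_apply, Matrix.transpose_apply, Finset.sum_mul]
  rw [Finset.sum_comm]
  exact Finset.sum_congr rfl fun a _ => Finset.sum_congr rfl fun b _ => by ring

variable {φ : M → M} {c c' : M} {h h' : Metric n M}

lemma metricCoord_readIn (hφ : ContMDiff (𝓡∂ (n + 1)) (𝓡∂ (n + 1)) ∞ φ)
    (hp : IsPullback φ h' h) {y : Model n} (hy : y ∈ readDomain φ c c') :
    metricCoord h c y = (jacobian (readIn φ c c') y)ᵀ * metricCoord h' c' (readIn φ c c' y) *
      jacobian (readIn φ c c') y := by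
  ext i j
  rw [← metricForm_stdVec, metricForm_readIn hφ hp hy, metricForm_eq_sum, sum_bilinear_eq]
  rfl

lemma lieCoord_readIn (hφ : ContMDiff (𝓡∂ (n + 1)) (𝓡∂ (n + 1)) ∞ φ)
    (hp : IsPullback φ h' h) {ξ σ : VField n M} (hξs : IsSmooth ξ) (hσs : IsSmooth σ)
    (hσ : ∀ x, mfderiv (𝓡∂ (n + 1)) (𝓡∂ (n + 1)) φ x (ξ x) = σ (φ x)) {y : Model n}
    (hy : y ∈ readDomain φ c c') :
    lieCoord h ξ c y = (jacobian (readIn φ c c') y)ᵀ * lieCoord h' σ c' (readIn φ c c' y) *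
      jacobian (readIn φ c c') y := by
  ext i j
  rw [lieCoord_eq hξs h hy.1, lieForm_readIn hφ hp hξs hσs hσ hy,
    lieForm_eq_sum hσs h' (readIn_mem_target hy), sum_bilinear_eq]
  rfl

lemma det_metricCoord_readIn (hφ : ContMDiff (𝓡∂ (n + 1)) (𝓡∂ (n + 1)) ∞ φ)
    (hp : IsPullback φ h' h) {y : Model n} (hy : y ∈ readDomain φ c c') :
    (metricCoord h c y).det = (jacobian (readIn φ c c') y).det ^ 2 *
      (metricCoord h' c' (readIn φ c c' y)).det := by
  rw [metricCoord_readIn hφ hp hy, Matrix.det_mul, Matrix.det_mul, Matrix.det_transpose]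
  ring

/-- The determinant of the pulled back metric is the squared Jacobian times that of the original,
and it is positive. No inverse of φ is needed. -/
lemma det_jacobian_ne_zero (hφ : ContMDiff (𝓡∂ (n + 1)) (𝓡∂ (n + 1)) ∞ φ)
    (hp : IsPullback φ h' h) {y : Model n} (hy : y ∈ readDomain φ c c') :
    (jacobian (readIn φ c c') y).det ≠ 0 := fun h0 => by
  have h1 := det_metricCoord_readIn hφ hp hy
  rw [h0] at h1
  have h2 := metricCoord_det_pos h hy.1
  rw [h1] at h2
  simp at h2

/-- The DeWitt density of deformations in a chart. -/
def chartDensity (h : Metric n M) (V W : VField n M) (c : M) (y : Model n) : ℝ :=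
  deWittPairing (metricCoord h c y) (lieCoord h V c y) (lieCoord h W c y)

lemma deWittDensity_self {V W : VField n M} (hV : IsSmooth V) (hW : IsSmooth W) (x : M) :
    deWittDensity h (deformation h V) (deformation h W) x = chartDensity h V W x (chart x x) := by
  have h1 : ∀ {V : VField n M}, IsSmooth V → ∀ i j, deformation h V x (tvec x (stdVec i))
      (tvec x (stdVec j)) = lieCoord h V x (chart x x) i j := fun hV i j => by
    rw [deformation_eq_self hV, lieCoord_eq hV h (mem_extChartAt_target x)]; rfl
  simp only [deWittDensity, h1 hV, h1 hW]
  rfl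

lemma deWittDensity_natural (hφ : ContMDiff (𝓡∂ (n + 1)) (𝓡∂ (n + 1)) ∞ φ)
    (hp : IsPullback φ h' h) {ξ₁ ξ₂ σ₁ σ₂ : VField n M} (hξ₁ : IsSmooth ξ₁) (hξ₂ : IsSmooth ξ₂)
    (hσ₁ : IsSmooth σ₁) (hσ₂ : IsSmooth σ₂)
    (h₁ : ∀ x, mfderiv (𝓡∂ (n + 1)) (𝓡∂ (n + 1)) φ x (ξ₁ x) = σ₁ (φ x))
    (h₂ : ∀ x, mfderiv (𝓡∂ (n + 1)) (𝓡∂ (n + 1)) φ x (ξ₂ x) = σ₂ (φ x)) {x : M}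
    (hx : φ x ∈ (chart (n := n) c').source) :
    deWittDensity h (deformation h ξ₁) (deformation h ξ₂) x =
      chartDensity h' σ₁ σ₂ c' (chart c' (φ x)) := by
  have hx0 := mem_extChartAt_source (I := 𝓡∂ (n + 1)) x
  have hy := chart_mem_readDomain hx0 hx
  rw [deWittDensity_self hξ₁ hξ₂, chartDensity, metricCoord_readIn hφ hp hy,
    lieCoord_readIn hφ hp hξ₁ hσ₁ h₁ hy, lieCoord_readIn hφ hp hξ₂ hσ₂ h₂ hy,
    deWittPairing_natural _ _ _ _ (isUnit_iff_ne_zero.2 (det_jacobian_ne_zero hφ hp hy)),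
    readIn_chart hx0, chartDensity]

lemma deWittDensity_chart {V W : VField n M} (hV : IsSmooth V) (hW : IsSmooth W) {c x : M}
    (hx : x ∈ (chart (n := n) c).source) :
    deWittDensity h (deformation h V) (deformation h W) x = chartDensity h V W c (chart c x) :=
  deWittDensity_natural contMDiff_id (isPullback_id h) hV hW hV hW
    (fun x => by rw [mfderiv_id]; rfl) (fun x => by rw [mfderiv_id]; rfl) hx

/-! ### The boundary -/

lemma interior_halfSpace_eq : interior (halfSpace n) = {y | 0 < y 0} :=
  interior_range_modelWithCornersEuclideanHalfSpace _

/-- Boundary points are defined through the preferred chart; invariance of interior points under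
chart changes allows any chart around the point. -/
lemma mem_boundary_iff {x : M} (hx : x ∈ (chart (n := n) c).source) :
    x ∈ (𝓡∂ (n + 1)).boundary M ↔ chart (n := n) c x 0 = 0 := by
  have hy := (chart (n := n) c).map_source hx
  have h1 : x ∈ (𝓡∂ (n + 1)).interior M ↔ chart (n := n) c x ∈ interior (chart (n := n) c).target :=
    (𝓡∂ (n + 1)).isInteriorPoint_iff_of_mem_atlas (n := 1) one_ne_zero (chart_mem_atlas _ c)
      (by rwa [← extChartAt_source (𝓡∂ (n + 1))])
  have h2 : chart (n := n) c x ∈ interior (chart (n := n) c).target ↔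
      chart (n := n) c x ∈ interior (halfSpace n) := by
    refine ⟨fun h => interior_mono (isRelOpen_target c).subset h, fun h => ?_⟩
    have h3 := (isRelOpen_target c).mem_nhdsWithin _ hy
    rw [nhdsWithin_eq_nhds.2 (mem_interior_iff_mem_nhds.1 h)] at h3
    exact mem_interior_iff_mem_nhds.2 h3
  have h4 : 0 ≤ chart (n := n) c x 0 := by
    have := (isRelOpen_target c).subset hy
    rwa [halfSpace_eq] at this
  rw [← ModelWithCorners.compl_interior, mem_compl_iff, h1, h2, interior_halfSpace_eq, mem_ofPred_eq,
    not_lt]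
  exact ⟨fun h => le_antisymm h h4, fun h => h.le⟩

lemma symm_mem_boundary_iff {y : Model n} (hy : y ∈ (chart c).target) :
    (chart c).symm y ∈ (𝓡∂ (n + 1)).boundary M ↔ y 0 = 0 := by
  rw [mem_boundary_iff ((chart c).map_target hy), (chart c).right_inv hy]

lemma mem_posTangentCone_halfSpace {y v : Model n} (hy : y ∈ halfSpace n) (hv : 0 ≤ v 0) :
    v ∈ posTangentConeAt (halfSpace n) y := by
  refine mem_posTangentConeAt_of_segment_subset ?_
  have hc : Convex ℝ (halfSpace n) := (𝓡∂ (n + 1)).convex_range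
  refine hc.segment_subset hy ?_
  rw [halfSpace_eq] at hy ⊢
  exact add_nonneg hy hv

/-- At boundary points the first component of the derivative of a chart change is determined by
its sign. -/
lemma fderivWithin_readIn_zero_nonneg (hφ : ContMDiff (𝓡∂ (n + 1)) (𝓡∂ (n + 1)) ∞ φ) {y v : Model n}
    (hy : y ∈ readDomain φ c c') (h0 : readIn φ c c' y 0 = 0) (hv : 0 ≤ v 0) :
    0 ≤ fderivWithin ℝ (readIn φ c c') (halfSpace n) y v 0 := by
  have hU := isRelOpen_readDomain (n := n) (c := c) (c' := c') hφ.continuous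
  have h1 := (coordFun (n := n) 0).hasFDerivAt.comp_hasFDerivWithinAt y
    ((smoothAlong_readIn hφ).differentiableWithinAt hy).hasFDerivWithinAt
  -- The boundary defining coordinate of the image is nonnegative and vanishes at y, so y is a
  -- minimum and the derivative is nonnegative in every direction pointing into the half space.
  have hmin : IsLocalMinOn (coordFun (n := n) 0 ∘ readIn φ c c') (halfSpace n) y := by
    filter_upwards [hU.mem_nhdsWithin y hy] with z hz
    have := (isRelOpen_target c').subset (readIn_mem_target hz)
    rw [halfSpace_eq] at this
    simpa [h0] using this
  exact hmin.hasFDerivWithinAt_nonneg h1 (mem_posTangentCone_halfSpace (hU.subset hy) hv)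

/-- Both signs of a direction tangent to the boundary point into the half space, so the derivative
has both signs. -/
lemma jacobian_zero_succ (hφ : ContMDiff (𝓡∂ (n + 1)) (𝓡∂ (n + 1)) ∞ φ) {y : Model n}
    (hy : y ∈ readDomain φ c c') (h0 : readIn φ c c' y 0 = 0) {i : Fin (n + 1)} (hi : i ≠ 0) :
    jacobian (readIn φ c c') y 0 i = 0 := by
  have h1 := fderivWithin_readIn_zero_nonneg hφ (v := stdVec i) hy h0 (by simp [hi.symm])
  have h2 := fderivWithin_readIn_zero_nonneg hφ (v := -stdVec i) hy h0 (by simp [hi.symm])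
  rw [map_neg, PiLp.neg_apply, neg_nonneg] at h2
  exact le_antisymm h2 h1

/-- If this entry were zero, the whole first row would vanish, against invertibility of the
Jacobian. Positivity is what keeps the outward direction outward. -/
lemma jacobian_zero_zero_pos (hφ : ContMDiff (𝓡∂ (n + 1)) (𝓡∂ (n + 1)) ∞ φ)
    (hp : IsPullback φ h' h) {y : Model n}
    (hy : y ∈ readDomain φ c c') (h0 : readIn φ c c' y 0 = 0) :
    0 < jacobian (readIn φ c c') y 0 0 := by
  refine lt_of_le_of_ne (fderivWithin_readIn_zero_nonneg hφ hy h0 (by simp)) fun h1 => ?_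
  refine det_jacobian_ne_zero hφ hp hy (Matrix.det_eq_zero_of_row_eq_zero 0 fun i => ?_)
  by_cases hi : i = 0
  · rw [hi]; exact h1.symm
  · exact jacobian_zero_succ hφ hy h0 hi

end Chart
end VacuaMetric
end

noncomputable section

namespace VacuaMetric

section Boundary

variable {n : ℕ} {M : Type*} [TopologicalSpace M] [ChartedSpace (EuclideanHalfSpace (n + 1)) M]
  [IsManifold (𝓡∂ (n + 1)) ∞ M]

open Matrix VacuaMetric.TensorAlgebra

/-! ### The normal vector -/

/-- The unit normal of the level sets of the boundary defining coordinate. -/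
def normalVec (h : Metric n M) (c : M) (y : Model n) : Model n := WithLp.toLp 2 (normalCoord h c y)

/-- N is the negative normalized gradient of the coordinate y⁰, so lowering its index gives
−dy⁰/√h^{00}. -/
lemma metricForm_normalVec (h : Metric n M) {c : M} {y : Model n} (hy : y ∈ (chart c).target)
    (v : Model n) :
    metricForm h c y (normalVec h c y) v = - v 0 / √(invCoord h c y 0 0) := by
  have h1 : invCoord h c y * metricCoord h c y = 1 := mul_eq_one_comm.mp (metricCoord_mul_inv h hy)
  have h2 : ∀ j, ∑ i, metricCoord h c y i j * normalCoord h c y i =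
      - (if (0 : Fin (n + 1)) = j then 1 else 0) / √(invCoord h c y 0 0) := fun j => by
    have h3 := congrFun (congrFun h1 0) j
    rw [Matrix.mul_apply, Matrix.one_apply] at h3
    rw [← h3, ← Finset.sum_neg_distrib, Finset.sum_div]
    refine Finset.sum_congr rfl fun i _ => ?_
    have h4 : invCoord h c y i 0 = invCoord h c y 0 i :=
      congrFun (congrFun (invCoord_transpose h) 0) i
    rw [normalCoord, h4]
    ring
  rw [metricForm_eq_sum, Finset.sum_comm]
  calc _ = ∑ j, (∑ i, metricCoord h c y i j * normalCoord h c y i) * v j := by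
        simp_rw [Finset.sum_mul]; rfl
    _ = _ := by
        simp_rw [h2]
        rw [Finset.sum_eq_single 0 (fun j _ hj => by simp [hj.symm]) (by simp), if_pos rfl]
        ring

variable {φ : M → M} {c c' : M} {h h' : Metric n M}

lemma invCoord_readIn (hφ : ContMDiff (𝓡∂ (n + 1)) (𝓡∂ (n + 1)) ∞ φ)
    (hp : IsPullback φ h' h) {y : Model n} (hy : y ∈ readDomain φ c c') :
    invCoord h' c' (readIn φ c c' y) = jacobian (readIn φ c c') y * invCoord h c y *
      (jacobian (readIn φ c c') y)ᵀ := by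
  set P := jacobian (readIn φ c c') y with hP
  have hu : IsUnit P.det := isUnit_iff_ne_zero.2 (det_jacobian_ne_zero hφ hp hy)
  have hut : IsUnit (Pᵀ).det := by rwa [Matrix.det_transpose]
  rw [invCoord, invCoord, metricCoord_readIn hφ hp hy, Matrix.mul_inv_rev, Matrix.mul_inv_rev,
    ← hP, ← Matrix.mul_assoc, ← Matrix.mul_assoc, Matrix.mul_nonsing_inv _ hu, Matrix.one_mul,
    Matrix.mul_assoc, Matrix.nonsing_inv_mul _ hut, Matrix.mul_one]

/-- At the boundary the first row of the Jacobian is (P₀₀, 0, …, 0) with P₀₀ > 0. Thus dy⁰ is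
rescaled by a positive factor, which the normalization removes. Away from the boundary N does depend
on the chart. -/
lemma normalVec_readIn (hφ : ContMDiff (𝓡∂ (n + 1)) (𝓡∂ (n + 1)) ∞ φ)
    (hp : IsPullback φ h' h) {y : Model n} (hy : y ∈ readDomain φ c c')
    (h0 : readIn φ c c' y 0 = 0) :
    fderivWithin ℝ (readIn φ c c') (halfSpace n) y (normalVec h c y) =
      normalVec h' c' (readIn φ c c' y) := by
  set P := jacobian (readIn φ c c') y with hP
  have hpos : 0 < P 0 0 := jacobian_zero_zero_pos hφ hp hy h0
  have hrow : ∀ i ≠ 0, P 0 i = 0 := fun i hi => jacobian_zero_succ hφ hy h0 hi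
  have hk : ∀ k, invCoord h' c' (readIn φ c c' y) k 0 = P 0 0 * (P * invCoord h c y) k 0 :=
    fun k => by
      rw [invCoord_readIn hφ hp hy, ← hP, Matrix.mul_apply]
      rw [Finset.sum_eq_single 0 (fun j _ hj => by simp [hrow j hj]) (by simp),
        Matrix.transpose_apply, mul_comm]
  have h00 : (P * invCoord h c y) 0 0 = P 0 0 * invCoord h c y 0 0 := by
    rw [Matrix.mul_apply, Finset.sum_eq_single 0 (fun j _ hj => by simp [hrow j hj]) (by simp)]
  have hs : √(invCoord h' c' (readIn φ c c' y) 0 0) = P 0 0 * √(invCoord h c y 0 0) := by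
    rw [hk, h00, ← mul_assoc, Real.sqrt_mul (by positivity), Real.sqrt_mul_self hpos.le]
  ext k
  rw [jacobian_mulVec]
  change ∑ a, P k a * (- invCoord h c y a 0 / √(invCoord h c y 0 0)) =
    - invCoord h' c' (readIn φ c c' y) k 0 / √(invCoord h' c' (readIn φ c c' y) 0 0)
  rw [hs, hk, ← mul_neg, mul_div_mul_left _ _ hpos.ne', Matrix.mul_apply, ← Finset.sum_neg_distrib,
    Finset.sum_div]
  exact Finset.sum_congr rfl fun i _ => by ring

lemma dChart_eq_fderivWithin {x : M} (hx : x ∈ (chart (n := n) c').source)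
    (u : TangentSpace (𝓡∂ (n + 1)) x) : dChart c' x u =
      fderivWithin ℝ (readIn id x c') (halfSpace n) (chart x x) (tcomp u) := by
  have h1 := fderivWithin_readIn_chart (n := n) (c := x) (c' := c') contMDiff_id
    (mem_extChartAt_source (I := 𝓡∂ (n + 1)) x) hx u
  rw [dChart_self, mfderiv_id] at h1
  exact h1.symm

lemma dChart_outwardNormal {x : M} (hx : x ∈ (chart (n := n) c).source)
    (hb : x ∈ (𝓡∂ (n + 1)).boundary M) :
    dChart c x (outwardNormal h x) = normalVec h c (chart c x) := by
  have hx0 := mem_extChartAt_source (I := 𝓡∂ (n + 1)) x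
  have h2 := readIn_chart (n := n) (φ := id) (c' := c) hx0
  rw [dChart_eq_fderivWithin hx]
  refine (normalVec_readIn contMDiff_id (isPullback_id h)
    (chart_mem_readDomain (φ := id) hx0 hx) ?_).trans ?_
  · rw [h2]; exact (mem_boundary_iff hx).1 hb
  · rw [h2, id]

lemma inner_outwardNormal {x : M} (hx : x ∈ (chart (n := n) c).source)
    (hb : x ∈ (𝓡∂ (n + 1)).boundary M) (v : TangentSpace (𝓡∂ (n + 1)) x) :
    h.inner x (outwardNormal h x) v = - dChart c x v 0 / √(invCoord h c (chart c x) 0 0) := by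
  rw [inner_eq_metricForm h hx, dChart_outwardNormal hx hb,
    metricForm_normalVec h ((chart c).map_source hx)]

lemma inner_outwardNormal_eq_zero_iff {x : M} (hx : x ∈ (chart (n := n) c).source)
    (hb : x ∈ (𝓡∂ (n + 1)).boundary M) (v : TangentSpace (𝓡∂ (n + 1)) x) :
    h.inner x (outwardNormal h x) v = 0 ↔ dChart c x v 0 = 0 := by
  have h1 := (Real.sqrt_pos.2 (invCoord_zero_pos h ((chart (n := n) c).map_source hx) 0)).ne'
  rw [inner_outwardNormal hx hb, div_eq_zero_iff, neg_eq_zero, or_iff_left h1]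

lemma BoundaryPreserving.vecChart_zero {V : VField n M} (hV : BoundaryPreserving h V) {y : Model n}
    (hy : y ∈ (chart c).target) (h0 : y 0 = 0) : vecChart V c y 0 = 0 := by
  have hb := (symm_mem_boundary_iff hy).2 h0
  exact (inner_outwardNormal_eq_zero_iff ((chart c).map_target hy) hb _).1 (hV _ hb)

lemma tangentialPart_eq {V : VField n M} (hV : BoundaryPreserving h V) {x : M}
    (hb : x ∈ (𝓡∂ (n + 1)).boundary M) : tangentialPart h V x = V x := by
  rw [tangentialPart, hV x hb, zero_smul, sub_zero]

/-- Tangential derivatives of functions that vanish on the boundary. -/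
lemma fderivWithin_eq_zero_of_boundary {U : Set (Model n)} (hU : IsRelOpen U) {f : Model n → ℝ}
    {y u : Model n} (hy : y ∈ U) (hf : DifferentiableWithinAt ℝ f (halfSpace n) y)
    (hf0 : ∀ z ∈ U, z 0 = 0 → f z = 0) (hy0 : y 0 = 0) (hu : u 0 = 0) :
    fderivWithin ℝ f (halfSpace n) y u = 0 := by
  set S : Set (Model n) := {z | z 0 = 0} with hS
  have hsub : S ⊆ halfSpace n := fun z hz => by
    rw [halfSpace_eq]; exact (show z 0 = 0 from hz).ge
  have h1 := hf.hasFDerivWithinAt.mono hsub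
  have h2 : HasFDerivWithinAt f (0 : Model n →L[ℝ] ℝ) S y := by
    refine (hasFDerivWithinAt_const (0 : ℝ) y S).congr_of_eventuallyEq ?_ (hf0 y hy hy0)
    filter_upwards [nhdsWithin_mono y hsub (hU.mem_nhdsWithin y hy), self_mem_nhdsWithin]
      with z hz hz' using hf0 z hz hz'
  have h3 : u ∈ tangentConeAt ℝ S y := by
    have h4 : y + u - y ∈ tangentConeAt ℝ S y := by
      refine mem_tangentConeAt_of_segment_subset fun z hz => ?_
      obtain ⟨t, _, rfl⟩ := segment_eq_image_lineMap ℝ y (y + u) ▸ hz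
      simp [hS, AffineMap.lineMap_apply, hu, hy0]
    rwa [add_sub_cancel_left] at h4
  -- Within the boundary hyperplane f has both its own derivative and zero as derivative; they agree
  -- on tangent directions of the hyperplane.
  exact (h1.unique_on h2 h3).trans rfl

lemma smoothAlong_normalCoord (h : Metric n M) (c : M) (k : Fin (n + 1)) :
    SmoothAlong (chart c).target (fun y => normalCoord h c y k) := fun y hy =>
  (smoothAlong_invCoord h c k 0 y hy).neg.div
    ((smoothAlong_invCoord h c 0 0 y hy).sqrt (invCoord_zero_pos h hy 0).ne')
    (Real.sqrt_pos.2 (invCoord_zero_pos h hy 0)).ne'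

/-- The normal over the ring of smooth functions. -/
def normalR (h : Metric n M) (c : M) : Fin (n + 1) → ChartRing (n := n) c :=
  fun k => ofSmooth _ _ (smoothAlong_normalCoord h c k)

lemma rep_normal (h : Metric n M) (c : M) (k : Fin (n + 1)) :
    Rep (fun y => normalCoord h c y k) (normalR h c k) := rep_ofSmooth (smoothAlong_normalCoord h c k)

lemma rep_inner (h : Metric n M) (c : M) {V W : Model n → Fin (n + 1) → ℝ}
    {v w : Fin (n + 1) → ChartRing (n := n) c} (hV : ∀ k, Rep (fun y => V y k) (v k))
    (hW : ∀ k, Rep (fun y => W y k) (w k)) :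
    Rep (fun y => metricForm h c y (WithLp.toLp 2 (V y)) (WithLp.toLp 2 (W y)))
      (v ⬝ᵥ metricR h c *ᵥ w) := by
  refine (Rep.sum (s := Finset.univ) fun i => (hV i).mul (Rep.sum (s := Finset.univ) fun j =>
    (rep_metric h c i j).mul (hW j))).congr fun y _ => ?_
  rw [metricForm_eq_sum]
  simp only [Finset.mul_sum]
  exact Finset.sum_congr rfl fun i _ => Finset.sum_congr rfl fun j _ => by ring

lemma rep_orthPart (h : Metric n M) (c : M) {W : Model n → Fin (n + 1) → ℝ}
    {w : Fin (n + 1) → ChartRing (n := n) c} (hW : ∀ k, Rep (fun y => W y k) (w k))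
    (k : Fin (n + 1)) :
    Rep (fun y => orthPart h c W y k) (orthV (metricR h c) (normalR h c) w k) := by
  refine ((hW k).sub ((rep_inner h c hW (rep_normal h c)).mul (rep_normal h c k))).congr
    fun y _ => ?_
  rw [orthPart, metricForm_eq_sum]

end Boundary
end VacuaMetric
end

noncomputable section

namespace VacuaMetric

/-! ### The boundary integrand as a Lie derivative; gradients -/

section Boundary

variable {n : ℕ} {M : Type*} [TopologicalSpace M] [ChartedSpace (EuclideanHalfSpace (n + 1)) M]
  [IsManifold (𝓡∂ (n + 1)) ∞ M]

open Matrix VacuaMetric.TensorAlgebra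

variable {c : M} {h : Metric n M} {V : VField n M}

/-- A constant vector field over the ring of smooth functions. -/
def constR (c : M) (u : Model n) : Fin (n + 1) → ChartRing (n := n) c :=
  fun k => ofSmooth _ _ (smoothAlong_const (u k))

lemma rep_const (c : M) (u : Model n) (k : Fin (n + 1)) :
    Rep (fun _ => u k) (constR c u k) := rep_ofSmooth (smoothAlong_const (u k))

/-- The covariant derivative of a vector field over the ring of smooth functions, both indices
lowered. -/
def hessR (h : Metric n M) (hV : IsSmooth V) (c : M) :
    Matrix (Fin (n + 1)) (Fin (n + 1)) (ChartRing (n := n) c) :=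
  metricR h c * nablaV (chartDer c) (metricR h c) (invR h c) (vecR hV c)

lemma inner_self_eq {x : M} (u v : TangentSpace (𝓡∂ (n + 1)) x) :
    h.inner x u v = metricForm h x (chart x x) (tcomp u) (tcomp v) := by
  rw [inner_eq_metricForm h (mem_extChartAt_source x), dChart_self, dChart_self]

lemma metricForm_symm (c : M) (y u v : Model n) :
    metricForm h c y u v = metricForm h c y v u := by
  rw [metricForm_apply, metricForm_apply, h.symm]

lemma inner_outwardNormal_self {x : M} (hb : x ∈ (𝓡∂ (n + 1)).boundary M)
    (u : TangentSpace (𝓡∂ (n + 1)) x) :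
    h.inner x (outwardNormal h x) u = 0 ↔ tcomp u 0 = 0 := by
  rw [inner_outwardNormal_eq_zero_iff (mem_extChartAt_source x) hb, dChart_self]

lemma chart_self_zero {x : M} (hb : x ∈ (𝓡∂ (n + 1)).boundary M) : chart (n := n) x x 0 = 0 :=
  (mem_boundary_iff (mem_extChartAt_source x)).1 hb

lemma rep_inner_normal_right {W : Model n → Fin (n + 1) → ℝ}
    {w : Fin (n + 1) → ChartRing (n := n) c} (hW : ∀ k, Rep (fun y => W y k) (w k)) :
    Rep (fun y => - W y 0 / √(invCoord h c y 0 0)) (w ⬝ᵥ metricR h c *ᵥ normalR h c) :=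
  (rep_inner h c hW (rep_normal h c)).congr fun y hy => by
    rw [metricForm_symm]
    exact (metricForm_normalVec h hy (WithLp.toLp 2 (W y))).symm

lemma rep_inner_normal_left {W : Model n → Fin (n + 1) → ℝ}
    {w : Fin (n + 1) → ChartRing (n := n) c} (hW : ∀ k, Rep (fun y => W y k) (w k)) :
    Rep (fun y => - W y 0 / √(invCoord h c y 0 0)) (normalR h c ⬝ᵥ metricR h c *ᵥ w) :=
  (rep_inner h c (rep_normal h c) hW).congr fun y hy => (metricForm_normalVec h hy (WithLp.toLp 2 (W y))).symm

/-- The normal derivative of a boundary preserving field in terms of its covariant derivative. -/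
lemma inner_normalDeriv (hV : IsSmooth V) (hbp : BoundaryPreserving h V) {x : M}
    (hb : x ∈ (𝓡∂ (n + 1)).boundary M) (u : TangentSpace (𝓡∂ (n + 1)) x)
    (hu : h.inner x (outwardNormal h x) u = 0) :
    h.inner x (normalDeriv h V x) u = evalAt (isRelOpen_target x) (mem_extChartAt_target x)
      (constR x (tcomp u) ⬝ᵥ hessR h hV x *ᵥ normalR h x) := by
  have hy := mem_extChartAt_target (I := 𝓡∂ (n + 1)) x
  have h0 := chart_self_zero hb
  rw [h.symm, inner_self_eq, hessR, dotProduct_mul_nablaV]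
  -- The vector u is extended with constant components. The extension needs to be orthogonal to the
  -- normal only at x.
  refine Eq.trans ?_ (eval_inner_normal_derivative (D := chartDer x) (H := invR h x)
    (evalAt (isRelOpen_target x) hy).toRingHom (normalR h x) (constR x (tcomp u)) (vecR hV x) ?_ ?_)
  · have h1 : ∀ k, Rep (fun y => ∑ i, normalCoord h x y i *
          covVec h x (orthPart h x (vecCoord V x)) i k y)
        ((∑ i, normalR h x i • covV (chartDer x) (metricR h x) (invR h x) i
          (orthV (metricR h x) (normalR h x) (vecR hV x))) k) := fun k => by
      rw [Finset.sum_apply]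
      exact Rep.sum fun i => (rep_normal h x i).mul
        (rep_covVec h x (rep_orthPart h x (rep_vec hV x)) i k)
    exact rep_inner h x (rep_const x (tcomp u)) (rep_orthPart h x h1) _ hy
  · refine ((rep_inner_normal_right (rep_vec hV x)) _ hy).symm.trans ?_
    beta_reduce
    rw [vecCoord_eq, hbp.vecChart_zero hy h0, neg_zero, zero_div]
  · refine ((rep_inner_normal_right (rep_const x (tcomp u))) _ hy).symm.trans ?_
    beta_reduce
    rw [(inner_outwardNormal_self hb u).1 hu, neg_zero, zero_div]

/-- V is tangential all along the boundary, so h(n, V) = 0 may be differentiated in the tangential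
direction u, which moves the derivative from the normal to V. -/
lemma extrinsicCurvature_eq (hV : IsSmooth V) (hbp : BoundaryPreserving h V) {x : M}
    (hb : x ∈ (𝓡∂ (n + 1)).boundary M) (u : TangentSpace (𝓡∂ (n + 1)) x)
    (hu : h.inner x (outwardNormal h x) u = 0) :
    extrinsicCurvature h x u (V x) = - evalAt (isRelOpen_target x) (mem_extChartAt_target x)
      (normalR h x ⬝ᵥ hessR h hV x *ᵥ constR x (tcomp u)) := by
  have hy := mem_extChartAt_target (I := 𝓡∂ (n + 1)) x
  have h0 := chart_self_zero hb
  rw [hessR, dotProduct_mul_nablaV]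
  refine Eq.trans ?_ (eval_extrinsic (D := chartDer x) (metricR_transpose h x)
    (metricR_mul_invR h x) (evalAt (isRelOpen_target x) hy).toRingHom (normalR h x)
      (constR x (tcomp u)) (vecR hV x) ?_)
  · refine Eq.trans ?_ ((Rep.sum (s := Finset.univ) fun i => (rep_const x (tcomp u) i).mul
      (rep_inner h x (rep_covVec h x (rep_normal h x) i) (rep_vec hV x))) _ hy)
    have h1 : ∀ j, tcomp (V x) j = vecCoord V x (chart x x) j := fun j => by
      rw [vecCoord_eq, vecChart_apply V (mem_extChartAt_source x), dChart_self]
    simp only [extrinsicCurvature, metricForm_eq_sum, Finset.mul_sum, h1]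
    refine Finset.sum_congr rfl fun i _ => Finset.sum_congr rfl fun k _ =>
      Finset.sum_congr rfl fun j _ => by ring
  · have h1 := rep_inner_normal_left (h := h) (rep_vec hV x)
    refine ((Rep.sum (s := Finset.univ) fun i => (rep_const x (tcomp u) i).mul (h1.pd i))
      _ hy).symm.trans ?_
    -- The normal component −V⁰/√h^{00} vanishes on the whole boundary part of the chart, so its
    -- derivative along u is zero.
    have h2 := fderivWithin_eq_zero_of_boundary (isRelOpen_target x) hy
      (h1.smoothAlong.differentiableWithinAt hy) (fun z hz hz0 => by
        rw [vecCoord_eq, hbp.vecChart_zero hz hz0, neg_zero, zero_div]) h0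
      ((inner_outwardNormal_self hb u).1 hu)
    rw [eq_sum_stdVec (tcomp u), map_sum] at h2
    simp only [map_smul, smul_eq_mul] at h2
    exact h2

/-- The boundary density in terms of the Lie derivative of the metric. -/
lemma boundaryDensity_eq_self {W : VField n M} (hV : IsSmooth V) (hbp : BoundaryPreserving h V)
    (hbp' : BoundaryPreserving h W) {x : M} (hb : x ∈ (𝓡∂ (n + 1)).boundary M) :
    boundaryDensity h W V x =
      lieForm h V x (chart x x) (normalVec h x (chart x x)) (tcomp (W x)) := by
  have hy := mem_extChartAt_target (I := 𝓡∂ (n + 1)) x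
  have hW := hbp' x hb
  -- The minus sign of the curvature term cancels the one from `extrinsicCurvature_eq`; the two
  -- derivatives of V, in the normal direction and along W, form the symmetrized derivative.
  rw [boundaryDensity, tangentialPart_eq hbp hb, tangentialPart_eq hbp' hb, h.symm,
    inner_normalDeriv hV hbp hb _ hW, extrinsicCurvature_eq hV hbp hb _ hW, sub_neg_eq_add,
    lieForm_eq_sum hV h hy, add_comm, hessR, dotProduct_mul_nablaV, dotProduct_mul_nablaV,
    ← map_add, ← dotProduct_lieM]
  refine ((Rep.sum (s := Finset.univ) fun i => (rep_normal h x i).mul (Rep.sum (s := Finset.univ)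
    fun j => (rep_lie hV h x i j).mul (rep_const x (tcomp (W x)) j))) _ hy).symm.trans ?_
  simp only [Finset.mul_sum]
  exact Finset.sum_congr rfl fun i _ => Finset.sum_congr rfl fun j _ => by
    rw [normalVec]; ring

/-- The integrand is defined with the chart at the point itself. Here it is expressed in one fixed
chart, by a formula that is meaningful and smooth also off the boundary. -/
lemma boundaryDensity_chart {W : VField n M} (hV : IsSmooth V) (hbp : BoundaryPreserving h V)
    (hbp' : BoundaryPreserving h W) {x : M} (hb : x ∈ (𝓡∂ (n + 1)).boundary M)
    (hx : x ∈ (chart (n := n) c).source) :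
    boundaryDensity h W V x = lieForm h V c (chart c x) (normalVec h c (chart c x))
      (vecChart W c (chart c x)) := by
  have hx0 := mem_extChartAt_source (I := 𝓡∂ (n + 1)) x
  have h2 := readIn_chart (n := n) (φ := id) (c' := c) hx0
  have h3 := chart_mem_readDomain (φ := id) hx0 hx
  rw [boundaryDensity_eq_self hV hbp hbp' hb,
    lieForm_readIn contMDiff_id (isPullback_id h) hV hV
      (fun x => by rw [mfderiv_id]; rfl) h3, normalVec_readIn contMDiff_id (isPullback_id h) h3 (by
        rw [h2]; exact (mem_boundary_iff hx).1 hb), ← dChart_eq_fderivWithin hx,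
    vecChart_apply W hx, h2, id]

/-! ### Gradients -/

variable {α : M → ℝ}

/-- h(∇α, v) = dα(v) characterizes the gradient without reference to the chart used to define it;
its components in any other chart follow from this. -/
lemma inner_grad (x : M) (v : TangentSpace (𝓡∂ (n + 1)) x) :
    h.inner x (grad h α x) v = realVec (mfderiv (𝓡∂ (n + 1)) 𝓘(ℝ, ℝ) α x v) := by
  have hy := mem_extChartAt_target (I := 𝓡∂ (n + 1)) x
  set d : Fin (n + 1) → ℝ :=
    fun j => realVec (mfderiv (𝓡∂ (n + 1)) 𝓘(ℝ, ℝ) α x (tvec x (stdVec j))) with hd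
  have h1 : tcomp (grad h α x) = WithLp.toLp 2 (invCoord h x (chart x x) *ᵥ d) := rfl
  have h2 : realVec (mfderiv (𝓡∂ (n + 1)) 𝓘(ℝ, ℝ) α x v) = ∑ j, tcomp v j * d j := by
    have e1 : v = ∑ j, tcomp v j • tvec x (stdVec j) := eq_sum_stdVec (tcomp v)
    conv_lhs => rw [e1]
    rw [map_sum]
    simp only [map_smul]
    rfl
  have h3 : ∀ j, ∑ i, metricCoord h x (chart x x) i j * (invCoord h x (chart x x) *ᵥ d) i = d j :=
    fun j => by
      have := congrFun (Matrix.mulVec_mulVec d (metricCoord h x (chart x x))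
        (invCoord h x (chart x x))) j
      rw [metricCoord_mul_inv h hy, Matrix.one_mulVec, ← metricCoord_transpose] at this
      exact this
  rw [h2, inner_self_eq, h1, metricForm_eq_sum, Finset.sum_comm]
  simp_rw [← Finset.sum_mul, h3, mul_comm]

lemma smoothAlong_comp_symm (hα : ContMDiff (𝓡∂ (n + 1)) 𝓘(ℝ, ℝ) ∞ α) (c : M) :
    SmoothAlong (chart (n := n) c).target (α ∘ (chart c).symm) := by
  refine ContDiffOn.smoothAlong (isRelOpen_target c) ?_
  rw [← contMDiffOn_iff_contDiffOn]
  exact hα.comp_contMDiffOn (contMDiffOn_extChartAt_symm c)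

lemma mfderiv_dSymm (hα : ContMDiff (𝓡∂ (n + 1)) 𝓘(ℝ, ℝ) ∞ α) {y : Model n}
    (hy : y ∈ (chart c).target) (v : Model n) :
    realVec (mfderiv (𝓡∂ (n + 1)) 𝓘(ℝ, ℝ) α ((chart c).symm y) (dSymm c y v)) =
      fderivWithin ℝ (α ∘ (chart c).symm) (halfSpace n) y v := by
  have hu : UniqueMDiffWithinAt 𝓘(ℝ, Model n) (halfSpace n) y :=
    (uniqueDiffOn_halfSpace y ((isRelOpen_target c).subset hy)).uniqueMDiffWithinAt
  have h1 : MDifferentiableWithinAt 𝓘(ℝ, Model n) (𝓡∂ (n + 1)) (chart (n := n) c).symm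
    (halfSpace n) y := mdifferentiableWithinAt_extChartAt_symm hy
  have h2 : MDifferentiableAt (𝓡∂ (n + 1)) 𝓘(ℝ, ℝ) α ((chart (n := n) c).symm y) :=
    hα.mdifferentiableAt (by simp)
  rw [← mfderivWithin_eq_fderivWithin]
  exact (DFunLike.congr_fun (mfderiv_comp_mfderivWithin y h2 h1 hu) v).symm

lemma vecCoord_grad (hα : ContMDiff (𝓡∂ (n + 1)) 𝓘(ℝ, ℝ) ∞ α) {y : Model n}
    (hy : y ∈ (chart c).target) (k : Fin (n + 1)) :
    vecCoord (grad h α) c y k =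
      ∑ j, invCoord h c y k j * pd j (α ∘ (chart c).symm) y := by
  have h1 : ∀ j, (metricCoord h c y *ᵥ vecCoord (grad h α) c y) j =
      pd j (α ∘ (chart c).symm) y := fun j => by
    have e1 := metricForm_stdVec_left h c y (vecChart (grad h α) c y) j
    have e2 := metricForm_symm (h := h) c y (stdVec j) (vecChart (grad h α) c y)
    conv_rhs at e2 => rw [metricForm_apply, dSymm_vecChart _ hy, inner_grad, mfderiv_dSymm hα hy]
    exact e1.symm.trans e2
  have h2 := congrFun (Matrix.mulVec_mulVec (vecCoord (grad h α) c y) (invCoord h c y)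
    (metricCoord h c y)) k
  rw [mul_eq_one_comm.mp (metricCoord_mul_inv h hy), Matrix.one_mulVec] at h2
  rw [← h2, funext h1]
  rfl

/-- A function over the ring of smooth functions. -/
def funR (hα : ContMDiff (𝓡∂ (n + 1)) 𝓘(ℝ, ℝ) ∞ α) (c : M) : ChartRing (n := n) c :=
  ofSmooth _ _ (smoothAlong_comp_symm hα c)

lemma rep_fun (hα : ContMDiff (𝓡∂ (n + 1)) 𝓘(ℝ, ℝ) ∞ α) (c : M) :
    Rep (α ∘ (chart (n := n) c).symm) (funR hα c) := rep_ofSmooth (smoothAlong_comp_symm hα c)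

lemma rep_grad (hα : ContMDiff (𝓡∂ (n + 1)) 𝓘(ℝ, ℝ) ∞ α) (c : M) (k : Fin (n + 1)) :
    Rep (fun y => vecCoord (grad h α) c y k)
      ((invR h c *ᵥ fun j => chartDer c j (funR hα c)) k) :=
  (Rep.sum (s := Finset.univ) fun j => (rep_inv h c k j).mul ((rep_fun hα c).pd j)).congr
    fun _ hy => vecCoord_grad hα hy k

lemma isSmooth_grad (hα : ContMDiff (𝓡∂ (n + 1)) 𝓘(ℝ, ℝ) ∞ α) : IsSmooth (grad h α) :=
  IsSmooth.of_vecChart fun c => by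
    have h1 : vecChart (grad h α) c =
        fun y => ∑ k, vecCoord (grad h α) c y k • (stdVec k : Model n) := by
      ext1 y; exact eq_sum_stdVec _
    rw [h1]
    exact SmoothAlong.sum fun k _ => fun y hy =>
      ((rep_grad hα c k).smoothAlong y hy).smul contDiffWithinAt_const

lemma hessR_grad_transpose (hα : ContMDiff (𝓡∂ (n + 1)) 𝓘(ℝ, ℝ) ∞ α) (c : M)
    (hs : IsSmooth (grad h α)) : (hessR h hs c)ᵀ = hessR h hs c := by
  have h1 : vecR hs c = invR h c *ᵥ fun j => chartDer c j (funR hα c) :=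
    funext fun k => (rep_vec hs c k).unique (rep_grad hα c k)
  rw [hessR, h1]
  exact transpose_mul_nablaV_grad pdDer_comm (metricR_transpose h c) (metricR_mul_invR h c) _

/-- The normal derivative of a boundary preserving gradient. -/
lemma inner_normalDeriv_grad (hα : ContMDiff (𝓡∂ (n + 1)) 𝓘(ℝ, ℝ) ∞ α)
    (hbp : BoundaryPreserving h (grad h α)) {x : M} (hb : x ∈ (𝓡∂ (n + 1)).boundary M)
    (v : TangentSpace (𝓡∂ (n + 1)) x) (hv : h.inner x (outwardNormal h x) v = 0) :
    h.inner x (normalDeriv h (grad h α) x) v =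
      - extrinsicCurvature h x v (tangentialPart h (grad h α) x) := by
  have hs := isSmooth_grad (h := h) hα
  rw [tangentialPart_eq hbp hb, inner_normalDeriv hs hbp hb v hv,
    extrinsicCurvature_eq hs hbp hb v hv, neg_neg]
  -- Both sides are the Hessian evaluated on n and v, in opposite orders.
  conv_rhs => rw [← hessR_grad_transpose hα x hs, Matrix.mulVec_transpose, dotProduct_comm,
    ← Matrix.dotProduct_mulVec]

lemma vecCoord_add (V W : VField n M) (c : M) (y : Model n) (k : Fin (n + 1)) :
    vecCoord (fun x => V x + W x) c y k = vecCoord V c y k + vecCoord W c y k := by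
  simp only [vecCoord_eq, vecChart, map_add, PiLp.add_apply]

lemma IsSmooth.add {W : VField n M} (hV : IsSmooth V) (hW : IsSmooth W) :
    IsSmooth (fun x => V x + W x) := IsSmooth.of_vecChart fun c => by
  have h1 : VacuaMetric.vecChart (fun x => V x + W x) c =
      fun y => VacuaMetric.vecChart V c y + VacuaMetric.vecChart W c y := by
    ext1 y; exact map_add _ _ _
  rw [h1]
  exact (hV.vecChart c).add (hW.vecChart c)

lemma BoundaryPreserving.add {W : VField n M} (hV : BoundaryPreserving h V)
    (hW : BoundaryPreserving h W) : BoundaryPreserving h (fun x => V x + W x) := fun x hx => by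
  rw [map_add, hV x hx, hW x hx, add_zero]

lemma nablaV_add (v w : Fin (n + 1) → ChartRing (n := n) c) :
    nablaV (chartDer c) (metricR h c) (invR h c) (v + w) =
      nablaV (chartDer c) (metricR h c) (invR h c) v +
      nablaV (chartDer c) (metricR h c) (invR h c) w := by
  ext i j
  simp only [nablaV, covV, Matrix.of_apply, Matrix.add_apply, Matrix.mulVec_add, Pi.add_apply,
    map_add]
  ring

/-- The constraint sees only the antisymmetric part of the lowered derivative, to which a symmetric
Hessian contributes nothing. -/
lemma IsAdmissible.add_grad {σ : VField n M} (hσ : IsAdmissible h σ)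
    (hα : ContMDiff (𝓡∂ (n + 1)) 𝓘(ℝ, ℝ) ∞ α) (hbp : BoundaryPreserving h (grad h α)) :
    IsAdmissible h (fun x => σ x + grad h α x) := by
  have hs : IsSmooth σ := hσ.smooth
  have hg := isSmooth_grad (h := h) hα
  refine ⟨hs.add hg, fun c y hy j => ?_, hσ.boundaryPreserving.add hbp⟩
  have h1 : vecR (hs.add hg) c = vecR hs c + vecR hg c := funext fun k =>
    (rep_vec (hs.add hg) c k).unique (((rep_vec hs c k).add (rep_vec hg c k)).congr fun y _ =>
      vecCoord_add σ (grad h α) c y k)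
  have h2 := hessR_grad_transpose hα c hg
  rw [hessR] at h2
  have h3 := rep_momentum (hs.add hg) h c j y hy
  rw [h1, nablaV_add, mul_add, Matrix.transpose_add, h2, add_sub_add_right_eq_sub] at h3
  rw [h3, ← rep_momentum hs h c j y hy]
  exact hσ.momentum c y hy j

end Boundary
end VacuaMetric
end

noncomputable section

namespace VacuaMetric

/-! ### Measures given by parametrizations -/

section Param

variable {E X : Type*} [NormedAddCommGroup E] [InnerProductSpace ℝ E] [FiniteDimensional ℝ E]
  [MeasurableSpace E] [BorelSpace E] [MeasurableSpace X]

/-- The image under `p` of the measure with density `w` on `S`. -/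
def paramMeasure (S : Set E) (w : E → ℝ) (p : E → X) : Measure X :=
  (((volume : Measure E).restrict S).withDensity fun y => ENNReal.ofReal (w y)).map p

variable [TopologicalSpace X] [BorelSpace X] {S : Set E} {w : E → ℝ} {p : E → X}

lemma measurableSet_inter_preimage (hS : MeasurableSet S) (hp : ContinuousOn p S) {A : Set X}
    (hA : MeasurableSet A) : MeasurableSet (S ∩ p ⁻¹' A) := by
  have h1 := MeasurableSet.subtype_image hS
    ((continuousOn_iff_continuous_domRestrict.1 hp).measurable hA)
  rwa [Set.domRestrict_eq, Set.preimage_comp, Subtype.image_preimage_coe] at h1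

lemma aemeasurable_param (hS : MeasurableSet S) (hp : ContinuousOn p S) :
    AEMeasurable p (((volume : Measure E).restrict S).withDensity fun y => ENNReal.ofReal (w y)) :=
  (hp.aemeasurable hS).mono_ac (withDensity_absolutelyContinuous _ _)

lemma paramMeasure_apply (hS : MeasurableSet S) (hp : ContinuousOn p S) {A : Set X}
    (hA : MeasurableSet A) :
    paramMeasure S w p A = ∫⁻ y in S ∩ p ⁻¹' A, ENNReal.ofReal (w y) := by
  rw [paramMeasure, Measure.map_apply_of_aemeasurable (aemeasurable_param hS hp) hA,
    withDensity_apply', Measure.restrict_restrict' hS, inter_comm]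

/-- Change of variables by G, with densities related by |det G'|. It serves for chart changes in the
interior and on the boundary, and for diffeomorphisms. -/
lemma paramMeasure_congr {X' : Type*} [MeasurableSpace X'] [TopologicalSpace X'] [BorelSpace X']
    {S' : Set E} {w' : E → ℝ} {p' : E → X'} (hS : MeasurableSet S) (hp : ContinuousOn p S)
    (hS' : MeasurableSet S') (hp' : ContinuousOn p' S') {B : Set X} {A : Set X'}
    (hB : MeasurableSet B) (hA : MeasurableSet A) {G : E → E} {G' : E → E →L[ℝ] E}
    (himage : G '' (S ∩ p ⁻¹' B) = S' ∩ p' ⁻¹' A) (hinj : InjOn G (S ∩ p ⁻¹' B))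
    (hG : ∀ y ∈ S ∩ p ⁻¹' B, HasFDerivWithinAt G (G' y) (S ∩ p ⁻¹' B) y)
    (hw : ∀ y ∈ S ∩ p ⁻¹' B, w y = |(G' y).det| * w' (G y)) :
    paramMeasure S w p B = paramMeasure S' w' p' A := by
  have hm := measurableSet_inter_preimage hS hp hB
  rw [paramMeasure_apply hS hp hB, paramMeasure_apply hS' hp' hA, ← himage,
    lintegral_image_eq_lintegral_abs_det_fderiv_mul volume hm hG hinj]
  refine setLIntegral_congr_fun hm fun y hy => ?_
  rw [hw y hy, ENNReal.ofReal_mul (abs_nonneg _)]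

lemma integral_paramMeasure (hS : MeasurableSet S) (hp : ContinuousOn p S)
    (hw : ContinuousOn w S) (hw0 : ∀ y ∈ S, 0 ≤ w y) {f : X → ℝ}
    (hf : AEStronglyMeasurable f (paramMeasure S w p)) :
    ∫ x, f x ∂(paramMeasure S w p) = ∫ y in S, w y * f (p y) := by
  rw [paramMeasure, integral_map (aemeasurable_param hS hp) hf,
    integral_withDensity_eq_integral_toReal_smul₀ (hw.aemeasurable hS).ennreal_ofReal
      (Filter.Eventually.of_forall fun _ => ENNReal.ofReal_lt_top)]
  refine setIntegral_congr_fun hS fun y hy => ?_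
  rw [ENNReal.toReal_ofReal (hw0 y hy), smul_eq_mul]

lemma paramMeasure_lt_top (hS : MeasurableSet S) (hp : ContinuousOn p S)
    (hw : ContinuousOn w S) {A : Set X} (hA : MeasurableSet A) {K : Set E} (hK : IsCompact K)
    (hKS : K ⊆ S) (hAK : S ∩ p ⁻¹' A ⊆ K) : paramMeasure S w p A < ⊤ := by
  rw [paramMeasure_apply hS hp hA]
  refine (lintegral_mono_set hAK).trans_lt ?_
  exact ((hw.mono hKS).integrableOn_compact hK).lintegral_lt_top

end Param

/-! ### Gluing local measures -/

section Sup

variable {X ι : Type*} [MeasurableSpace X]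

/-- The supremum of a consistent family of local measures restricts to its members. -/
lemma iSup_restrict_eq (μ : ι → Measure X) (U : ι → Set X) (hU : ∀ i, MeasurableSet (U i))
    (hμ : ∀ i, (μ i).restrict (U i) = μ i)
    (hcons : ∀ i j, ∀ A ⊆ U i ∩ U j, MeasurableSet A → μ i A = μ j A)
    (hcover : ∃ s : ℕ → ι, ⋃ k, U (s k) = univ) (c : ι) :
    (⨆ i, μ i).restrict (U c) = μ c := by
  obtain ⟨s, hs⟩ := hcover
  set D : ℕ → Set X := disjointed fun k => U (s k) with hD
  have hDm : ∀ k, MeasurableSet (D k) := fun k => MeasurableSet.disjointed (fun k => hU (s k)) k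
  have hDU : ∀ k, D k ⊆ U (s k) := fun k => disjointed_subset _ k
  have hDuniv : ⋃ k, D k = univ := by rw [hD, iUnion_disjointed, hs]
  have hDdisj : Pairwise (Function.onFun Disjoint D) := disjoint_disjointed _
  -- A countable subcover is made disjoint and one local measure is used on each piece. Consistency
  -- shows that the resulting measure restricts to every member of the family.
  set ν : Measure X := Measure.sum fun k => (μ (s k)).restrict (D k) with hν
  have key : ∀ c, ν.restrict (U c) = μ c := fun c => by
    refine Measure.ext fun A hA => ?_
    rw [Measure.restrict_apply hA, hν, Measure.sum_apply _ (hA.inter (hU c))]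
    have h1 : ∀ k, (μ (s k)).restrict (D k) (A ∩ U c) = μ c (A ∩ U c ∩ D k) := fun k => by
      rw [Measure.restrict_apply (hA.inter (hU c))]
      exact hcons _ _ _ (fun x hx => ⟨hDU k hx.2, hx.1.2⟩) ((hA.inter (hU c)).inter (hDm k))
    simp_rw [h1]
    rw [← measure_iUnion (fun i j hij => (hDdisj hij).mono inter_subset_right inter_subset_right)
      fun k => (hA.inter (hU c)).inter (hDm k), ← inter_iUnion, hDuniv, inter_univ,
      ← Measure.restrict_apply hA, hμ]
  -- Every local measure is a restriction of ν, so ν bounds the supremum from above. The bound from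
  -- below on each set is the definition of a supremum.
  have hle : (⨆ i, μ i) ≤ ν := iSup_le fun i => by
    rw [← key i]; exact Measure.restrict_le_self
  refine le_antisymm ((Measure.restrict_mono subset_rfl hle).trans (key c).le) ?_
  calc μ c = (μ c).restrict (U c) := (hμ c).symm
    _ ≤ _ := Measure.restrict_mono subset_rfl (le_iSup μ c)

end Sup

/-! ### Measures from compatible parametrizations -/

section Family

/-- A consistent family of measures given by parametrizations of the members of an open cover. -/
structure ParamFamily (E X ι : Type*) [NormedAddCommGroup E] [InnerProductSpace ℝ E]
    [FiniteDimensional ℝ E] [MeasurableSpace E] [BorelSpace E] [MeasurableSpace X]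
    [TopologicalSpace X] [BorelSpace X] where
  /-- The open cover. -/
  U : ι → Set X
  /-- The domains of the parametrizations. -/
  S : ι → Set E
  /-- The densities. -/
  w : ι → E → ℝ
  /-- The parametrizations. -/
  p : ι → E → X
  isOpen_U : ∀ i, IsOpen (U i)
  cover : ∃ s : ℕ → ι, ⋃ k, U (s k) = univ
  measurableSet_S : ∀ i, MeasurableSet (S i)
  continuousOn_p : ∀ i, ContinuousOn (p i) (S i)
  continuousOn_w : ∀ i, ContinuousOn (w i) (S i)
  nonneg_w : ∀ i, ∀ y ∈ S i, 0 ≤ w i y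
  mapsTo_p : ∀ i, MapsTo (p i) (S i) (U i)
  consistent : ∀ i j, ∀ A ⊆ U i ∩ U j, MeasurableSet A →
    paramMeasure (S i) (w i) (p i) A = paramMeasure (S j) (w j) (p j) A
  compact : ∀ i, ∀ K ⊆ U i, IsCompact K → ∃ L ⊆ S i, IsCompact L ∧ S i ∩ p i ⁻¹' K ⊆ L

variable {E X ι : Type*} [NormedAddCommGroup E] [InnerProductSpace ℝ E]
    [FiniteDimensional ℝ E] [MeasurableSpace E] [BorelSpace E] [MeasurableSpace X]
    [TopologicalSpace X] [BorelSpace X] (F : ParamFamily E X ι)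

namespace ParamFamily

/-- The measure defined by one parametrization. -/
def localMeasure (i : ι) : Measure X := paramMeasure (F.S i) (F.w i) (F.p i)

/-- The measure defined by a family of parametrizations. -/
def measure : Measure X := ⨆ i, F.localMeasure i

lemma restrict_localMeasure (i : ι) : (F.localMeasure i).restrict (F.U i) = F.localMeasure i := by
  refine Measure.ext fun A hA => ?_
  have hU := (F.isOpen_U i).measurableSet
  rw [Measure.restrict_apply hA, localMeasure,
    paramMeasure_apply (F.measurableSet_S i) (F.continuousOn_p i) (hA.inter hU),
    paramMeasure_apply (F.measurableSet_S i) (F.continuousOn_p i) hA]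
  congr 2
  ext y
  exact ⟨fun h => ⟨h.1, h.2.1⟩, fun h => ⟨h.1, h.2, F.mapsTo_p i h.1⟩⟩

lemma restrict_measure (i : ι) : F.measure.restrict (F.U i) = F.localMeasure i :=
  iSup_restrict_eq _ _ (fun i => (F.isOpen_U i).measurableSet) F.restrict_localMeasure
    F.consistent F.cover i

lemma measure_apply (i : ι) {A : Set X} (hA : A ⊆ F.U i) :
    F.measure A = F.localMeasure i A := by
  rw [← F.restrict_measure i, Measure.restrict_eq_self _ hA]

/-- Applied to the boundary parametrizations, this shows that the boundary volume is carried by the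
boundary. -/
lemma ae_of_forall {P : X → Prop} (hP : MeasurableSet {x | P x})
    (h : ∀ i, ∀ y ∈ F.S i, P (F.p i y)) : ∀ᵐ x ∂F.measure, P x := by
  obtain ⟨s, hs⟩ := F.cover
  have h1 : {x | P x}ᶜ = ⋃ k, ({x | P x}ᶜ ∩ F.U (s k)) := by rw [← inter_iUnion, hs, inter_univ]
  rw [ae_iff]
  change F.measure {x | P x}ᶜ = 0
  rw [h1]
  refine measure_iUnion_null fun k => ?_
  rw [F.measure_apply (s k) inter_subset_right, localMeasure,
    paramMeasure_apply (F.measurableSet_S _) (F.continuousOn_p _)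
      (hP.compl.inter (F.isOpen_U _).measurableSet)]
  have h2 : F.S (s k) ∩ F.p (s k) ⁻¹' ({x | P x}ᶜ ∩ F.U (s k)) = ∅ :=
    eq_empty_of_forall_notMem fun y hy => hy.2.1 (h _ y hy.1)
  rw [h2, Measure.restrict_empty, lintegral_zero_measure]

lemma measure_lt_top {i : ι} {K : Set X} (hKU : K ⊆ F.U i) (hK : IsCompact K)
    (hKm : MeasurableSet K) : F.measure K < ⊤ := by
  obtain ⟨L, hL, hLc, hKL⟩ := F.compact i K hKU hK
  rw [F.measure_apply i hKU]
  exact paramMeasure_lt_top (F.measurableSet_S i) (F.continuousOn_p i) (F.continuousOn_w i) hKm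
    hLc hL hKL

lemma isLocallyFiniteMeasure [T2Space X] [LocallyCompactSpace X] :
    IsLocallyFiniteMeasure F.measure where
  finiteAtNhds x := by
    obtain ⟨s, hs⟩ := F.cover
    obtain ⟨k, hk⟩ := mem_iUnion.1 (hs.symm ▸ mem_univ x : x ∈ ⋃ k, F.U (s k))
    obtain ⟨K, hK, hxK, hKU⟩ := exists_compact_subset (F.isOpen_U (s k)) hk
    exact ⟨K, mem_interior_iff_mem_nhds.1 hxK, F.measure_lt_top hKU hK hK.measurableSet⟩

lemma integral_eq {i : ι} {f : X → ℝ} (hf : Continuous f) (h0 : ∀ x ∉ F.U i, f x = 0) :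
    ∫ x, f x ∂F.measure = ∫ y in F.S i, F.w i y * f (F.p i y) := by
  rw [← setIntegral_eq_integral_of_forall_compl_eq_zero h0, F.restrict_measure i, localMeasure,
    integral_paramMeasure (F.measurableSet_S i) (F.continuousOn_p i) (F.continuousOn_w i)
      (F.nonneg_w i) hf.aestronglyMeasurable]

end ParamFamily

end Family

/-! ### The Riemannian volume and its naturality -/

section Volume

variable {n : ℕ} {M : Type*} [TopologicalSpace M] [ChartedSpace (EuclideanHalfSpace (n + 1)) M]
  [IsManifold (𝓡∂ (n + 1)) ∞ M]

lemma IsRelOpen.measurableSet {U : Set (Model n)} (hU : IsRelOpen U) : MeasurableSet U := by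
  have h1 : ∀ y ∈ U, ∃ O, IsOpen O ∧ y ∈ O ∧ O ∩ halfSpace n ⊆ U := fun y hy =>
    _root_.mem_nhdsWithin.1 (hU.mem_nhdsWithin y hy)
  choose! O hO hyO hOU using h1
  have h2 : U = (⋃ y ∈ U, O y) ∩ halfSpace n := by
    refine Subset.antisymm (fun y hy => ⟨mem_biUnion hy (hyO y hy), hU.subset hy⟩) ?_
    rintro z ⟨hz, hz'⟩
    obtain ⟨y, hy, hzy⟩ := mem_iUnion₂.1 hz
    exact hOU y hy ⟨hzy, hz'⟩
  rw [h2]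
  exact (isOpen_biUnion hO).measurableSet.inter
    ((𝓡∂ (n + 1)).isClosed_range).measurableSet

lemma measurableSet_target (c : M) : MeasurableSet (chart (n := n) c).target :=
  (isRelOpen_target c).measurableSet

lemma continuousOn_symm (c : M) : ContinuousOn (chart (n := n) c).symm (chart (n := n) c).target :=
  continuousOn_extChartAt_symm c

lemma continuousOn_sqrt_det (h : Metric n M) (c : M) :
    ContinuousOn (fun y => √(metricCoord h c y).det) (chart c).target :=
  ((SmoothAlong.det (smoothAlong_metricCoord h c)).continuousOn (isRelOpen_target c)).sqrt

variable [MeasurableSpace M]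

lemma chartVolume_eq (h : Metric n M) (c : M) : chartVolume h c =
    paramMeasure (chart c).target (fun y => √(metricCoord h c y).det) (chart c).symm := rfl

variable [BorelSpace M]

lemma readDomain_bij (φ ψ : M → M) (hψφ : ∀ x, ψ (φ x) = x) (hφψ : ∀ x, φ (ψ x) = x) {c c' : M}
    {A : Set M} (hA : A ⊆ (chart (n := n) c').source) (hA' : φ ⁻¹' A ⊆ (chart (n := n) c).source) :
    (chart (n := n) c).target ∩ (chart c).symm ⁻¹' (φ ⁻¹' A) ⊆ readDomain φ c c' ∧
    readIn φ c c' '' ((chart (n := n) c).target ∩ (chart c).symm ⁻¹' (φ ⁻¹' A)) =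
      (chart (n := n) c').target ∩ (chart c').symm ⁻¹' A ∧
    InjOn (readIn φ c c') ((chart (n := n) c).target ∩ (chart c).symm ⁻¹' (φ ⁻¹' A)) := by
  have hsub : (chart (n := n) c).target ∩ (chart c).symm ⁻¹' (φ ⁻¹' A) ⊆ readDomain φ c c' :=
    fun y hy => ⟨hy.1, hA hy.2⟩
  have hinv : ∀ y ∈ (chart (n := n) c).target ∩ (chart c).symm ⁻¹' (φ ⁻¹' A),
      chart c (ψ ((chart c').symm (readIn φ c c' y))) = y := fun y hy => by
    rw [symm_readIn (hsub hy), hψφ, (chart c).right_inv hy.1]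
  refine ⟨hsub, ?_, fun y hy z hz hyz => by rw [← hinv y hy, hyz, hinv z hz]⟩
  refine Subset.antisymm ?_ fun z hz => ?_
  · rintro _ ⟨y, hy, rfl⟩
    refine ⟨readIn_mem_target (hsub hy), ?_⟩
    rw [mem_preimage, symm_readIn (hsub hy)]
    exact hy.2
  · have hz2 : φ (ψ ((chart c').symm z)) ∈ A := by rw [hφψ]; exact hz.2
    have hx : ψ ((chart c').symm z) ∈ (chart (n := n) c).source := hA' hz2
    refine ⟨chart c (ψ ((chart c').symm z)), ⟨(chart c).map_source hx, ?_⟩, ?_⟩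
    · rw [mem_preimage, (chart c).left_inv hx]
      exact hz2
    · rw [readIn_chart hx, hφψ, (chart c').right_inv hz.1]

/-- The factor |det J| of the change of variables is the one relating the roots of the metric
determinants. For φ = id this is the consistency of the chart volumes. -/
lemma chartVolume_preimage {φ ψ : M → M} (hφ : ContMDiff (𝓡∂ (n + 1)) (𝓡∂ (n + 1)) ∞ φ)
    (hψφ : ∀ x, ψ (φ x) = x) (hφψ : ∀ x, φ (ψ x) = x) {h h' : Metric n M}
    (hp : IsPullback φ h' h) {c c' : M} {A : Set M} (hAm : MeasurableSet A)
    (hA : A ⊆ (chart (n := n) c').source) (hA' : φ ⁻¹' A ⊆ (chart (n := n) c).source) :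
    chartVolume h c (φ ⁻¹' A) = chartVolume h' c' A := by
  obtain ⟨hsub, himage, hinj⟩ := readDomain_bij φ ψ hψφ hφψ hA hA'
  rw [chartVolume_eq, chartVolume_eq]
  refine paramMeasure_congr (G' := fun y => fderivWithin ℝ (readIn φ c c') (halfSpace n) y)
    (measurableSet_target c) (continuousOn_symm c) (measurableSet_target c')
    (continuousOn_symm c') (hφ.continuous.measurable hAm) hAm himage hinj
    (fun y hy => ?_) fun y hy => ?_
  · exact ((smoothAlong_readIn hφ).differentiableWithinAt (hsub hy)).hasFDerivWithinAt.mono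
      fun z hz => (isRelOpen_target c).subset hz.1
  · rw [det_metricCoord_readIn hφ hp (hsub hy), Real.sqrt_mul (sq_nonneg _), Real.sqrt_sq_eq_abs,
      det_fderivWithin]

lemma measurableSet_source (c : M) : MeasurableSet (chart (n := n) c).source :=
  (isOpen_extChartAt_source c).measurableSet

lemma exists_finset_cover [CompactSpace M] :
    ∃ t : Finset M, ⋃ c ∈ t, (chart (n := n) c).source = univ := by
  obtain ⟨t, _, ht⟩ := isCompact_univ.elim_nhds_subcover (fun x : M => (chart (n := n) x).source)
    fun x _ => (isOpen_extChartAt_source (I := 𝓡∂ (n + 1)) x).mem_nhds (mem_extChartAt_source x)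
  exact ⟨t, univ_subset_iff.1 ht⟩

lemma exists_cover [CompactSpace M] [Nonempty M] :
    ∃ s : ℕ → M, ⋃ k, (chart (n := n) (s k)).source = univ := by
  obtain ⟨t, htc⟩ := exists_finset_cover (n := n) (M := M)
  have hne : (t : Set M).Nonempty := by
    obtain ⟨x⟩ := ‹Nonempty M›
    obtain ⟨y, hy, _⟩ := mem_iUnion₂.1 (htc.symm ▸ mem_univ x : x ∈ ⋃ y ∈ t, _)
    exact ⟨y, hy⟩
  obtain ⟨s, hs⟩ := t.countable_toSet.exists_eq_range hne
  refine ⟨s, ?_⟩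
  rw [← htc, ← biUnion_range (g := fun c => (chart (n := n) c).source), ← hs]
  rfl

/-- The family of Riemannian volumes of chart domains. -/
def volumeFamily [CompactSpace M] [Nonempty M] (h : Metric n M) : ParamFamily (Model n) M M where
  U c := (chart (n := n) c).source
  S c := (chart c).target
  w c y := √(metricCoord h c y).det
  p c := (chart c).symm
  isOpen_U c := isOpen_extChartAt_source c
  cover := exists_cover
  measurableSet_S := measurableSet_target
  continuousOn_p := continuousOn_symm
  continuousOn_w := continuousOn_sqrt_det h
  nonneg_w _ _ _ := Real.sqrt_nonneg _
  mapsTo_p c := (chart c).mapsTo_symm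
  consistent _ _ _ hA hAm :=
    chartVolume_preimage (φ := id) (ψ := id) contMDiff_id (fun _ => rfl) (fun _ => rfl)
      (isPullback_id h) hAm (fun _ hx => (hA hx).2) fun _ hx => (hA hx).1
  compact c K hK hKc := ⟨chart c '' K, fun _ ⟨_, hx, hy⟩ => hy ▸ (chart c).map_source (hK hx),
    hKc.image_of_continuousOn ((continuousOn_extChartAt c).mono hK),
    fun _ hy => ⟨_, hy.2, (chart c).right_inv hy.1⟩⟩

lemma riemVolume_eq [CompactSpace M] [Nonempty M] (h : Metric n M) :
    riemVolume h = (volumeFamily h).measure := rfl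

/-- The Riemannian volume is natural. -/
lemma map_riemVolume [CompactSpace M] {φ ψ : M → M}
    (hφ : ContMDiff (𝓡∂ (n + 1)) (𝓡∂ (n + 1)) ∞ φ) (hψ : Continuous ψ)
    (hψφ : ∀ x, ψ (φ x) = x) (hφψ : ∀ x, φ (ψ x) = x) {h h' : Metric n M}
    (hp : IsPullback φ h' h) : (riemVolume h).map φ = riemVolume h' := by
  rcases isEmpty_or_nonempty M with hM | hM
  · exact Measure.ext fun A _ => by rw [eq_empty_of_isEmpty A, measure_empty, measure_empty]
  obtain ⟨s, hs⟩ := exists_cover (n := n) (M := M)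
  have hm := hφ.continuous.measurable
  -- Countably many pieces, each inside one chart domain and with its preimage under φ inside
  -- another, reduce the comparison to `chartVolume_preimage`.
  have hU : ⋃ k : ℕ × ℕ, ((chart (n := n) (s k.1)).source ∩
      ψ ⁻¹' (chart (n := n) (s k.2)).source) = univ := by
    refine eq_univ_of_forall fun x => ?_
    obtain ⟨k, hk⟩ := mem_iUnion.1 (hs.symm ▸ mem_univ x : x ∈ ⋃ k, _)
    obtain ⟨l, hl⟩ := mem_iUnion.1 (hs.symm ▸ mem_univ (ψ x) : ψ x ∈ ⋃ k, _)
    exact mem_iUnion.2 ⟨(k, l), hk, hl⟩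
  refine (Measure.ext_iff_of_iUnion_eq_univ hU).2 fun k => Measure.ext fun A hA => ?_
  have hB : MeasurableSet (A ∩ ((chart (n := n) (s k.1)).source ∩
      ψ ⁻¹' (chart (n := n) (s k.2)).source)) := hA.inter
    ((measurableSet_source _).inter (hψ.measurable (measurableSet_source _)))
  have hA1 : A ∩ ((chart (n := n) (s k.1)).source ∩ ψ ⁻¹' (chart (n := n) (s k.2)).source) ⊆
      (chart (n := n) (s k.1)).source := fun x hx => hx.2.1
  have hA2 : φ ⁻¹' (A ∩ ((chart (n := n) (s k.1)).source ∩
      ψ ⁻¹' (chart (n := n) (s k.2)).source)) ⊆ (chart (n := n) (s k.2)).source := fun x hx => by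
    have := hx.2.2
    rwa [mem_preimage, hψφ] at this
  rw [Measure.restrict_apply hA, Measure.restrict_apply hA, Measure.map_apply hm hB,
    riemVolume_eq, riemVolume_eq, (volumeFamily h).measure_apply (s k.2) hA2,
    (volumeFamily h').measure_apply (s k.1) hA1]
  exact chartVolume_preimage hφ hψφ hφψ hp hB hA1 hA2

end Volume

end VacuaMetric
end

noncomputable section

namespace VacuaMetric

/-! ### The boundary measure -/

section BoundaryVolume

variable {n : ℕ} {M : Type*} [TopologicalSpace M] [ChartedSpace (EuclideanHalfSpace (n + 1)) M]
  [IsManifold (𝓡∂ (n + 1)) ∞ M]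

open Matrix

/-- The inclusion of the boundary of the half space, as a linear map. -/
def bdryL (n : ℕ) : EuclideanSpace ℝ (Fin n) →L[ℝ] Model n :=
  LinearMap.toContinuousLinearMap
    { toFun := bdryIncl
      map_add' := fun x y => by
        ext i; refine Fin.cases ?_ (fun i => ?_) i <;> simp [bdryIncl]
      map_smul' := fun r x => by
        ext i; refine Fin.cases ?_ (fun i => ?_) i <;> simp [bdryIncl] }

/-- Forgetting the boundary defining coordinate. -/
def tailL (n : ℕ) : Model n →L[ℝ] EuclideanSpace ℝ (Fin n) :=
  LinearMap.toContinuousLinearMap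
    { toFun := fun y => WithLp.toLp 2 fun i => y i.succ
      map_add' := fun _ _ => rfl
      map_smul' := fun _ _ => rfl }

lemma bdryL_apply (z : EuclideanSpace ℝ (Fin n)) : bdryL n z = bdryIncl z := rfl

lemma tailL_apply (y : Model n) (i : Fin n) : tailL n y i = y i.succ := rfl

lemma bdryIncl_zero (z : EuclideanSpace ℝ (Fin n)) : bdryIncl z 0 = 0 := rfl

lemma bdryIncl_succ (z : EuclideanSpace ℝ (Fin n)) (i : Fin n) : bdryIncl z i.succ = z i := rfl

lemma tailL_bdryIncl (z : EuclideanSpace ℝ (Fin n)) : tailL n (bdryIncl z) = z := rfl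

lemma bdryIncl_tailL {y : Model n} (hy : y 0 = 0) : bdryIncl (tailL n y) = y := by
  ext i
  refine Fin.cases hy.symm (fun i => rfl) i

lemma bdryIncl_mem_halfSpace (z : EuclideanSpace ℝ (Fin n)) : bdryIncl z ∈ halfSpace n := by
  rw [halfSpace_eq]; exact (bdryIncl_zero z).ge

lemma continuous_bdryIncl : Continuous (bdryIncl (n := n)) := (bdryL n).continuous

/-- The chart change restricted to the boundary has as Jacobian the block of the full Jacobian with
first row and column deleted. -/
lemma det_tail_comp (L : Model n →L[ℝ] Model n) :
    (tailL n ∘L L ∘L bdryL n).det =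
      ((Matrix.of fun a i => L (stdVec i) a : Matrix (Fin (n + 1)) (Fin (n + 1)) ℝ).submatrix
        Fin.succ Fin.succ).det := by
  rw [ContinuousLinearMap.det, ← LinearMap.det_toMatrix (EuclideanSpace.basisFun _ ℝ).toBasis]
  congr 1
  ext a i
  have h1 : bdryIncl (EuclideanSpace.single i (1 : ℝ)) = stdVec i.succ := by
    ext k
    refine Fin.cases ?_ (fun k => ?_) k
    · simp [bdryIncl_zero]
    · simp [bdryIncl_succ]
  simp [LinearMap.toMatrix_apply, tailL_apply, bdryL_apply, h1]

/-- The matrix of the induced metric. -/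
def bdryCoord (h : Metric n M) (c : M) (z : EuclideanSpace ℝ (Fin n)) :
    Matrix (Fin n) (Fin n) ℝ := (metricCoord h c (bdryIncl z)).submatrix Fin.succ Fin.succ

/-- The part of the boundary of the half space in the target of a chart. -/
def bdryTarget (n : ℕ) {M : Type*} [TopologicalSpace M]
    [ChartedSpace (EuclideanHalfSpace (n + 1)) M] (c : M) : Set (EuclideanSpace ℝ (Fin n)) :=
  bdryIncl ⁻¹' (chart c).target

lemma measurableSet_bdryTarget (c : M) : MeasurableSet (bdryTarget n c) :=
  continuous_bdryIncl.measurable (measurableSet_target c)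

lemma continuousOn_symm_bdryIncl (c : M) :
    ContinuousOn (fun z => (chart (n := n) c).symm (bdryIncl z)) (bdryTarget n c) :=
  (continuousOn_symm c).comp continuous_bdryIncl.continuousOn fun _ hz => hz

lemma continuousOn_sqrt_det_bdryCoord (h : Metric n M) (c : M) :
    ContinuousOn (fun z => √(bdryCoord h c z).det) (bdryTarget n c) := by
  have h1 : ContinuousOn (fun y => ((metricCoord h c y).submatrix Fin.succ Fin.succ).det)
      (chart c).target :=
    SmoothAlong.continuousOn (isRelOpen_target c)
      (SmoothAlong.det (m := fun y => (metricCoord h c y).submatrix Fin.succ Fin.succ)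
        fun i j => smoothAlong_metricCoord h c i.succ j.succ)
  exact (h1.comp continuous_bdryIncl.continuousOn fun _ hz => hz).sqrt

/-- Since the first row of P vanishes off the diagonal, the induced metric transforms by the
tangential block of P alone. -/
lemma submatrix_transpose_mul_mul {m P : Matrix (Fin (n + 1)) (Fin (n + 1)) ℝ}
    (hP : ∀ i ≠ 0, P 0 i = 0) : (Pᵀ * m * P).submatrix Fin.succ Fin.succ =
      (P.submatrix Fin.succ Fin.succ)ᵀ * m.submatrix Fin.succ Fin.succ *
        P.submatrix Fin.succ Fin.succ := by
  ext i j
  have h1 : ∀ i : Fin n, P 0 i.succ = 0 := fun i => hP _ i.succ_ne_zero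
  simp [Matrix.mul_apply, Fin.sum_univ_succ, h1]

lemma det_bdryCoord_readIn {φ : M → M} {c c' : M} {h h' : Metric n M}
    (hφ : ContMDiff (𝓡∂ (n + 1)) (𝓡∂ (n + 1)) ∞ φ)
    (hp : IsPullback φ h' h) {z : EuclideanSpace ℝ (Fin n)} (hz : bdryIncl z ∈ readDomain φ c c')
    (h0 : readIn φ c c' (bdryIncl z) 0 = 0) :
    (bdryCoord h c z).det =
      ((jacobian (readIn φ c c') (bdryIncl z)).submatrix Fin.succ Fin.succ).det ^ 2 *
        (bdryCoord h' c' (tailL n (readIn φ c c' (bdryIncl z)))).det := by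
  rw [bdryCoord, bdryCoord, metricCoord_readIn hφ hp hz,
    submatrix_transpose_mul_mul fun i hi => jacobian_zero_succ hφ hz h0 hi, Matrix.det_mul,
    Matrix.det_mul, Matrix.det_transpose, bdryIncl_tailL h0]
  ring

variable [MeasurableSpace M] [BorelSpace M]

lemma chartBdryVolume_eq (h : Metric n M) (c : M) : chartBdryVolume h c =
    paramMeasure (bdryTarget n c) (fun z => √(bdryCoord h c z).det)
      (fun z => (chart c).symm (bdryIncl z)) := rfl

lemma chartBdryVolume_congr (h : Metric n M) {c c' : M} {A : Set M} (hAm : MeasurableSet A)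
    (hA' : A ⊆ (chart (n := n) c).source) (hA : A ⊆ (chart (n := n) c').source) :
    chartBdryVolume h c A = chartBdryVolume h c' A := by
  obtain ⟨hsub, himage, hinj⟩ := readDomain_bij (n := n) (id : M → M) id (fun _ => rfl)
    (fun _ => rfl) (A := A) hA hA'
  have hid : ContMDiff (𝓡∂ (n + 1)) (𝓡∂ (n + 1)) ∞ (id : M → M) := contMDiff_id
  have hmem : ∀ z ∈ bdryTarget n c ∩ (fun z => (chart (n := n) c).symm (bdryIncl z)) ⁻¹' A,
      bdryIncl z ∈ (chart (n := n) c).target ∩ (chart c).symm ⁻¹' (id ⁻¹' A) := fun z hz => hz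
  have hzero : ∀ z ∈ bdryTarget n c ∩ (fun z => (chart (n := n) c).symm (bdryIncl z)) ⁻¹' A,
      readIn (n := n) id c c' (bdryIncl z) 0 = 0 := fun z hz =>
    (mem_boundary_iff (hA hz.2)).1 ((symm_mem_boundary_iff hz.1).2 (bdryIncl_zero z))
  rw [chartBdryVolume_eq, chartBdryVolume_eq]
  refine paramMeasure_congr (G := fun z => tailL n (readIn id c c' (bdryIncl z)))
    (G' := fun z => tailL n ∘L
      fderivWithin ℝ (readIn id c c') (halfSpace n) (bdryIncl z) ∘L bdryL n)
    (measurableSet_bdryTarget c) (continuousOn_symm_bdryIncl c) (measurableSet_bdryTarget c')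
    (continuousOn_symm_bdryIncl c') hAm hAm ?_ ?_ ?_ ?_
  · refine Subset.antisymm ?_ fun w hw => ?_
    · rintro _ ⟨z, hz, rfl⟩
      have h1 := himage.subset (mem_image_of_mem _ (hmem z hz))
      rwa [← bdryIncl_tailL (hzero z hz)] at h1
    · obtain ⟨y, hy, hyw⟩ := himage.superset (show bdryIncl w ∈ _ from hw)
      have hb := (symm_mem_boundary_iff hw.1).2 (bdryIncl_zero w)
      have h2 : (chart (n := n) c').symm (bdryIncl w) = (chart (n := n) c).symm y := by
        rw [← hyw, symm_readIn (hsub hy), id]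
      rw [h2] at hb
      have hy0 := (symm_mem_boundary_iff hy.1).1 hb
      refine ⟨tailL n y, ?_, ?_⟩
      · rw [← bdryIncl_tailL hy0] at hy
        exact hy
      · beta_reduce
        rw [bdryIncl_tailL hy0, hyw, tailL_bdryIncl]
  · intro z hz z' hz' hzz
    have h1 := congrArg bdryIncl hzz
    beta_reduce at h1
    rw [bdryIncl_tailL (hzero z hz), bdryIncl_tailL (hzero z' hz')] at h1
    rw [← tailL_bdryIncl z, ← tailL_bdryIncl z', hinj (hmem z hz) (hmem z' hz') h1]
  · intro z hz
    have h1 := ((smoothAlong_readIn hid).differentiableWithinAt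
      (hsub (hmem z hz))).hasFDerivWithinAt
    exact (tailL n).hasFDerivAt.comp_hasFDerivWithinAt z (h1.comp z
      (bdryL n).hasFDerivAt.hasFDerivWithinAt fun z _ => bdryIncl_mem_halfSpace z)
  · intro z hz
    rw [det_bdryCoord_readIn hid (isPullback_id h) (hsub (hmem z hz)) (hzero z hz),
      Real.sqrt_mul (sq_nonneg _), Real.sqrt_sq_eq_abs, det_tail_comp]
    rfl

/-- The family of boundary volumes of chart domains. -/
def bdryFamily [CompactSpace M] [Nonempty M] (h : Metric n M) :
    ParamFamily (EuclideanSpace ℝ (Fin n)) M M where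
  U c := (chart (n := n) c).source
  S c := bdryTarget n c
  w c z := √(bdryCoord h c z).det
  p c z := (chart c).symm (bdryIncl z)
  isOpen_U c := isOpen_extChartAt_source c
  cover := exists_cover
  measurableSet_S := measurableSet_bdryTarget
  continuousOn_p := continuousOn_symm_bdryIncl
  continuousOn_w := continuousOn_sqrt_det_bdryCoord h
  nonneg_w _ _ _ := Real.sqrt_nonneg _
  mapsTo_p c _ hz := (chart c).mapsTo_symm hz
  consistent _ _ _ hA hAm :=
    chartBdryVolume_congr h hAm (fun _ hx => (hA hx).1) fun _ hx => (hA hx).2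
  compact c K hK hKc := by
    have h1 : IsCompact (chart (n := n) c '' K) :=
      hKc.image_of_continuousOn ((continuousOn_extChartAt c).mono hK)
    have h2 : IsClosed {y : Model n | y 0 = 0} :=
      isClosed_eq (coordFun (n := n) 0).continuous continuous_const
    refine ⟨tailL n '' (chart (n := n) c '' K ∩ {y | y 0 = 0}), ?_,
      (h1.inter_right h2).image (tailL n).continuous, fun z hz =>
        ⟨bdryIncl z, ⟨⟨_, hz.2, (chart c).right_inv hz.1⟩, bdryIncl_zero z⟩, tailL_bdryIncl z⟩⟩
    rintro _ ⟨_, ⟨⟨x, hx, rfl⟩, h0⟩, rfl⟩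
    change bdryIncl _ ∈ (chart (n := n) c).target
    rw [bdryIncl_tailL h0]
    exact (chart c).map_source (hK hx)

lemma bdryVolume_eq [CompactSpace M] [Nonempty M] (h : Metric n M) :
    bdryVolume h = (bdryFamily h).measure := rfl

end BoundaryVolume
end VacuaMetric
end

noncomputable section

namespace VacuaMetric

/-! ### The divergence theorem on the half space -/

section Divergence

variable {n : ℕ}

lemma setIntegral_toLp {m : ℕ} (S : Set (EuclideanSpace ℝ (Fin m)))
    (g : EuclideanSpace ℝ (Fin m) → ℝ) :
    ∫ y in S, g y = ∫ x in WithLp.toLp 2 ⁻¹' S, g (WithLp.toLp 2 x) :=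
  ((PiLp.volume_preserving_toLp (Fin m)).setIntegral_preimage_emb
    (MeasurableEquiv.toLp 2 (Fin m → ℝ)).measurableEmbedding g S).symm

lemma insertNth_zero_toLp (z : Fin n → ℝ) :
    WithLp.toLp 2 (Fin.insertNth 0 0 z : Fin (n + 1) → ℝ) = bdryIncl (WithLp.toLp 2 z) := by
  rw [Fin.insertNth_zero']; rfl

/-- The divergence theorem for compactly supported vector fields on the half space. -/
lemma integral_divergence_halfSpace {f : Fin (n + 1) → Model n → ℝ} {K : Set (Model n)}
    (hK : IsCompact K) (hf0 : ∀ i, ∀ y ∉ K, f i y = 0)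
    (hf : ∀ i, ContDiffOn ℝ 1 (f i) (halfSpace n)) :
    ∫ y in halfSpace n, ∑ i, pd i (f i) y = - ∫ z, f 0 (bdryIncl z) := by
  obtain ⟨R, hR, hKR⟩ : ∃ R > 0, ∀ y ∈ K, ∀ i, |y i| < R := by
    obtain ⟨R, hR, hKR⟩ := hK.isBounded.exists_pos_norm_lt
    exact ⟨R, hR, fun y hy i => (PiLp.norm_apply_le y i).trans_lt (hKR y hy)⟩
  -- The box [0, R] × [−R, R]ⁿ contains K ∩ halfSpace; among its faces only y⁰ = 0 can meet K.
  set a : Fin (n + 1) → ℝ := fun i => if i = 0 then 0 else -R with ha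
  set b : Fin (n + 1) → ℝ := fun _ => R with hb
  have hab : a ≤ b := fun i => by
    simp only [ha, hb]; split_ifs <;> linarith
  have hIcc : ∀ x ∈ Icc a b, WithLp.toLp 2 x ∈ halfSpace n := fun x hx => by
    rw [halfSpace_eq]
    have := hx.1 0
    simpa [ha] using this
  set T : (Fin (n + 1) → ℝ) →L[ℝ] Model n :=
    (PiLp.continuousLinearEquiv 2 ℝ fun _ : Fin (n + 1) => ℝ).symm.toContinuousLinearMap with hT
  have hTapp : ∀ x, T x = WithLp.toLp 2 x := fun x => rfl
  have hcont : ∀ i, ContinuousOn (pd i (f i)) (halfSpace n) := fun i =>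
    ((hf i).continuousOn_fderivWithin uniqueDiffOn_halfSpace le_rfl).clm_apply
      continuousOn_const
  have hpd0 : ∀ i, ∀ y ∈ halfSpace n, y ∉ K → pd i (f i) y = 0 := fun i y hy hyK => by
    have h1 : f i =ᶠ[nhdsWithin y (halfSpace n)] fun _ => 0 :=
      Filter.eventually_of_mem (mem_nhdsWithin_of_mem_nhds (hK.isClosed.isOpen_compl.mem_nhds hyK))
        fun z hz => hf0 i z hz
    rw [pd, h1.fderivWithin_eq (hf0 i y hyK)]
    simp
  have key := integral_divergence_of_hasFDerivAt_off_countable' a b hab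
    (fun i x => f i (WithLp.toLp 2 x))
    (fun i x => (fderivWithin ℝ (f i) (halfSpace n) (WithLp.toLp 2 x)).comp T) ∅ countable_empty
    (fun i => (hf i).continuousOn.comp T.continuous.continuousOn hIcc) (fun x hx i => ?_) ?_
  · have hL : ∫ y in halfSpace n, ∑ i, pd i (f i) y =
        ∫ x in Icc a b, ∑ i, pd i (f i) (WithLp.toLp 2 x) := by
      rw [setIntegral_toLp]
      refine (setIntegral_eq_of_subset_of_forall_sdiff_eq_zero
        (T.continuous.measurable (𝓡∂ (n + 1)).isClosed_range.measurableSet) hIcc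
        fun x hx => ?_)
      refine Finset.sum_eq_zero fun i _ => hpd0 i _ hx.1 fun hxK => hx.2 ?_
      have h1 := hx.1
      rw [mem_preimage, halfSpace_eq] at h1
      refine ⟨fun j => ?_, fun j => (abs_lt.1 (hKR _ hxK j)).2.le⟩
      simp only [ha]
      split_ifs with hj
      · rw [hj]; exact h1
      · exact (abs_lt.1 (hKR _ hxK j)).1.le
    have hout : ∀ i, ∀ y : Model n, R ≤ |y i| → ∀ j, f j y = 0 := fun i y hy j =>
      hf0 j y fun hyK => (hKR y hyK i).not_ge hy
    have hterm : ∀ i : Fin (n + 1),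
        ((∫ x in Icc (a ∘ i.succAbove) (b ∘ i.succAbove),
            f i (WithLp.toLp 2 (i.insertNth (b i) x))) -
          ∫ x in Icc (a ∘ i.succAbove) (b ∘ i.succAbove),
            f i (WithLp.toLp 2 (i.insertNth (a i) x))) =
        if i = 0 then - ∫ z, f 0 (bdryIncl z) else 0 := fun i => by
      -- On an upper face some coordinate equals R, while K has all coordinates strictly below R in
      -- absolute value. The lower faces other than y⁰ = 0 are treated in the same way below.
      have h1 : ∀ x : Fin n → ℝ, f i (WithLp.toLp 2 (i.insertNth (b i) x)) = 0 := fun x =>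
        hout i _ (by simp [hb, abs_of_pos hR]) i
      simp only [h1, integral_zero, zero_sub]
      split_ifs with hi
      · subst hi
        congr 1
        have h2 : a 0 = 0 := by simp [ha]
        simp only [h2, insertNth_zero_toLp]
        have h3 : ∫ z, f 0 (bdryIncl z) = ∫ x : Fin n → ℝ, f 0 (bdryIncl (WithLp.toLp 2 x)) := by
          simpa using setIntegral_toLp univ fun z => f 0 (bdryIncl z)
        rw [h3]
        refine setIntegral_eq_integral_of_forall_compl_eq_zero fun x hx => hf0 0 _ fun hxK => hx ?_
        have h4 : ∀ j : Fin n, |x j| < R := fun j => hKR _ hxK j.succ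
        refine ⟨fun j => ?_, fun j => (abs_lt.1 (h4 j)).2.le⟩
        simp only [ha, Function.comp]
        rw [if_neg (Fin.succAbove_ne 0 j)]
        exact (abs_lt.1 (h4 j)).1.le
      · have h1 : ∀ x : Fin n → ℝ, f i (WithLp.toLp 2 (i.insertNth (a i) x)) = 0 := fun x =>
          hout i _ (by simp [ha, hi, abs_of_pos hR]) i
        simp only [h1, integral_zero, neg_zero]
    rw [hL]
    refine key.trans ?_
    rw [Finset.sum_congr rfl fun i _ => hterm i]
    simp
  · have h1 : WithLp.toLp 2 x ∈ interior (halfSpace n) := by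
      rw [interior_halfSpace_eq]
      have := (hx.1 0 (mem_univ _)).1
      simpa [ha] using this
    have h2 := ((hf i).differentiableOn one_ne_zero _ (interior_subset h1)).hasFDerivWithinAt
      |>.hasFDerivAt (mem_interior_iff_mem_nhds.1 h1)
    exact h2.comp x T.hasFDerivAt
  · refine ContinuousOn.integrableOn_compact isCompact_Icc ?_
    exact continuousOn_finsetSum _ fun i _ =>
      (hcont i).comp T.continuous.continuousOn hIcc

end Divergence
end VacuaMetric
end

noncomputable section

namespace VacuaMetric

/-! ### The flux field and its divergence -/

section Flux

variable {n : ℕ} {M : Type*} [TopologicalSpace M] [ChartedSpace (EuclideanHalfSpace (n + 1)) M]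
  [IsManifold (𝓡∂ (n + 1)) ∞ M]

open Matrix VacuaMetric.TensorAlgebra

variable {c : M} {h : Metric n M}

/-- The cofactor formula for h^{00}. It converts the volume density of M into that of the boundary,
the normalization of N supplying √h^{00}. -/
lemma invCoord_mul_det (h : Metric n M) {y : Model n} (hy : y ∈ (chart c).target) :
    invCoord h c y 0 0 * (metricCoord h c y).det =
      ((metricCoord h c y).submatrix Fin.succ Fin.succ).det := by
  have h1 : (metricCoord h c y).det ≠ 0 := (metricCoord_det_pos h hy).ne'
  rw [invCoord, Matrix.inv_def, Matrix.smul_apply, Matrix.adjugate_fin_succ_eq_det_submatrix,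
    Ring.inverse_eq_inv', smul_eq_mul]
  simp only [Fin.succAbove_zero, Fin.val_zero, add_zero, pow_zero, one_mul]
  field_simp

lemma smoothAlong_sqrt_det (h : Metric n M) (c : M) :
    SmoothAlong (chart c).target (fun y => √(metricCoord h c y).det) := fun y hy =>
  (SmoothAlong.det (smoothAlong_metricCoord h c) y hy).sqrt (metricCoord_det_pos h hy).ne'

lemma smoothAlong_inv_sqrt_det (h : Metric n M) (c : M) :
    SmoothAlong (chart c).target (fun y => (√(metricCoord h c y).det)⁻¹) := fun y hy =>
  (smoothAlong_sqrt_det h c y hy).inv (Real.sqrt_pos.2 (metricCoord_det_pos h hy)).ne'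

/-- The volume density over the ring of smooth functions. -/
def volR (h : Metric n M) (c : M) : ChartRing (n := n) c := ofSmooth _ _ (smoothAlong_sqrt_det h c)

lemma map_metricR {y : Model n} (hy : y ∈ (chart c).target) :
    (metricR h c).map (evalAt (isRelOpen_target c) hy) = metricCoord h c y := by
  ext i j; exact (rep_metric h c i j y hy).symm

lemma map_invR {y : Model n} (hy : y ∈ (chart c).target) :
    (invR h c).map (evalAt (isRelOpen_target c) hy) = invCoord h c y := by
  ext i j; exact (rep_inv h c i j y hy).symm

lemma map_lieR {V : VField n M} (hV : IsSmooth V) {y : Model n} (hy : y ∈ (chart c).target) :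
    (lieM (chartDer c) (metricR h c) (invR h c) (vecR hV c)).map
      (evalAt (isRelOpen_target c) hy) = lieCoord h V c y := by
  ext i j; exact (rep_lie hV h c i j y hy).symm

lemma chartDer_volR (h : Metric n M) (c : M) (m : Fin (n + 1)) : chartDer c m (volR h c) =
    volR h c * (chrM (chartDer c) (metricR h c) (invR h c) m).trace := by
  refine derivation_volume (metricR_transpose h c) (metricR_mul_invR h c)
    (w' := ofSmooth _ _ (smoothAlong_inv_sqrt_det h c)) ?_ ?_ m
  · refine ext_evalAt fun y hy => ?_
    have h1 : evalAt (isRelOpen_target c) hy (metricR h c).det = (metricCoord h c y).det := by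
      rw [AlgHom.map_det]
      exact congrArg _ (map_metricR hy)
    rw [map_mul, h1]
    exact Real.mul_self_sqrt (metricCoord_det_pos h hy).le
  · refine ext_evalAt fun y hy => ?_
    rw [map_mul, map_one]
    exact mul_inv_cancel₀ (Real.sqrt_pos.2 (metricCoord_det_pos h hy)).ne'

lemma lieCoord_symm (V : VField n M) (y : Model n) : (lieCoord h V c y)ᵀ = lieCoord h V c y := by
  ext i j
  simp only [lieCoord, Matrix.transpose_apply, Matrix.of_apply, add_comm]

/-- The flux whose divergence is half of the DeWitt density. -/
def flux (h : Metric n M) {V W : VField n M} (hV : IsSmooth V) (hW : IsSmooth W) (c : M)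
    (i : Fin (n + 1)) : ChartRing (n := n) c :=
  volR h c * (momM (chartDer c) (metricR h c) (invR h c) (vecR hW c) *ᵥ vecR hV c) i

variable {V W : VField n M} (hV : IsSmooth V) (hW : IsSmooth W)

lemma trace_map_evalAt {y : Model n} (hy : y ∈ (chart c).target)
    (A : Matrix (Fin (n + 1)) (Fin (n + 1)) (ChartRing (n := n) c)) :
    evalAt (isRelOpen_target c) hy A.trace = (A.map (evalAt (isRelOpen_target c) hy)).trace := by
  simp [Matrix.trace]

/-- Here the two hypotheses on curvature and momentum enter the integral identity. They concern only
W; the field V is arbitrary. -/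
lemma divergence_flux (hflat : IsRicciFlat h) (hmom : MomentumConstraint h W) {y : Model n}
    (hy : y ∈ (chart c).target) :
    ∑ i, pd i (flux h hV hW c i).fn y =
      √(metricCoord h c y).det * (1 / 2 * chartDensity h V W c y) := by
  have h1 := divergence_momM_mulVec (metricR_transpose h c) (metricR_mul_invR h c)
    (chartDer_volR h c) (vecR hV c) (vecR hW c) (divergence_momM_chart hW hflat hmom c)
  have h2 := (Rep.sum (s := Finset.univ) fun i => (rep_fn (flux h hV hW c i)).pd i) y hy
  have hv : evalAt (isRelOpen_target c) hy (volR h c) = √(metricCoord h c y).det := rfl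
  refine h2.trans ((congrArg _ h1).trans ?_)
  rw [map_mul, map_smul, map_sub, map_mul, trace_map_evalAt, trace_map_evalAt, trace_map_evalAt,
    smul_eq_mul, hv]
  simp only [Matrix.map_mul, map_invR hy, map_lieR _ hy]
  rw [chartDensity, deWittPairing_eq_trace, lieCoord_symm, lieCoord_symm]
  change _ = _ * (1 / 2 * ((lieCoord h V c y * invCoord h c y * lieCoord h W c y *
    (invCoord h c y)ᵀ).trace - (lieCoord h V c y * invCoord h c y).trace *
      (lieCoord h W c y * invCoord h c y).trace))
  rw [invCoord_transpose, Matrix.trace_mul_comm _ (invCoord h c y),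
    Matrix.trace_mul_comm (lieCoord h V c y), Matrix.trace_mul_comm (lieCoord h W c y)]
  simp only [Matrix.mul_assoc]

/-- The trace part of `momM` multiplies V⁰, which is zero on the boundary. In the rest, h^{0l} =
−√h^{00} N^l, and √h^{00} combines with √det h to the boundary density. -/
lemma flux_boundary (hV0 : BoundaryPreserving h V) {y : Model n}
    (hy : y ∈ (chart c).target) (h0 : y 0 = 0) :
    - (flux h hV hW c 0).fn y = √((metricCoord h c y).submatrix Fin.succ Fin.succ).det *
      lieForm h W c y (normalVec h c y) (vecChart V c y) := by
  set s := √(invCoord h c y 0 0) with hs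
  have hs0 : 0 < s := Real.sqrt_pos.2 (invCoord_zero_pos h hy 0)
  have hss : s * s = invCoord h c y 0 0 := Real.mul_self_sqrt (invCoord_zero_pos h hy 0).le
  have hV00 : vecChart V c y 0 = 0 := hV0.vecChart_zero hy h0
  have e1 : evalAt (isRelOpen_target c) hy
      ((momM (chartDer c) (metricR h c) (invR h c) (vecR hW c) *ᵥ vecR hV c) 0) =
      ∑ k, (invCoord h c y * lieCoord h W c y) 0 k * vecChart V c y k := by
    have e2 : ∀ k, evalAt (isRelOpen_target c) hy (vecR hV c k) = vecChart V c y k := fun k => rfl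
    have e3 : evalAt (isRelOpen_target c) hy (vecR hV c 0) = 0 := hV00
    rw [momM, Matrix.sub_mulVec, Matrix.smul_mulVec, Matrix.one_mulVec, Pi.sub_apply,
      Pi.smul_apply, smul_eq_mul, map_sub, map_mul, e3, mul_zero, sub_zero, Matrix.mulVec,
      dotProduct, map_sum]
    simp only [map_mul, e2, ← map_invR hy, ← map_lieR hW hy, ← Matrix.map_mul, Matrix.map_apply]
  rw [← invCoord_mul_det h hy, Real.sqrt_mul (invCoord_zero_pos h hy 0).le, ← evalAt_eq_fn hy,
    flux, map_mul, e1, lieForm_eq_sum hW h hy, ← hs]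
  have e4 : ∀ k, s * ∑ l, lieCoord h W c y l k * normalVec h c y l =
      - (invCoord h c y * lieCoord h W c y) 0 k := fun k => by
    rw [Matrix.mul_apply, ← Finset.sum_neg_distrib, Finset.mul_sum]
    refine Finset.sum_congr rfl fun l _ => ?_
    have h4 : invCoord h c y l 0 = invCoord h c y 0 l :=
      congrFun (congrFun (invCoord_transpose h) 0) l
    have h5 : normalVec h c y l = - invCoord h c y l 0 / s := rfl
    rw [h5, h4]
    field_simp
  have e5 : s * ∑ i, ∑ j, lieCoord h W c y i j * normalVec h c y i * vecChart V c y j =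
      - ∑ k, (invCoord h c y * lieCoord h W c y) 0 k * vecChart V c y k := by
    rw [Finset.sum_comm, Finset.mul_sum, ← Finset.sum_neg_distrib]
    refine Finset.sum_congr rfl fun k _ => ?_
    rw [← neg_mul, ← e4, ← Finset.sum_mul, mul_assoc]
  have hv : evalAt (isRelOpen_target c) hy (volR h c) = √(metricCoord h c y).det := rfl
  rw [hv, mul_comm s, mul_assoc, e5]
  ring

/-! ### Extension by zero -/

/-- Off the target the complement of the compact K is a neighbourhood on which the extension is
zero, so the extension by zero stays C¹ up to the boundary. -/
lemma contDiffOn_indicator {g : Model n → ℝ} (hg : SmoothAlong (chart (n := n) c).target g)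
    {K : Set (Model n)} (hK : IsCompact K) (h0 : ∀ y ∈ (chart (n := n) c).target, y ∉ K → g y = 0)
    (hKt : K ⊆ (chart (n := n) c).target) :
    ContDiffOn ℝ 1 ((chart (n := n) c).target.indicator g) (halfSpace n) := by
  intro y hy
  by_cases hyt : y ∈ (chart (n := n) c).target
  · exact ((hg.congr (isRelOpen_target c) fun z hz => indicator_of_mem hz g) y hyt).of_le (by
      exact_mod_cast le_top)
  · have h1 : (chart (n := n) c).target.indicator g =ᶠ[nhds y] fun _ => 0 := by
      filter_upwards [hK.isClosed.isOpen_compl.mem_nhds fun hyK => hyt (hKt hyK)] with z hz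
      by_cases hzt : z ∈ (chart (n := n) c).target
      · rw [indicator_of_mem hzt, h0 z hzt hz]
      · rw [indicator_of_notMem hzt]
    exact (contDiffAt_const.congr_of_eventuallyEq h1).contDiffWithinAt

lemma pd_indicator {g : Model n → ℝ} {K : Set (Model n)} (hK : IsCompact K)
    (h0 : ∀ y ∈ (chart (n := n) c).target, y ∉ K → g y = 0)
    (hKt : K ⊆ (chart (n := n) c).target) (k : Fin (n + 1)) (y : Model n) :
    pd k ((chart (n := n) c).target.indicator g) y =
      (chart (n := n) c).target.indicator (pd k g) y := by
  by_cases hyt : y ∈ (chart (n := n) c).target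
  · rw [indicator_of_mem hyt, pd_congr (isRelOpen_target c) hyt fun z hz => indicator_of_mem hz g]
  · have h1 : (chart (n := n) c).target.indicator g =ᶠ[nhds y] fun _ => 0 := by
      filter_upwards [hK.isClosed.isOpen_compl.mem_nhds fun hyK => hyt (hKt hyK)] with z hz
      by_cases hzt : z ∈ (chart (n := n) c).target
      · rw [indicator_of_mem hzt, h0 z hzt hz]
      · rw [indicator_of_notMem hzt]
    rw [indicator_of_notMem hyt, pd, (h1.filter_mono nhdsWithin_le_nhds).fderivWithin_eq h1.eq_of_nhds]
    simp

lemma continuous_indicator_source [T2Space M] {g : M → ℝ}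
    (hg : ContinuousOn g (chart (n := n) c).source) {K : Set M} (hK : IsCompact K)
    (h0 : ∀ x ∉ K, g x = 0) (hKs : K ⊆ (chart (n := n) c).source) :
    Continuous ((chart (n := n) c).source.indicator g) := by
  refine continuous_iff_continuousAt.2 fun x => ?_
  by_cases hx : x ∈ (chart (n := n) c).source
  · have hn := (isOpen_extChartAt_source (I := 𝓡∂ (n + 1)) c).mem_nhds hx
    refine (hg.continuousAt hn).congr ?_
    filter_upwards [hn] with z hz
    rw [indicator_of_mem hz]
  · refine continuousAt_const.congr (f := fun _ => (0 : ℝ)) ?_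
    filter_upwards [hK.isClosed.isOpen_compl.mem_nhds fun hxK => hx (hKs hxK)] with z hz
    by_cases hzt : z ∈ (chart (n := n) c).source
    · rw [indicator_of_mem hzt, h0 z hz]
    · rw [indicator_of_notMem hzt]

end Flux
end VacuaMetric
end

noncomputable section

namespace VacuaMetric

section Identity

variable {n : ℕ} {M : Type*} [TopologicalSpace M] [ChartedSpace (EuclideanHalfSpace (n + 1)) M]
  [IsManifold (𝓡∂ (n + 1)) ∞ M]

open Matrix

variable {c : M} {h : Metric n M} {V V' W : VField n M}

/-! ### Continuity and additivity of the densities -/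

lemma smoothAlong_chartDensity (hV : IsSmooth V) (hW : IsSmooth W) (c : M) :
    SmoothAlong (chart c).target (chartDensity h V W c) :=
  Rep.smoothAlong (Rep.sum (s := Finset.univ) fun i => Rep.sum (s := Finset.univ) fun j =>
    Rep.sum (s := Finset.univ) fun k => Rep.sum (s := Finset.univ) fun l =>
      ((((rep_inv h c i k).mul (rep_inv h c j l)).sub ((rep_inv h c i j).mul
        (rep_inv h c k l))).mul (rep_lie hV h c i j)).mul (rep_lie hW h c k l))

lemma continuous_deWittDensity (hV : IsSmooth V) (hW : IsSmooth W) :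
    Continuous (deWittDensity h (deformation h V) (deformation h W)) := by
  refine continuous_iff_continuousAt.2 fun x => ?_
  have hx := mem_extChartAt_source (I := 𝓡∂ (n + 1)) x
  have hn := (isOpen_extChartAt_source (I := 𝓡∂ (n + 1)) x).mem_nhds hx
  have h1 : ContinuousOn (fun z => chartDensity h V W x (chart x z)) (chart (n := n) x).source :=
    ((smoothAlong_chartDensity hV hW x).continuousOn (isRelOpen_target x)).comp
      (continuousOn_extChartAt x) (chart x).mapsTo
  refine (h1.continuousAt hn).congr ?_
  filter_upwards [hn] with z hz
  exact (deWittDensity_chart hV hW hz).symm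

lemma lieForm_add (hV : IsSmooth V) (hV' : IsSmooth V') {y : Model n} (hy : y ∈ (chart c).target)
    (u v : Model n) : lieForm h (fun x => V x + V' x) c y u v =
      lieForm h V c y u v + lieForm h V' c y u v := by
  have h1 : vecChart (fun x => V x + V' x) c = fun y => vecChart V c y + vecChart V' c y := by
    ext1 y; exact map_add _ _ _
  rw [lieForm, lieForm, lieForm, lieDeriv, lieDeriv, lieDeriv, h1,
    fderivWithin_fun_add (uniqueDiffOn_halfSpace y ((isRelOpen_target c).subset hy))
      ((hV.vecChart c).differentiableWithinAt hy) ((hV'.vecChart c).differentiableWithinAt hy)]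
  simp only [map_add, _root_.add_apply]
  ring

lemma lieForm_add_right (y u v w : Model n) :
    lieForm h V c y u (v + w) = lieForm h V c y u v + lieForm h V c y u w := by
  simp only [lieForm, lieDeriv, map_add]
  ring

lemma lieForm_zero_right (y u : Model n) : lieForm h V c y u 0 = 0 := by
  simp only [lieForm, lieDeriv, map_zero, add_zero]

lemma lieForm_eq_zero {x : M} (h0 : ∀ᶠ z in nhds x, V z = 0) (u v : Model n) :
    lieForm h V x (chart x x) u v = 0 := by
  have h1 : vecChart V x =ᶠ[nhds (chart x x)] fun _ => 0 := by
    have h2 := continuousAt_extChartAt_symm (I := 𝓡∂ (n + 1)) x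
    rw [ContinuousAt, extChartAt_to_inv] at h2
    filter_upwards [h2.eventually h0] with y hy
    rw [vecChart, hy, map_zero]
  rw [lieForm, lieDeriv, (h1.filter_mono nhdsWithin_le_nhds).fderivWithin_eq h1.eq_of_nhds,
    h1.eq_of_nhds]
  simp

lemma deWittDensity_eq_zero (hV : IsSmooth V) (hW : IsSmooth W) {x : M}
    (h0 : ∀ᶠ z in nhds x, V z = 0) :
    deWittDensity h (deformation h V) (deformation h W) x = 0 := by
  have h1 : ∀ i j, lieCoord h V x (chart x x) i j = 0 := fun i j => by
    rw [lieCoord_eq hV h (mem_extChartAt_target x), lieForm_eq_zero h0]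
  rw [deWittDensity_self hV hW]
  simp only [chartDensity, deWittPairing, h1, mul_zero, zero_mul, Finset.sum_const_zero]

lemma chartDensity_add (hV : IsSmooth V) (hV' : IsSmooth V') {y : Model n}
    (hy : y ∈ (chart c).target) : chartDensity h (fun x => V x + V' x) W c y =
      chartDensity h V W c y + chartDensity h V' W c y := by
  have h1 : ∀ i j, lieCoord h (fun x => V x + V' x) c y i j =
      lieCoord h V c y i j + lieCoord h V' c y i j := fun i j => by
    rw [lieCoord_eq (hV.add hV') h hy, lieCoord_eq hV h hy, lieCoord_eq hV' h hy,
      lieForm_add hV hV' hy]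
  simp only [chartDensity, deWittPairing, h1, mul_add, add_mul, Finset.sum_add_distrib]

lemma deWittDensity_add (hV : IsSmooth V) (hV' : IsSmooth V') (hW : IsSmooth W) (x : M) :
    deWittDensity h (deformation h fun x => V x + V' x) (deformation h W) x =
      deWittDensity h (deformation h V) (deformation h W) x +
        deWittDensity h (deformation h V') (deformation h W) x := by
  rw [deWittDensity_self (hV.add hV') hW, deWittDensity_self hV hW, deWittDensity_self hV' hW,
    chartDensity_add hV hV' (mem_extChartAt_target x)]

/-- Exchange of the two index pairs, with a symmetric inverse metric. The symmetry of the boundary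
form is drawn from this. -/
lemma deWittDensity_symm (h : Metric n M) (k₁ k₂ : TensorField n M) (x : M) :
    deWittDensity h k₁ k₂ x = deWittDensity h k₂ k₁ x := by
  have hs : ∀ i j, invCoord h x (chart x x) i j = invCoord h x (chart x x) j i := fun i j =>
    congrFun (congrFun (invCoord_transpose h) j) i
  have h1 : ∀ (f : Fin (n + 1) → Fin (n + 1) → Fin (n + 1) → Fin (n + 1) → ℝ),
      ∑ i, ∑ j, ∑ k, ∑ l, f i j k l = ∑ i, ∑ j, ∑ k, ∑ l, f k l i j := fun f => by
    have h2 := Finset.sum_comm (s := Finset.univ) (t := Finset.univ)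
      (f := fun (p q : Fin (n + 1) × Fin (n + 1)) => f p.1 p.2 q.1 q.2)
    simpa only [Fintype.sum_prod_type] using h2
  rw [deWittDensity, h1, deWittDensity]
  refine Finset.sum_congr rfl fun i _ => Finset.sum_congr rfl fun j _ =>
    Finset.sum_congr rfl fun k _ => Finset.sum_congr rfl fun l _ => ?_
  rw [hs k i, hs l j]
  ring

lemma boundaryDensity_add (hW : IsSmooth W) (hbW : BoundaryPreserving h W)
    (hbV : BoundaryPreserving h V) (hbV' : BoundaryPreserving h V') {x : M}
    (hb : x ∈ (𝓡∂ (n + 1)).boundary M) :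
    boundaryDensity h (fun x => V x + V' x) W x =
      boundaryDensity h V W x + boundaryDensity h V' W x := by
  rw [boundaryDensity_eq_self hW hbW (hbV.add hbV') hb, boundaryDensity_eq_self hW hbW hbV hb,
    boundaryDensity_eq_self hW hbW hbV' hb, ← lieForm_add_right]
  rfl

/-! ### Localization -/

lemma IsSmooth.smul {ρ : M → ℝ} (hρ : ContMDiff (𝓡∂ (n + 1)) 𝓘(ℝ, ℝ) ∞ ρ) (hV : IsSmooth V) :
    IsSmooth (fun x => ρ x • V x) := IsSmooth.of_vecChart fun c => by
  have h1 : VacuaMetric.vecChart (fun x => ρ x • V x) c =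
      fun y => (ρ ∘ (chart c).symm) y • VacuaMetric.vecChart V c y := by
    ext1 y; exact map_smul _ _ _
  rw [h1]
  exact fun y hy => (smoothAlong_comp_symm hρ c y hy).smul (hV.vecChart c y hy)

lemma BoundaryPreserving.smul (ρ : M → ℝ) (hV : BoundaryPreserving h V) :
    BoundaryPreserving h (fun x => ρ x • V x) := fun x hx => by
  rw [map_smul, hV x hx, smul_zero]

variable [CompactSpace M] [T2Space M] [MeasurableSpace M] [BorelSpace M]

instance isLocallyFiniteMeasure_riemVolume (h : Metric n M) :
    IsLocallyFiniteMeasure (riemVolume h) where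
  finiteAtNhds x := by
    have : Nonempty M := ⟨x⟩
    exact (volumeFamily h).isLocallyFiniteMeasure.finiteAtNhds x

instance isLocallyFiniteMeasure_bdryVolume (h : Metric n M) :
    IsLocallyFiniteMeasure (bdryVolume h) where
  finiteAtNhds x := by
    have : Nonempty M := ⟨x⟩
    exact (bdryFamily h).isLocallyFiniteMeasure.finiteAtNhds x

lemma integrable_of_continuous {μ : Measure M} [IsLocallyFiniteMeasure μ] {f : M → ℝ}
    (hf : Continuous f) : Integrable f μ :=
  hf.integrable_of_hasCompactSupport (HasCompactSupport.of_compactSpace f)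

lemma ae_mem_boundary (h : Metric n M) : ∀ᵐ x ∂(bdryVolume h), x ∈ (𝓡∂ (n + 1)).boundary M := by
  rcases isEmpty_or_nonempty M with hM | hM
  · exact Filter.Eventually.of_forall fun x => (hM.false x).elim
  · exact (bdryFamily h).ae_of_forall
      ((𝓡∂ (n + 1)).isClosed_boundary (n := 1) one_ne_zero).measurableSet
      fun c z hz => (symm_mem_boundary_iff (c := c) hz).2 (bdryIncl_zero z)

/-- The Green identity relating the DeWitt metric and the boundary form, for a fixed second
field `W`. -/
structure GreenIdentity (h : Metric n M) (V W : VField n M) : Prop where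
  smooth : IsSmooth V
  boundaryPreserving : BoundaryPreserving h V
  integrable : Integrable (boundaryDensity h V W) (bdryVolume h)
  eq : deWitt h (deformation h V) (deformation h W) = boundaryForm h V W

/-- Splitting the boundary integral requires integrability, which is why the structure carries it;
the DeWitt densities are continuous on a compact manifold. -/
lemma GreenIdentity.add (hW : IsSmooth W) (hbW : BoundaryPreserving h W)
    (hV : GreenIdentity h V W) (hV' : GreenIdentity h V' W) :
    GreenIdentity h (fun x => V x + V' x) W := by
  have h1 : boundaryDensity h (fun x => V x + V' x) W =ᵐ[bdryVolume h]
      fun x => boundaryDensity h V W x + boundaryDensity h V' W x := by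
    filter_upwards [ae_mem_boundary h] with x hx using
      boundaryDensity_add hW hbW hV.boundaryPreserving hV'.boundaryPreserving hx
  refine ⟨hV.smooth.add hV'.smooth, hV.boundaryPreserving.add hV'.boundaryPreserving,
    (hV.integrable.add hV'.integrable).congr h1.symm, ?_⟩
  rw [boundaryForm, integral_congr_ae h1, integral_add hV.integrable hV'.integrable,
    ← boundaryForm, ← boundaryForm, ← hV.eq, ← hV'.eq, deWitt, deWitt, deWitt, ← mul_add,
    ← integral_add (integrable_of_continuous (continuous_deWittDensity hV.smooth hW))
      (integrable_of_continuous (continuous_deWittDensity hV'.smooth hW))]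
  simp only [deWittDensity_add hV.smooth hV'.smooth hW]

/-- The Green identity for a field supported in the domain of a chart. -/
lemma greenIdentity_of_support (hflat : IsRicciFlat h) (hW : IsAdmissible h W) (hV : IsSmooth V)
    (hbV : BoundaryPreserving h V) {K : Set M} (hK : IsCompact K)
    (hKc : K ⊆ (chart (n := n) c).source) (h0 : ∀ x ∉ K, V x = 0) : GreenIdentity h V W := by
  have : Nonempty M := ⟨c⟩
  have hWs : IsSmooth W := hW.smooth
  have hbW := hW.boundaryPreserving
  have hK' : IsCompact (chart (n := n) c '' K) :=
    hK.image_of_continuousOn ((continuousOn_extChartAt c).mono hKc)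
  have hKt : chart (n := n) c '' K ⊆ (chart (n := n) c).target :=
    image_subset_iff.2 fun x hx => (chart c).map_source (hKc hx)
  have hV0 : ∀ y ∈ (chart (n := n) c).target, y ∉ chart (n := n) c '' K →
      vecChart V c y = 0 := fun y hy hyK => by
    rw [vecChart, h0 _ fun hx => hyK ⟨_, hx, (chart c).right_inv hy⟩, map_zero]
  have hflux0 : ∀ i, ∀ y ∈ (chart (n := n) c).target, y ∉ chart (n := n) c '' K →
      (flux h hV hWs c i).fn y = 0 := fun i y hy hyK => by
    have h1 : ∀ k, evalAt (isRelOpen_target c) hy (vecR hV c k) = 0 := fun k => by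
      change vecChart V c y k = 0
      rw [hV0 y hy hyK]; rfl
    rw [← evalAt_eq_fn hy, flux, map_mul, Matrix.mulVec, dotProduct, map_sum,
      Finset.sum_eq_zero fun k _ => by rw [map_mul, h1, mul_zero], mul_zero]
  set g : M → ℝ := fun x =>
    lieForm h W c (chart c x) (normalVec h c (chart c x)) (vecChart V c (chart c x)) with hg
  have hg0 : ∀ x ∉ K, x ∈ (chart (n := n) c).source → g x = 0 := fun x hx hxs => by
    rw [hg]; beta_reduce
    rw [vecChart_apply V hxs, h0 x hx, map_zero, lieForm_zero_right]
  have hgc : ContinuousOn g (chart (n := n) c).source := by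
    have h1 : SmoothAlong (chart (n := n) c).target
        (fun y => lieForm h W c y (normalVec h c y) (vecChart V c y)) :=
      SmoothAlong.congr (isRelOpen_target c) (Rep.smoothAlong
        (Rep.sum (s := Finset.univ) fun i => Rep.sum (s := Finset.univ) fun j =>
          ((rep_lie hWs h c i j).mul (rep_normal h c i)).mul (rep_vec hV c j)))
        fun y hy => lieForm_eq_sum hWs h hy _ _
    exact (h1.continuousOn (isRelOpen_target c)).comp (continuousOn_extChartAt c) (chart c).mapsTo
  -- A continuous function on M replacing the boundary integrand, which is controlled only at
  -- boundary points. `hae` shows that the two agree almost everywhere for the boundary volume.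
  set G : M → ℝ := (chart (n := n) c).source.indicator (K.indicator g) with hG
  have hGg : ∀ x ∈ (chart (n := n) c).source, K.indicator g x = g x := fun x hx => by
    by_cases hxK : x ∈ K
    · rw [indicator_of_mem hxK]
    · rw [indicator_of_notMem hxK, hg0 x hxK hx]
  have hGc : Continuous G := continuous_indicator_source (hgc.congr hGg) hK
    (fun x hx => indicator_of_notMem hx g) hKc
  have hae : boundaryDensity h V W =ᵐ[bdryVolume h] G := by
    filter_upwards [ae_mem_boundary h] with x hb
    by_cases hx : x ∈ (chart (n := n) c).source
    · rw [hG, indicator_of_mem hx, hGg x hx]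
      exact boundaryDensity_chart hWs hbW hbV hb hx
    · rw [hG, indicator_of_notMem hx, boundaryDensity_eq_self hWs hbW hbV hb,
        h0 x fun hxK => hx (hKc hxK)]
      exact lieForm_zero_right _ _
  refine ⟨hV, hbV, (integrable_of_continuous hGc).congr hae.symm, ?_⟩
  have hR : boundaryForm h V W =
      ∫ z in bdryTarget n c, √(bdryCoord h c z).det * G ((chart c).symm (bdryIncl z)) := by
    rw [boundaryForm, integral_congr_ae hae, bdryVolume_eq]
    exact (bdryFamily h).integral_eq (i := c) hGc fun x hx => indicator_of_notMem hx _
  have hL : deWitt h (deformation h V) (deformation h W) =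
      1 / 2 * ∫ y in (chart (n := n) c).target,
        √(metricCoord h c y).det * chartDensity h V W c y := by
    rw [deWitt, riemVolume_eq, (volumeFamily h).integral_eq (i := c)
      (continuous_deWittDensity hV hWs) fun x hx => ?_]
    · congr 1
      refine setIntegral_congr_fun (measurableSet_target c) fun y hy => ?_
      change √(metricCoord h c y).det * deWittDensity h _ _ ((chart c).symm y) = _
      rw [deWittDensity_chart hV hWs ((chart c).map_target hy), (chart c).right_inv hy]
    · have hxK : x ∉ K := fun hxK => hx (hKc hxK)
      exact deWittDensity_eq_zero hV hWs <| Filter.eventually_of_mem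
        (hK.isClosed.isOpen_compl.mem_nhds hxK) h0
  -- The flux is linear in V and so is supported where V is; extended by zero it is a compactly
  -- supported C¹ field on the half space.
  have hdiv := integral_divergence_halfSpace hK' (f := fun i =>
    (chart (n := n) c).target.indicator (flux h hV hWs c i).fn) (fun i y hy => by
      by_cases hyt : y ∈ (chart (n := n) c).target
      · rw [indicator_of_mem hyt, hflux0 i y hyt hy]
      · rw [indicator_of_notMem hyt])
    fun i => contDiffOn_indicator (flux h hV hWs c i).smoothAlong_fn hK' (hflux0 i) hKt
  simp only [pd_indicator hK' (hflux0 _) hKt] at hdiv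
  have h3 : ∫ y in halfSpace n, ∑ i, (chart (n := n) c).target.indicator
      (pd i (flux h hV hWs c i).fn) y =
      ∫ y in (chart (n := n) c).target,
        1 / 2 * (√(metricCoord h c y).det * chartDensity h V W c y) := by
    refine (setIntegral_eq_of_subset_of_forall_sdiff_eq_zero
      (𝓡∂ (n + 1)).isClosed_range.measurableSet (isRelOpen_target c).subset fun y hy =>
        Finset.sum_eq_zero fun i _ => indicator_of_notMem hy.2 _).trans ?_
    refine setIntegral_congr_fun (measurableSet_target c) fun y hy => ?_
    simp only [indicator_of_mem hy]
    rw [divergence_flux hV hWs hflat hW.momentum hy]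
    ring
  have h4 : ∀ z ∉ bdryTarget n c,
      - (chart (n := n) c).target.indicator (flux h hV hWs c 0).fn (bdryIncl z) = 0 :=
    fun z hz => by rw [indicator_of_notMem (show bdryIncl z ∉ (chart c).target from hz), neg_zero]
  -- Both sides are now integrals over the boundary slice of the chart. The outward direction is
  -- that of decreasing y⁰, and −flux⁰ is identified with the boundary integrand by `flux_boundary`.
  rw [hL, hR, ← integral_const_mul, ← h3, hdiv, ← integral_neg,
    ← setIntegral_eq_integral_of_forall_compl_eq_zero h4]
  refine setIntegral_congr_fun (measurableSet_bdryTarget c) fun z hz => ?_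
  have hz' : bdryIncl z ∈ (chart (n := n) c).target := hz
  have hzs := (chart c).map_target hz'
  rw [indicator_of_mem hz', flux_boundary hV hWs hbV hz' (bdryIncl_zero z), hG,
    indicator_of_mem hzs, hGg _ hzs, hg]
  beta_reduce
  rw [(chart c).right_inv hz']
  rfl

end Identity
end VacuaMetric
end

noncomputable section

namespace VacuaMetric

/-! ### The metric on the space of vacua -/

section Vacua

variable {n : ℕ} {M : Type*} [TopologicalSpace M] [ChartedSpace (EuclideanHalfSpace (n + 1)) M]
  [IsManifold (𝓡∂ (n + 1)) ∞ M] [CompactSpace M] [T2Space M] [MeasurableSpace M] [BorelSpace M]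

variable {h h' : Metric n M} {V W σ₁ σ₂ τ₁ τ₂ : VField n M}

/-- The partition of unity multiplies V only: cutting off keeps V smooth and boundary preserving,
whereas it would destroy the momentum constraint of W. -/
lemma greenIdentity (hflat : IsRicciFlat h) (hW : IsAdmissible h W) (hV : IsSmooth V)
    (hbV : BoundaryPreserving h V) [Nonempty M] : GreenIdentity h V W := by
  obtain ⟨t, ht⟩ := exists_finset_cover (n := n) (M := M)
  obtain ⟨ρ, hρ⟩ := SmoothPartitionOfUnity.exists_isSubordinate (𝓡∂ (n + 1)) (s := univ)
    isClosed_univ (fun c : t => (chart (n := n) (c : M)).source)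
    (fun c => isOpen_extChartAt_source (c : M)) fun x _ => by
      obtain ⟨c, hc, hx⟩ := mem_iUnion₂.1 (ht.symm ▸ mem_univ x : x ∈ ⋃ c ∈ t, _)
      exact mem_iUnion.2 ⟨⟨c, hc⟩, hx⟩
  have hpiece : ∀ i, GreenIdentity h (fun x => ρ i x • V x) W := fun i =>
    greenIdentity_of_support (c := (i : M)) hflat hW (hV.smul (ρ i).contMDiff)
      (hbV.smul _) (isClosed_tsupport (ρ i)).isCompact (hρ i) fun x hx => by
        rw [image_eq_zero_of_notMem_tsupport hx, zero_smul]
  have hsum : ∀ s : Finset t, GreenIdentity h (fun x => ∑ i ∈ s, ρ i x • V x) W := fun s => by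
    classical
    induction s using Finset.induction_on with
    | empty =>
      obtain ⟨c⟩ := ‹Nonempty M›
      have h0 : BoundaryPreserving h (fun _ => 0 : VField n M) := fun x _ => map_zero _
      have h1 : IsSmooth (fun _ => 0 : VField n M) := by
        simpa using hV.smul (contMDiff_const (c := (0 : ℝ)))
      simpa using greenIdentity_of_support (c := c) hflat hW h1 h0 isCompact_empty
        (empty_subset _) fun _ _ => rfl
    | insert a s ha ih =>
      simp only [Finset.sum_insert ha]
      exact (hpiece a).add hW.smooth hW.boundaryPreserving ih
  have hV1 : V = fun x => ∑ i, ρ i x • V x := by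
    ext1 x
    have h1 := ρ.sum_eq_one (mem_univ x)
    rw [finsum_eq_sum_of_fintype] at h1
    rw [← Finset.sum_smul, h1, one_smul]
  rw [hV1]
  exact hsum Finset.univ

lemma integrable_boundaryDensity (hflat : IsRicciFlat h) (h₁ : IsAdmissible h σ₁)
    (h₂ : IsAdmissible h σ₂) : Integrable (boundaryDensity h σ₁ σ₂) (bdryVolume h) := by
  rcases isEmpty_or_nonempty M with hM | hM
  · have h0 : bdryVolume h = 0 := Measure.ext fun A _ => by
      rw [eq_empty_of_isEmpty A, measure_empty, measure_empty]
    rw [h0]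
    exact integrable_zero_measure
  · exact (greenIdentity hflat h₂ h₁.smooth h₁.boundaryPreserving).integrable

lemma deWitt_eq_boundaryForm (hflat : IsRicciFlat h) (h₁ : IsAdmissible h σ₁)
    (h₂ : IsAdmissible h σ₂) :
    deWitt h (deformation h σ₁) (deformation h σ₂) = boundaryForm h σ₁ σ₂ := by
  rcases isEmpty_or_nonempty M with hM | hM
  · have h0 : bdryVolume h = 0 := Measure.ext fun A _ => by
      rw [eq_empty_of_isEmpty A, measure_empty, measure_empty]
    have h1 : riemVolume h = 0 := Measure.ext fun A _ => by
      rw [eq_empty_of_isEmpty A, measure_empty, measure_empty]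
    rw [deWitt, boundaryForm, h0, h1, integral_zero_measure, integral_zero_measure, mul_zero]
  · exact (greenIdentity hflat h₂ h₁.smooth h₁.boundaryPreserving).eq

variable (φ : M ≃ₘ^∞⟮𝓡∂ (n + 1), 𝓡∂ (n + 1)⟯ M)

lemma isInvertible_mfderiv (x : M) :
    (mfderiv (𝓡∂ (n + 1)) (𝓡∂ (n + 1)) φ x).IsInvertible :=
  ⟨φ.mfderivToContinuousLinearEquiv (by simp) x, rfl⟩

lemma isSmooth_mpullback (hV : IsSmooth V) :
    IsSmooth (VectorField.mpullback (𝓡∂ (n + 1)) (𝓡∂ (n + 1)) φ V) :=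
  ContMDiff.mpullback_vectorField hV φ.contMDiff (isInvertible_mfderiv φ) (by simp)

lemma mfderiv_mpullback (V : VField n M) (x : M) :
    mfderiv (𝓡∂ (n + 1)) (𝓡∂ (n + 1)) φ x
      (VectorField.mpullback (𝓡∂ (n + 1)) (𝓡∂ (n + 1)) φ V x) = V (φ x) :=
  (isInvertible_mfderiv φ x).self_apply_inverse _

/-- The DeWitt metric is invariant under diffeomorphisms. -/
lemma vacuaMetric_eq_deWitt (hp : IsPullback φ h' h) (hV : IsSmooth V) (hW : IsSmooth W) :
    vacuaMetric h φ V W = deWitt h' (deformation h' V) (deformation h' W) := by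
  have h1 : ∀ x, deWittDensity h
      (deformation h (VectorField.mpullback (𝓡∂ (n + 1)) (𝓡∂ (n + 1)) φ V))
      (deformation h (VectorField.mpullback (𝓡∂ (n + 1)) (𝓡∂ (n + 1)) φ W)) x =
        deWittDensity h' (deformation h' V) (deformation h' W) (φ x) := fun x => by
    rw [deWittDensity_self hV hW]
    exact deWittDensity_natural φ.contMDiff hp (isSmooth_mpullback φ hV) (isSmooth_mpullback φ hW)
      hV hW (mfderiv_mpullback φ V) (mfderiv_mpullback φ W) (mem_extChartAt_source _)
  have h2 := map_riemVolume φ.contMDiff φ.symm.contMDiff.continuous φ.symm_apply_apply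
    φ.apply_symm_apply hp
  rw [vacuaMetric, deWitt, deWitt, ← h2, integral_map φ.contMDiff.continuous.measurable.aemeasurable
    (continuous_deWittDensity hV hW).aestronglyMeasurable]
  simp only [h1]

lemma vacuaMetric_eq_boundaryForm (hflat : IsRicciFlat h') (hp : IsPullback φ h' h)
    (h₁ : IsAdmissible h' σ₁) (h₂ : IsAdmissible h' σ₂) :
    vacuaMetric h φ σ₁ σ₂ = boundaryForm h' σ₁ σ₂ := by
  rw [vacuaMetric_eq_deWitt φ hp h₁.smooth h₂.smooth, deWitt_eq_boundaryForm hflat h₁ h₂]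

lemma deWitt_symm (h : Metric n M) (k₁ k₂ : TensorField n M) : deWitt h k₁ k₂ = deWitt h k₂ k₁ := by
  rw [deWitt, deWitt, funext (deWittDensity_symm h k₁ k₂)]

/-- The symmetry is not visible in the integrand; it is inherited from the DeWitt metric. -/
lemma boundaryForm_symm (hflat : IsRicciFlat h) (h₁ : IsAdmissible h σ₁)
    (h₂ : IsAdmissible h σ₂) : boundaryForm h σ₁ σ₂ = boundaryForm h σ₂ σ₁ := by
  rw [← deWitt_eq_boundaryForm hflat h₁ h₂, ← deWitt_eq_boundaryForm hflat h₂ h₁, deWitt_symm]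

lemma boundaryForm_congr_left
    (h₁ : ∀ x ∈ (𝓡∂ (n + 1)).boundary M, tangentialPart h σ₁ x = tangentialPart h τ₁ x) :
    boundaryForm h σ₁ W = boundaryForm h τ₁ W := by
  refine integral_congr_ae ?_
  filter_upwards [ae_mem_boundary h] with x hx
  rw [boundaryDensity, boundaryDensity, h₁ x hx]

/-- The first field is replaced directly, since its derivatives do not enter. The second is moved to
the first slot by symmetry, although the integrand contains its normal derivative. -/
lemma boundaryForm_congr (hflat : IsRicciFlat h)
    (hσ₂ : IsAdmissible h σ₂) (hτ₁ : IsAdmissible h τ₁) (hτ₂ : IsAdmissible h τ₂)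
    (h₁ : ∀ x ∈ (𝓡∂ (n + 1)).boundary M, tangentialPart h σ₁ x = tangentialPart h τ₁ x)
    (h₂ : ∀ x ∈ (𝓡∂ (n + 1)).boundary M, tangentialPart h σ₂ x = tangentialPart h τ₂ x) :
    boundaryForm h σ₁ σ₂ = boundaryForm h τ₁ τ₂ := by
  rw [boundaryForm_congr_left h₁, boundaryForm_symm hflat hτ₁ hσ₂, boundaryForm_congr_left h₂,
    boundaryForm_symm hflat hτ₂ hτ₁]

/-- A boundary preserving gradient of a function that vanishes on the boundary vanishes there. -/
lemma grad_eq_zero {α : M → ℝ} (hα : ContMDiff (𝓡∂ (n + 1)) 𝓘(ℝ, ℝ) ∞ α)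
    (hα0 : ∀ x ∈ (𝓡∂ (n + 1)).boundary M, α x = 0)
    (hbp : BoundaryPreserving h (grad h α)) {x : M} (hb : x ∈ (𝓡∂ (n + 1)).boundary M) :
    grad h α x = 0 := by
  have hy := mem_extChartAt_target (I := 𝓡∂ (n + 1)) x
  have h0 := chart_self_zero hb
  have h1 : fderivWithin ℝ (α ∘ (chart x).symm) (halfSpace n) (chart x x)
      (vecChart (grad h α) x (chart x x)) = 0 :=
    fderivWithin_eq_zero_of_boundary (isRelOpen_target x) hy
      ((smoothAlong_comp_symm hα x).differentiableWithinAt hy)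
      (fun z hz hz0 => hα0 _ ((symm_mem_boundary_iff hz).2 hz0)) h0 (hbp.vecChart_zero hy h0)
  -- The gradient is tangential and α vanishes along the boundary, so dα(∇α) = 0. This number is
  -- h(∇α, ∇α), and definiteness of the metric concludes.
  rw [← mfderiv_dSymm hα hy, dSymm_vecChart _ hy, ← inner_grad (h := h), extChartAt_to_inv] at h1
  by_contra hne
  exact (h.pos x _ hne).ne' h1

lemma tangentialPart_add_grad {α : M → ℝ} (hα : ContMDiff (𝓡∂ (n + 1)) 𝓘(ℝ, ℝ) ∞ α)
    (hα0 : ∀ x ∈ (𝓡∂ (n + 1)).boundary M, α x = 0)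
    (hbp : BoundaryPreserving h (grad h α)) (V : VField n M) :
    ∀ x ∈ (𝓡∂ (n + 1)).boundary M,
      tangentialPart h (fun x => V x + grad h α x) x = tangentialPart h V x := fun x hx => by
  rw [tangentialPart, tangentialPart, grad_eq_zero hα hα0 hbp hx, add_zero]

end Vacua
end VacuaMetric
end

theorem mainTheorem1 {n : ℕ} {M : Type*} [TopologicalSpace M]
    [ChartedSpace (EuclideanHalfSpace (n + 1)) M] [IsManifold (𝓡∂ (n + 1)) ∞ M]
    [CompactSpace M] [T2Space M] [MeasurableSpace M] [BorelSpace M]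
    (hbar : VacuaMetric.Metric n M) (hflat : VacuaMetric.IsRicciFlat hbar) :
    -- the metric on the space of vacua is the boundary integral
    (∀ (φ : M ≃ₘ^∞⟮𝓡∂ (n + 1), 𝓡∂ (n + 1)⟯ M) (h : VacuaMetric.Metric n M),
      VacuaMetric.IsPullback φ hbar h →
      ∀ σ₁ σ₂ : VacuaMetric.VField n M,
        VacuaMetric.IsAdmissible hbar σ₁ → VacuaMetric.IsAdmissible hbar σ₂ →
        Integrable (VacuaMetric.deWittDensity h
          (VacuaMetric.deformation h
            (VectorField.mpullback (𝓡∂ (n + 1)) (𝓡∂ (n + 1)) φ σ₁))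
          (VacuaMetric.deformation h
            (VectorField.mpullback (𝓡∂ (n + 1)) (𝓡∂ (n + 1)) φ σ₂)))
          (VacuaMetric.riemVolume h) ∧
        Integrable (VacuaMetric.boundaryDensity hbar σ₁ σ₂) (VacuaMetric.bdryVolume hbar) ∧
        VacuaMetric.vacuaMetric h φ σ₁ σ₂ = VacuaMetric.boundaryForm hbar σ₁ σ₂) ∧
    -- the normal derivative of a boundary preserving gradient
    (∀ α : M → ℝ, ContMDiff (𝓡∂ (n + 1)) 𝓘(ℝ, ℝ) ∞ α →
      VacuaMetric.BoundaryPreserving hbar (VacuaMetric.grad hbar α) →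
      ∀ x ∈ (𝓡∂ (n + 1)).boundary M, ∀ v : TangentSpace (𝓡∂ (n + 1)) x,
        hbar.inner x (VacuaMetric.outwardNormal hbar x) v = 0 →
        hbar.inner x (VacuaMetric.normalDeriv hbar (VacuaMetric.grad hbar α) x) v =
          - VacuaMetric.extrinsicCurvature hbar x v
              (VacuaMetric.tangentialPart hbar (VacuaMetric.grad hbar α) x)) ∧
    -- the gauge ambiguity drops out
    (∀ α β : M → ℝ, ContMDiff (𝓡∂ (n + 1)) 𝓘(ℝ, ℝ) ∞ α →
      ContMDiff (𝓡∂ (n + 1)) 𝓘(ℝ, ℝ) ∞ β →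
      (∀ x ∈ (𝓡∂ (n + 1)).boundary M, α x = 0) → (∀ x ∈ (𝓡∂ (n + 1)).boundary M, β x = 0) →
      VacuaMetric.BoundaryPreserving hbar (VacuaMetric.grad hbar α) →
      VacuaMetric.BoundaryPreserving hbar (VacuaMetric.grad hbar β) →
      ∀ σ₁ σ₂ : VacuaMetric.VField n M,
        VacuaMetric.IsAdmissible hbar σ₁ → VacuaMetric.IsAdmissible hbar σ₂ →
        VacuaMetric.IsAdmissible hbar (fun x => σ₁ x + VacuaMetric.grad hbar α x) ∧
        VacuaMetric.IsAdmissible hbar (fun x => σ₂ x + VacuaMetric.grad hbar β x) ∧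
        VacuaMetric.boundaryForm hbar (fun x => σ₁ x + VacuaMetric.grad hbar α x)
            (fun x => σ₂ x + VacuaMetric.grad hbar β x) =
          VacuaMetric.boundaryForm hbar σ₁ σ₂ ∧
        ∀ (φ : M ≃ₘ^∞⟮𝓡∂ (n + 1), 𝓡∂ (n + 1)⟯ M) (h : VacuaMetric.Metric n M),
          VacuaMetric.IsPullback φ hbar h →
          VacuaMetric.vacuaMetric h φ (fun x => σ₁ x + VacuaMetric.grad hbar α x)
              (fun x => σ₂ x + VacuaMetric.grad hbar β x) =
            VacuaMetric.vacuaMetric h φ σ₁ σ₂) ∧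
    -- the metric depends only on the tangential boundary vector fields
    (∀ σ₁ σ₂ τ₁ τ₂ : VacuaMetric.VField n M,
      VacuaMetric.IsAdmissible hbar σ₁ → VacuaMetric.IsAdmissible hbar σ₂ →
      VacuaMetric.IsAdmissible hbar τ₁ → VacuaMetric.IsAdmissible hbar τ₂ →
      (∀ x ∈ (𝓡∂ (n + 1)).boundary M,
        VacuaMetric.tangentialPart hbar σ₁ x = VacuaMetric.tangentialPart hbar τ₁ x) →
      (∀ x ∈ (𝓡∂ (n + 1)).boundary M,
        VacuaMetric.tangentialPart hbar σ₂ x = VacuaMetric.tangentialPart hbar τ₂ x) →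
      VacuaMetric.boundaryForm hbar σ₁ σ₂ = VacuaMetric.boundaryForm hbar τ₁ τ₂ ∧
      ∀ (φ : M ≃ₘ^∞⟮𝓡∂ (n + 1), 𝓡∂ (n + 1)⟯ M) (h : VacuaMetric.Metric n M),
        VacuaMetric.IsPullback φ hbar h →
        VacuaMetric.vacuaMetric h φ σ₁ σ₂ = VacuaMetric.vacuaMetric h φ τ₁ τ₂) := by
  refine ⟨fun φ h hp σ₁ σ₂ h₁ h₂ => ⟨?_, ?_, ?_⟩, fun α hα hbp x hb v hv => ?_,
    fun α β hα hβ hα0 hβ0 hbα hbβ σ₁ σ₂ h₁ h₂ => ?_,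
    fun σ₁ σ₂ τ₁ τ₂ h₁ h₂ h₁' h₂' ht₁ ht₂ => ?_⟩
  · exact VacuaMetric.integrable_of_continuous (VacuaMetric.continuous_deWittDensity
      (VacuaMetric.isSmooth_mpullback φ h₁.smooth) (VacuaMetric.isSmooth_mpullback φ h₂.smooth))
  · exact VacuaMetric.integrable_boundaryDensity hflat h₁ h₂
  · exact VacuaMetric.vacuaMetric_eq_boundaryForm φ hflat hp h₁ h₂
  · exact VacuaMetric.inner_normalDeriv_grad hα hbp hb v hv
  · have h₁' := h₁.add_grad hα hbα
    have h₂' := h₂.add_grad hβ hbβ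
    -- Gauge invariance is a case of dependence on the tangential boundary values alone, as both
    -- gradients vanish on the boundary.
    have key := VacuaMetric.boundaryForm_congr hflat h₂' h₁ h₂
      (VacuaMetric.tangentialPart_add_grad hα hα0 hbα σ₁)
      (VacuaMetric.tangentialPart_add_grad hβ hβ0 hbβ σ₂)
    refine ⟨h₁', h₂', key, fun φ h hp => ?_⟩
    rw [VacuaMetric.vacuaMetric_eq_boundaryForm φ hflat hp h₁' h₂',
      VacuaMetric.vacuaMetric_eq_boundaryForm φ hflat hp h₁ h₂, key]
  · have key := VacuaMetric.boundaryForm_congr hflat h₂ h₁' h₂' ht₁ ht₂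
    refine ⟨key, fun φ h hp => ?_⟩
    rw [VacuaMetric.vacuaMetric_eq_boundaryForm φ hflat hp h₁ h₂,
      VacuaMetric.vacuaMetric_eq_boundaryForm φ hflat hp h₁' h₂', key]
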